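/- Let $r_0,q_0,g_0:\mathbb R\to\mathbb C$ be Schwartz functions (only their restrictions to $[0,\infty)$ matter) with $q_0(0)=g_0(0)$. For $\operatorname{Im}k\le 0$ put $\hat f(k)=\int_0^\infty e^{-ikx}f(x)\,dx$, and put $\tilde f(w,t)=\int_0^t e^{-iw\tau}f(\tau)\,d\tau$. Let $\mu(k)=(1+k^2)^{1/2}=\sqrt{|1+k^2|}\,e^{i(\theta_1+\theta_2-\pi)/2}$, where $\theta_1,\theta_2\in[0,2\pi)$ are the angles of $k+i$ and $k-i$ measured counterclockwise from the direction $-i$ (branch cut $i[-1,1]$, $\mu(k)\sim k$ at infinity), and $\omega=\omega(k)=k/\mu(k)$. Let $\mathcal C$ be a closed contour in the open upper half-plane that winds once counterclockwise around $i$. For $x>0$, $t\ge 0$ define $$\begin{aligned} r(x,t)&=\frac1{2\pi}\int_{\mathbb R}e^{ikx}\,\tfrac12\big[(e^{i\omega t}+e^{-i\omega t})\hat r_0(k)-\mu(k)(e^{i\omega t}-e^{-i\omega t})\hat q_0(k)\big]dk\\ &\quad+\frac1{2\pi}\int_{\mathcal C}e^{ikx}\,\tfrac12\big[(e^{i\omega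 t}+e^{-i\omega t})\hat r_0(-k)+\mu(k)(e^{i\omega t}-e^{-i\omega t})\hat q_0(-k)\big]dk\\ &\quad+\frac1{2\pi}\int_{\mathcal C}e^{ikx}\Big\{e^{i\omega t}\tilde g_0(\omega,t)+e^{-i\omega t}\tilde g_0(-\omega,t)+i\omega\big[e^{i\omega t}\widetilde{g_0'}(\omega,t)-e^{-i\omega t}\widetilde{g_0'}(-\omega,t)\big]\Big\}dk,\\ q(x,t)&=\frac1{2\pi}\int_{\mathbb R}e^{ikx}\,\tfrac12\big[(e^{i\omega t}+e^{-i\omega t})\hat q_0(k)-\tfrac1{\mu(k)}(e^{i\omega t}-e^{-i\omega t})\hat r_0(k)\big]dk\\ &\quad-\frac1{2\pi}\int_{\mathcal C}e^{ikx}\,\tfrac12\big[(e^{i\omega t}+e^{-i\omega t})\hat q_0(-k)+\tfrac1{\mu(k)}(e^{i\omega t}-e^{-i\omega t})\hat r_0(-k)\big]dk\\ &\quad-\frac1{2\pi}\int_{\mathcal C}e^{ikx}\Big\{\tfrac1{\mu(k)}\big[e^{i\omega t}\tilde g_0(\omega,t)-e^{-i\omega t}\tilde g_0(-\omega,t)\big]+\tfrac{ik}{1+k^2}\big[e^{i\omega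 t}\widetilde{g_0'}(\omega,t)+e^{-i\omega t}\widetilde{g_0'}(-\omega,t)\big]\Big\}dk. \end{aligned}$$ Here the integral over $\mathbb R$ in $q$ is a (convergent) improper integral. The integrand over $\mathbb R$ in $r$ need not decay at infinity, and its integral is understood as $\lim_{\varepsilon\to0^+}\int_{\mathbb R}e^{-\varepsilon k^2}(\cdots)\,dk$; this limit exists, and it equals the improper integral, which converges, whenever $q_0(0)\sin t=0$. Then $r,q$ extend continuously to $x\ge0$, $t\ge 0$ (the values at $x=0$ being the limits as $x\to0^+$), and the extension is a classical solution of the linearized classical Boussinesq problem $$r_t+q_x=0,\quad q_t+r_x-q_{xxt}=0\quad(x>0,\ t>0),$$ $$r(x,0)=r_0(x),\quad q(x,0)=q_0(x)\quad(x\ge0),\qquad q(0,t)=g_0(t)\quad(t\ge0),$$ with $r\in C^1$ and $q\in C^3$ for $x>0$, $t>0$. -/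

import Mathlib

open Complex MeasureTheory Filter Topology Set
open scoped SchwartzMap

noncomputable section

namespace Boussinesq

/-- The angle in `[0, 2π)`, measured counterclockwise, from the downward vertical direction `-i`
to the vector `z` (note that `z = |z| e^{i(θ - π/2)}` iff `i z = |z| e^{iθ}`). -/
def angleFromDown (z : ℂ) : ℝ := toIcoMod Real.two_pi_pos 0 (arg (I * z))

/-- The square root `μ(k) = (1 + k²)^{1/2} = √|1 + k²| e^{i(θ₁ + θ₂ - π)/2}` with branch cut
`i[-1, 1]`; here `θ₁`, `θ₂` are the angles of `k + i` and `k - i`. On the cut this is the limit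
from the right, and `μ(k) ~ k` at infinity. -/
def mu (k : ℂ) : ℂ :=
  (Real.sqrt ‖1 + k ^ 2‖ : ℂ) *
    exp (I * (((angleFromDown (k + I) + angleFromDown (k - I) - Real.pi) / 2 : ℝ) : ℂ))

/-- The dispersion relation `ω(k) = k / μ(k)`. -/
def omega (k : ℂ) : ℂ := k / mu k

/-- Half-line Fourier transform `∫₀^∞ e^{-ikx} f(x) dx` (used for `Im k ≤ 0`). -/
def halfLineFourier (f : ℝ → ℂ) (k : ℂ) : ℂ := ∫ x in Ioi (0 : ℝ), exp (-I * k * x) * f x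

/-- Time transform `∫₀^t e^{-iwτ} f(τ) dτ`. -/
def timeTransform (f : ℝ → ℂ) (w : ℂ) (t : ℝ) : ℂ := ∫ τ in (0 : ℝ)..t, exp (-I * w * τ) * f τ

/-- Integral of `F` along the curve `γ : [0, 1] → ℂ`. -/
def contourIntegral (γ : ℝ → ℂ) (F : ℂ → ℂ) : ℂ :=
  ∫ u in (0 : ℝ)..1, F (γ u) * derivWithin γ (Icc 0 1) u

/-- `γ : [0, 1] → ℂ` is a closed contour in the open upper half-plane going once counterclockwise
around `i`. The parametrization is `C¹` but its speed may vanish, so corners are allowed. -/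
structure IsContourAroundI (γ : ℝ → ℂ) : Prop where
  contDiffOn : ContDiffOn ℝ 1 γ (Icc 0 1)
  closed : γ 0 = γ 1
  im_pos : ∀ u ∈ Icc (0 : ℝ) 1, 0 < (γ u).im
  ne_I : ∀ u ∈ Icc (0 : ℝ) 1, γ u ≠ I
  winding : contourIntegral γ (fun k => 1 / (k - I)) = 2 * Real.pi * I

/-- The improper integral of `F` over `ℝ`, both ends independently, converges to `J`. -/
def HasImproperIntegral (F : ℝ → ℂ) (J : ℂ) : Prop :=
  Tendsto (fun p : ℝ × ℝ => ∫ k in p.1..p.2, F k) (atBot ×ˢ atTop) (𝓝 J)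

/-- The integral of `F` over `ℝ`, summed with Gaussian cut-off
`lim_{ε → 0+} ∫ e^{-ε k²} F(k) dk`, is `J`. -/
def HasGaussIntegral (F : ℝ → ℂ) (J : ℂ) : Prop :=
  Tendsto (fun ε : ℝ => ∫ k : ℝ, (Real.exp (-ε * k ^ 2) : ℂ) * F k) (𝓝[>] 0) (𝓝 J)

/-- Integrand over `ℝ` in the formula for `r`. -/
def lineIntegrandR (r₀ q₀ : ℝ → ℂ) (x t : ℝ) (k : ℝ) : ℂ :=
  exp (I * k * x) * (1 / 2 *
    ((exp (I * omega k * t) + exp (-I * omega k * t)) * halfLineFourier r₀ k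
      - mu k * (exp (I * omega k * t) - exp (-I * omega k * t)) * halfLineFourier q₀ k))

/-- Integrand over `ℝ` in the formula for `q`. -/
def lineIntegrandQ (r₀ q₀ : ℝ → ℂ) (x t : ℝ) (k : ℝ) : ℂ :=
  exp (I * k * x) * (1 / 2 *
    ((exp (I * omega k * t) + exp (-I * omega k * t)) * halfLineFourier q₀ k
      - 1 / mu k * (exp (I * omega k * t) - exp (-I * omega k * t)) * halfLineFourier r₀ k))

/-- First contour integrand in the formula for `r` (initial data). -/
def contourIntegrandR₁ (r₀ q₀ : ℝ → ℂ) (x t : ℝ) (k : ℂ) : ℂ :=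
  exp (I * k * x) * (1 / 2 *
    ((exp (I * omega k * t) + exp (-I * omega k * t)) * halfLineFourier r₀ (-k)
      + mu k * (exp (I * omega k * t) - exp (-I * omega k * t)) * halfLineFourier q₀ (-k)))

/-- Second contour integrand in the formula for `r` (boundary data). -/
def contourIntegrandR₂ (g₀ : ℝ → ℂ) (x t : ℝ) (k : ℂ) : ℂ :=
  exp (I * k * x) *
    ((exp (I * omega k * t) * timeTransform g₀ (omega k) t
        + exp (-I * omega k * t) * timeTransform g₀ (-omega k) t)
      + I * omega k * (exp (I * omega k * t) * timeTransform (deriv g₀) (omega k) t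
        - exp (-I * omega k * t) * timeTransform (deriv g₀) (-omega k) t))

/-- First contour integrand in the formula for `q` (initial data). -/
def contourIntegrandQ₁ (r₀ q₀ : ℝ → ℂ) (x t : ℝ) (k : ℂ) : ℂ :=
  exp (I * k * x) * (1 / 2 *
    ((exp (I * omega k * t) + exp (-I * omega k * t)) * halfLineFourier q₀ (-k)
      + 1 / mu k * (exp (I * omega k * t) - exp (-I * omega k * t)) * halfLineFourier r₀ (-k)))

/-- Second contour integrand in the formula for `q` (boundary data). -/
def contourIntegrandQ₂ (g₀ : ℝ → ℂ) (x t : ℝ) (k : ℂ) : ℂ :=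
  exp (I * k * x) *
    (1 / mu k * (exp (I * omega k * t) * timeTransform g₀ (omega k) t
        - exp (-I * omega k * t) * timeTransform g₀ (-omega k) t)
      + I * k / (1 + k ^ 2) * (exp (I * omega k * t) * timeTransform (deriv g₀) (omega k) t
        + exp (-I * omega k * t) * timeTransform (deriv g₀) (-omega k) t))

/-- `v` is the value at `(x, t)` of the formula for `r`. The integrand over `ℝ` is bounded but
tends to a nonzero multiple of `e^{ikx}` at infinity when `q₀(0) sin t ≠ 0`, so its integral is
taken with a Gaussian cut-off; when `q₀(0) sin t = 0` it converges also as an improper integral,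
to the same value. -/
def IsFormulaValueR (r₀ q₀ g₀ : ℝ → ℂ) (γ : ℝ → ℂ) (x t : ℝ) (v : ℂ) : Prop :=
  ∃ J : ℂ, HasGaussIntegral (lineIntegrandR r₀ q₀ x t) J ∧
    (q₀ 0 * (Real.sin t : ℂ) = 0 → HasImproperIntegral (lineIntegrandR r₀ q₀ x t) J) ∧
    v = 1 / (2 * Real.pi) * J
      + 1 / (2 * Real.pi) * contourIntegral γ (contourIntegrandR₁ r₀ q₀ x t)
      + 1 / (2 * Real.pi) * contourIntegral γ (contourIntegrandR₂ g₀ x t)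

/-- `v` is the value at `(x, t)` of the formula for `q`, the integral over `ℝ` being a convergent
improper integral. -/
def IsFormulaValueQ (r₀ q₀ g₀ : ℝ → ℂ) (γ : ℝ → ℂ) (x t : ℝ) (v : ℂ) : Prop :=
  ∃ J : ℂ, HasImproperIntegral (lineIntegrandQ r₀ q₀ x t) J ∧
    v = 1 / (2 * Real.pi) * J
      - 1 / (2 * Real.pi) * contourIntegral γ (contourIntegrandQ₁ r₀ q₀ x t)
      - 1 / (2 * Real.pi) * contourIntegral γ (contourIntegrandQ₂ g₀ x t)

/-- `(r, q)` is a classical solution of `r_t + q_x = 0`, `q_t + r_x - q_{xxt} = 0` in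
`x > 0`, `t > 0` with `r(x,0) = r₀(x)`, `q(x,0) = q₀(x)` for `x ≥ 0` and `q(0,t) = g₀(t)` for
`t ≥ 0`: both functions are continuous on the closed quadrant, and `r` is `C¹`, `q` is `C³` in the
open one (so the order of derivatives in `q_{xxt}` is immaterial). -/
structure IsClassicalSolution (r₀ q₀ g₀ : ℝ → ℂ) (r q : ℝ → ℝ → ℂ) : Prop where
  continuousOn_r : ContinuousOn (fun p : ℝ × ℝ => r p.1 p.2) (Ici 0 ×ˢ Ici 0)
  continuousOn_q : ContinuousOn (fun p : ℝ × ℝ => q p.1 p.2) (Ici 0 ×ˢ Ici 0)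
  contDiffOn_r : ContDiffOn ℝ 1 (fun p : ℝ × ℝ => r p.1 p.2) (Ioi 0 ×ˢ Ioi 0)
  contDiffOn_q : ContDiffOn ℝ 3 (fun p : ℝ × ℝ => q p.1 p.2) (Ioi 0 ×ˢ Ioi 0)
  eq_one : ∀ x t : ℝ, 0 < x → 0 < t →
    deriv (fun s => r x s) t + deriv (fun y => q y t) x = 0
  eq_two : ∀ x t : ℝ, 0 < x → 0 < t →
    deriv (fun s => q x s) t + deriv (fun y => r y t) x
      - deriv (fun s => iteratedDeriv 2 (fun y => q y s) x) t = 0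
  initial_r : ∀ x : ℝ, 0 ≤ x → r x 0 = r₀ x
  initial_q : ∀ x : ℝ, 0 ≤ x → q x 0 = q₀ x
  boundary_q : ∀ t : ℝ, 0 ≤ t → q 0 t = g₀ t

end Boussinesq

end

/-!
The formulas are even in the branched square root `μ`, so every integrand is built from entire
functions of `ω² = k² / (1 + k²)` and is single-valued, with `i` as its only singularity in the
upper half-plane. Each wave `e^{ikx}` with these amplitudes solves the system up to a term in `g₀`
that is holomorphic in the upper half-plane and hence integrates to zero over the contour.

To give the integral over `ℝ` a meaning that can be differentiated, split the half-line transform of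
a Schwartz function into its boundary jet, a polynomial in `1 / (1 + ik)` without constant term, and
a tail of size `|k|⁻⁶`. The tail integrals converge absolutely together with the derivatives needed.
The jets extend to the upper half-plane, and for `x > 0` their integrals move to the contour through
large rectangles, which gives expressions that are smooth for all real `x` and `t`.

At `t = 0` the contour integrands are holomorphic in the upper half-plane and only Fourier inversion
on the line remains. At `x = 0` the tails reflected to the upper half-plane cancel, and the
remaining amplitude is odd, so its contour integral is given by its coefficient of `1 / k` at
infinity; with `q₀(0) = g₀(0)` this coefficient yields `g₀(t)`.
-/

noncomputable section

namespace Boussinesq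

/-! ### The dispersion relation -/

theorem norm_mul_exp_angleFromDown (z : ℂ) :
    (‖z‖ : ℂ) * exp (I * angleFromDown z) = I * z := by
  have h : (I * angleFromDown z : ℂ) = arg (I * z) * I
      - (toIcoDiv Real.two_pi_pos 0 (arg (I * z)) : ℤ) * (2 * Real.pi * I) := by
    rw [angleFromDown, ← self_sub_toIcoDiv_zsmul]
    push_cast [zsmul_eq_mul]
    ring
  rw [h, exp_sub, exp_int_mul_two_pi_mul_I, div_one]
  simpa using norm_mul_exp_arg_mul_I (I * z)

theorem mu_sq (k : ℂ) : mu k ^ 2 = 1 + k ^ 2 := by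
  have hfactor : 1 + k ^ 2 = (k + I) * (k - I) := by linear_combination I_sq
  have hsqrt : ((Real.sqrt ‖1 + k ^ 2‖ : ℝ) : ℂ) ^ 2 = (‖k + I‖ : ℂ) * ‖k - I‖ := by
    rw [← ofReal_pow, Real.sq_sqrt (norm_nonneg _), hfactor, norm_mul, ofReal_mul]
  have hexp :
      exp (I * (((angleFromDown (k + I) + angleFromDown (k - I) - Real.pi) / 2 : ℝ) : ℂ)) ^ 2
        = exp (I * angleFromDown (k + I)) * exp (I * angleFromDown (k - I)) * (-1) := by
    rw [← exp_nat_mul, ← exp_add, ← exp_neg_pi_mul_I, ← exp_add]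
    congr 1
    push_cast
    ring
  rw [mu, mul_pow, hsqrt, hexp]
  calc _ = (‖k + I‖ * exp (I * angleFromDown (k + I))) *
        (‖k - I‖ * exp (I * angleFromDown (k - I))) * (-1) := by ring
    _ = 1 + k ^ 2 := by
      rw [norm_mul_exp_angleFromDown, norm_mul_exp_angleFromDown, hfactor]
      linear_combination (-(k + I) * (k - I)) * I_sq

theorem mu_ne_zero {k : ℂ} (hk : 1 + k ^ 2 ≠ 0) : mu k ≠ 0 := by
  rwa [← mu_sq, pow_ne_zero_iff two_ne_zero] at hk

theorem mu_mul_omega {k : ℂ} (hk : 1 + k ^ 2 ≠ 0) : mu k * omega k = k :=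
  mul_div_cancel₀ _ (mu_ne_zero hk)

theorem one_div_mu_mul_omega (k : ℂ) : 1 / mu k * omega k = k / (1 + k ^ 2) := by
  rw [omega, ← mu_sq]
  ring

/-- `ω²` as a function of the wave number; unlike `ω` it is single-valued, with poles only at
`k = ±i`. -/
def omegaSq (k : ℂ) : ℂ := k ^ 2 / (1 + k ^ 2)

theorem omega_sq (k : ℂ) : omega k ^ 2 = omegaSq k := by
  rw [omega, div_pow, mu_sq, omegaSq]

/-! ### Trigonometric functions of `ω t` as entire functions of `ω²` -/

/-- The entire function `w ↦ cos √w`. -/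
def cosSqrt (w : ℂ) : ℂ := ∑' n : ℕ, (-1) ^ n * w ^ n / ((2 * n).factorial : ℂ)

/-- The entire function `w ↦ sin √w / √w`. -/
def sincSqrt (w : ℂ) : ℂ := ∑' n : ℕ, (-1) ^ n * w ^ n / ((2 * n + 1).factorial : ℂ)

theorem cosSqrt_sq (w : ℂ) : cosSqrt (w ^ 2) = cos w := by
  rw [cosSqrt, ← (hasSum_cos w).tsum_eq]
  simp only [pow_mul]

theorem mul_sincSqrt_sq (w : ℂ) : w * sincSqrt (w ^ 2) = sin w := by
  rw [sincSqrt, ← (hasSum_sin w).tsum_eq, ← tsum_mul_left]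
  congr 1 with n
  ring

theorem sincSqrt_zero : sincSqrt 0 = 1 := by
  rw [sincSqrt, tsum_eq_single 0 fun n hn => by simp [hn]]
  simp

theorem differentiable_tsum_mul_pow {c : ℕ → ℂ} (hc : ∀ n, ‖c n‖ ≤ 1 / (n.factorial : ℝ)) :
    Differentiable ℂ (fun w : ℂ => ∑' n : ℕ, c n * w ^ n) := by
  intro w
  have hd : DifferentiableOn ℂ (fun w : ℂ => ∑' n : ℕ, c n * w ^ n)
      (Metric.ball 0 (‖w‖ + 1)) := by
    refine differentiableOn_tsum_of_summable_norm (Real.summable_pow_div_factorial (‖w‖ + 1))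
      (fun n => by fun_prop) Metric.isOpen_ball fun n v hv => ?_
    rw [mem_ball_zero_iff] at hv
    rw [norm_mul, norm_pow, div_eq_inv_mul, ← one_div]
    gcongr
    exact hc n
  exact hd.differentiableAt (Metric.isOpen_ball.mem_nhds (by simp))

theorem norm_neg_one_pow_div_factorial_le {m n : ℕ} (h : n ≤ m) :
    ‖(-1) ^ n / (m.factorial : ℂ)‖ ≤ 1 / (n.factorial : ℝ) := by
  rw [norm_div, norm_pow, norm_neg, norm_one, one_pow, norm_natCast]
  gcongr

@[fun_prop]
theorem differentiable_cosSqrt : Differentiable ℂ cosSqrt := by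
  have h := differentiable_tsum_mul_pow fun n =>
    norm_neg_one_pow_div_factorial_le (by lia : n ≤ 2 * n)
  simp only [div_mul_eq_mul_div] at h
  exact h

@[fun_prop]
theorem differentiable_sincSqrt : Differentiable ℂ sincSqrt := by
  have h := differentiable_tsum_mul_pow fun n =>
    norm_neg_one_pow_div_factorial_le (by lia : n ≤ 2 * n + 1)
  simp only [div_mul_eq_mul_div] at h
  exact h

@[fun_prop]
theorem continuous_cosSqrt : Continuous cosSqrt := differentiable_cosSqrt.continuous

@[fun_prop]
theorem continuous_sincSqrt : Continuous sincSqrt := differentiable_sincSqrt.continuous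

/-- `cos (ω t)` as a function of `z = ω²`. -/
def cosTime (z : ℂ) (t : ℝ) : ℂ := cosSqrt (z * t ^ 2)

/-- `sin (ω t) / ω` as a function of `z = ω²`. -/
def sinTime (z : ℂ) (t : ℝ) : ℂ := t * sincSqrt (z * t ^ 2)

theorem cosTime_sq (w : ℂ) (t : ℝ) : cosTime (w ^ 2) t = cos (w * t) := by
  rw [cosTime, ← mul_pow, cosSqrt_sq]

theorem mul_sinTime_sq (w : ℂ) (t : ℝ) : w * sinTime (w ^ 2) t = sin (w * t) := by
  rw [sinTime, ← mul_pow, ← mul_assoc, mul_sincSqrt_sq]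

@[simp] theorem cosTime_zero_right (z : ℂ) : cosTime z 0 = 1 := by
  simpa [cosTime] using cosSqrt_sq 0

@[simp] theorem cosTime_zero_left (t : ℝ) : cosTime 0 t = 1 := by
  simpa [cosTime] using cosSqrt_sq 0

@[simp] theorem sinTime_zero_right (z : ℂ) : sinTime z 0 = 0 := by
  simp [sinTime]

@[simp] theorem sinTime_zero_left (t : ℝ) : sinTime 0 t = t := by
  simp [sinTime, sincSqrt_zero]

theorem cosTime_one (t : ℝ) : cosTime 1 t = Real.cos t := by
  simpa using cosTime_sq 1 t

theorem sinTime_one (t : ℝ) : sinTime 1 t = Real.sin t := by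
  simpa using mul_sinTime_sq 1 t

theorem exists_sq_eq (z : ℂ) : ∃ w : ℂ, w ^ 2 = z :=
  IsAlgClosed.exists_pow_nat_eq z two_pos

theorem cosTime_sq_add_mul_sinTime_sq (z : ℂ) (t : ℝ) :
    cosTime z t ^ 2 + z * sinTime z t ^ 2 = 1 := by
  obtain ⟨w, rfl⟩ := exists_sq_eq z
  rw [← mul_pow, mul_sinTime_sq, cosTime_sq, cos_sq_add_sin_sq]

theorem exp_I_mul_omega (k : ℂ) (t : ℝ) :
    exp (I * omega k * t) = cosTime (omegaSq k) t + I * omega k * sinTime (omegaSq k) t := by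
  rw [← omega_sq, mul_assoc, mul_assoc, mul_sinTime_sq, cosTime_sq, mul_comm I, exp_mul_I,
    mul_comm I]

theorem exp_neg_I_mul_omega (k : ℂ) (t : ℝ) :
    exp (-I * omega k * t) = cosTime (omegaSq k) t - I * omega k * sinTime (omegaSq k) t := by
  rw [← omega_sq, mul_assoc, mul_assoc I, mul_sinTime_sq, cosTime_sq, neg_mul, mul_comm I,
    ← neg_mul, exp_mul_I, cos_neg, sin_neg]
  ring

theorem exp_add_exp_neg_omega (k : ℂ) (t : ℝ) :
    exp (I * omega k * t) + exp (-I * omega k * t) = 2 * cosTime (omegaSq k) t := by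
  rw [exp_I_mul_omega, exp_neg_I_mul_omega]
  ring

theorem exp_sub_exp_neg_omega (k : ℂ) (t : ℝ) :
    exp (I * omega k * t) - exp (-I * omega k * t)
      = 2 * I * omega k * sinTime (omegaSq k) t := by
  rw [exp_I_mul_omega, exp_neg_I_mul_omega]
  ring

@[fun_prop]
theorem continuous_cosTime {X : Type*} [TopologicalSpace X] {z : X → ℂ} {t : X → ℝ}
    (hz : Continuous z) (ht : Continuous t) : Continuous fun x => cosTime (z x) (t x) := by
  unfold cosTime
  fun_prop

@[fun_prop]
theorem continuous_sinTime {X : Type*} [TopologicalSpace X] {z : X → ℂ} {t : X → ℝ}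
    (hz : Continuous z) (ht : Continuous t) : Continuous fun x => sinTime (z x) (t x) := by
  unfold sinTime
  fun_prop

@[fun_prop]
theorem differentiable_cosTime (t : ℝ) : Differentiable ℂ (fun z => cosTime z t) := by
  unfold cosTime
  fun_prop

@[fun_prop]
theorem differentiable_sinTime (t : ℝ) : Differentiable ℂ (fun z => sinTime z t) := by
  unfold sinTime
  fun_prop

theorem hasDerivAt_cosTime (z : ℂ) (t : ℝ) :
    HasDerivAt (cosTime z) (-z * sinTime z t) t := by
  obtain ⟨w, rfl⟩ := exists_sq_eq z
  have hcos : HasDerivAt (fun s : ℂ => cos (w * s)) (-sin (w * t) * w) (t : ℂ) := by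
    simpa using ((hasDerivAt_id (t : ℂ)).const_mul w).ccos
  rw [show cosTime (w ^ 2) = fun s : ℝ => cos (w * s) from funext fun s => cosTime_sq w s]
  convert! hcos.comp_ofReal using 1
  rw [← mul_sinTime_sq]
  ring

theorem hasDerivAt_sinTime (z : ℂ) (t : ℝ) :
    HasDerivAt (sinTime z) (cosTime z t) t := by
  obtain ⟨w, rfl⟩ := exists_sq_eq z
  rcases eq_or_ne w 0 with rfl | hw
  · have hid : sinTime (0 ^ 2) = fun s : ℝ => (s : ℂ) := by
      ext s
      simp
    rw [hid]
    simpa using (hasDerivAt_id (t : ℂ)).comp_ofReal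
  have hsinTime : sinTime (w ^ 2) = fun s : ℝ => w⁻¹ * sin (w * s) := by
    ext s
    rw [← mul_sinTime_sq, inv_mul_cancel_left₀ hw]
  have hsin : HasDerivAt (fun s : ℂ => w⁻¹ * sin (w * s)) (w⁻¹ * (cos (w * t) * w)) (t : ℂ) := by
    simpa using (((hasDerivAt_id (t : ℂ)).const_mul w).csin).const_mul w⁻¹
  rw [hsinTime]
  convert! hsin.comp_ofReal using 1
  rw [cosTime_sq]
  field_simp

/-! ### Duhamel integrals -/

theorem differentiable_intervalIntegral {E : Type*} [NormedAddCommGroup E] [NormedSpace ℂ E]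
    [CompleteSpace E] {Φ : ℂ → ℝ → E} (hΦ : Continuous (Function.uncurry Φ))
    (hd : ∀ τ, Differentiable ℂ fun z => Φ z τ) (a b : ℝ) :
    Differentiable ℂ (fun z => ∫ τ in a..b, Φ z τ) := by
  intro z
  obtain ⟨M, hM⟩ := ((isCompact_closedBall z 2).prod
    (isCompact_uIcc (a := a) (b := b))).exists_bound_of_continuousOn hΦ.continuousOn
  have hderiv : ∀ τ ∈ uIoc a b, ∀ w ∈ Metric.ball z 1, ‖deriv (fun v => Φ v τ) w‖ ≤ M := by
    intro τ hτ w hw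
    rw [← div_one M]
    refine norm_deriv_le_of_forall_mem_sphere_norm_le one_pos (hd τ).diffContOnCl
      fun v hv => hM (v, τ) ⟨?_, uIoc_subset_uIcc hτ⟩
    rw [Metric.mem_closedBall]
    have hvw : dist v w = 1 := hv
    linarith [dist_triangle v w z, Metric.mem_ball.1 hw]
  have hmeas : StronglyMeasurable fun τ => deriv (fun v => Φ v τ) z :=
    (stronglyMeasurable_deriv_with_param (f := fun τ v => Φ v τ)
      (hΦ.comp continuous_swap)).comp_measurable measurable_prodMk_right
  refine (intervalIntegral.hasDerivAt_integral_of_dominated_loc_of_deriv_le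
    (bound := fun _ => M) (Metric.ball_mem_nhds z one_pos)
    (Eventually.of_forall fun w => (hΦ.uncurry_left w).aestronglyMeasurable)
    ((hΦ.uncurry_left z).intervalIntegrable _ _) hmeas.aestronglyMeasurable
    (ae_of_all _ hderiv) intervalIntegrable_const
    (ae_of_all _ fun τ _ w _ => (hd τ w).hasDerivAt)).2.differentiableAt

/-- `∫₀^t cos (ω τ) g(τ) dτ` as a function of `z = ω²`. -/
def cosInt (g : ℝ → ℂ) (z : ℂ) (t : ℝ) : ℂ := ∫ τ in (0 : ℝ)..t, cosTime z τ * g τ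

/-- `∫₀^t sin (ω τ) / ω g(τ) dτ` as a function of `z = ω²`. -/
def sinInt (g : ℝ → ℂ) (z : ℂ) (t : ℝ) : ℂ := ∫ τ in (0 : ℝ)..t, sinTime z τ * g τ

/-- `∫₀^t cos (ω (t - τ)) g(τ) dτ` as a function of `z = ω²`, the kernel being expanded by the
addition theorem. -/
def cosConv (g : ℝ → ℂ) (z : ℂ) (t : ℝ) : ℂ :=
  cosTime z t * cosInt g z t + z * sinTime z t * sinInt g z t

/-- `∫₀^t sin (ω (t - τ)) / ω g(τ) dτ` as a function of `z = ω²`, the kernel being expanded by the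
addition theorem. -/
def sinConv (g : ℝ → ℂ) (z : ℂ) (t : ℝ) : ℂ :=
  sinTime z t * cosInt g z t - cosTime z t * sinInt g z t

@[simp] theorem cosConv_zero (g : ℝ → ℂ) (z : ℂ) : cosConv g z 0 = 0 := by
  simp [cosConv, cosInt]

@[simp] theorem sinConv_zero (g : ℝ → ℂ) (z : ℂ) : sinConv g z 0 = 0 := by
  simp [sinConv, sinInt]

section Duhamel

variable {X : Type*} [TopologicalSpace X] {z : X → ℂ} {t : X → ℝ} {g : ℝ → ℂ}

@[fun_prop]
theorem continuous_cosInt (hg : Continuous g) (hz : Continuous z) (ht : Continuous t) :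
    Continuous fun x => cosInt g (z x) (t x) :=
  intervalIntegral.continuous_parametric_intervalIntegral_of_continuous
    (f := fun x τ => cosTime (z x) τ * g τ) (by fun_prop) ht

@[fun_prop]
theorem continuous_sinInt (hg : Continuous g) (hz : Continuous z) (ht : Continuous t) :
    Continuous fun x => sinInt g (z x) (t x) :=
  intervalIntegral.continuous_parametric_intervalIntegral_of_continuous
    (f := fun x τ => sinTime (z x) τ * g τ) (by fun_prop) ht

@[fun_prop]
theorem continuous_cosConv (hg : Continuous g) (hz : Continuous z) (ht : Continuous t) :
    Continuous fun x => cosConv g (z x) (t x) := by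
  unfold cosConv
  fun_prop

@[fun_prop]
theorem continuous_sinConv (hg : Continuous g) (hz : Continuous z) (ht : Continuous t) :
    Continuous fun x => sinConv g (z x) (t x) := by
  unfold sinConv
  fun_prop

@[fun_prop]
theorem differentiable_cosInt (hg : Continuous g) (t : ℝ) :
    Differentiable ℂ (fun z => cosInt g z t) :=
  differentiable_intervalIntegral (by fun_prop) (fun τ => by fun_prop) 0 t

@[fun_prop]
theorem differentiable_sinInt (hg : Continuous g) (t : ℝ) :
    Differentiable ℂ (fun z => sinInt g z t) :=
  differentiable_intervalIntegral (by fun_prop) (fun τ => by fun_prop) 0 t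

@[fun_prop]
theorem differentiable_cosConv (hg : Continuous g) (t : ℝ) :
    Differentiable ℂ (fun z => cosConv g z t) := by
  unfold cosConv
  fun_prop

@[fun_prop]
theorem differentiable_sinConv (hg : Continuous g) (t : ℝ) :
    Differentiable ℂ (fun z => sinConv g z t) := by
  unfold sinConv
  fun_prop

theorem hasDerivAt_cosInt (hg : Continuous g) (z : ℂ) (t : ℝ) :
    HasDerivAt (cosInt g z) (cosTime z t * g t) t :=
  (Continuous.integral_hasStrictDerivAt (by fun_prop) 0 t).hasDerivAt

theorem hasDerivAt_sinInt (hg : Continuous g) (z : ℂ) (t : ℝ) :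
    HasDerivAt (sinInt g z) (sinTime z t * g t) t :=
  (Continuous.integral_hasStrictDerivAt (by fun_prop) 0 t).hasDerivAt

theorem hasDerivAt_cosConv (hg : Continuous g) (z : ℂ) (t : ℝ) :
    HasDerivAt (cosConv g z) (g t - z * sinConv g z t) t := by
  convert! ((hasDerivAt_cosTime z t).mul (hasDerivAt_cosInt hg z t)).add
    (((hasDerivAt_sinTime z t).const_mul z).mul (hasDerivAt_sinInt hg z t)) using 1
  rw [sinConv]
  linear_combination (-g t) * cosTime_sq_add_mul_sinTime_sq z t

theorem hasDerivAt_sinConv (hg : Continuous g) (z : ℂ) (t : ℝ) :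
    HasDerivAt (sinConv g z) (cosConv g z t) t := by
  convert! ((hasDerivAt_sinTime z t).mul (hasDerivAt_cosInt hg z t)).sub
    ((hasDerivAt_cosTime z t).mul (hasDerivAt_sinInt hg z t)) using 1
  rw [cosConv]
  ring

section IntegrationByParts

variable {g' : ℝ → ℂ} (hg : ∀ t, HasDerivAt g (g' t) t) (hg' : Continuous g') (z : ℂ) (t : ℝ)
include hg hg'

theorem cosInt_deriv : cosInt g' z t = cosTime z t * g t - g 0 + z * sinInt g z t := by
  rw [cosInt, intervalIntegral.integral_mul_deriv_eq_deriv_mul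
    (fun x _ => hasDerivAt_cosTime z x) (fun x _ => hg x)
    (Continuous.intervalIntegrable (by fun_prop) _ _) (hg'.intervalIntegrable _ _), sinInt]
  simp only [mul_assoc, intervalIntegral.integral_const_mul, cosTime_zero_right]
  ring

theorem sinInt_deriv : sinInt g' z t = sinTime z t * g t - cosInt g z t := by
  rw [sinInt, intervalIntegral.integral_mul_deriv_eq_deriv_mul
    (fun x _ => hasDerivAt_sinTime z x) (fun x _ => hg x)
    (Continuous.intervalIntegrable (by fun_prop) _ _) (hg'.intervalIntegrable _ _), cosInt,
    sinTime_zero_right]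
  ring

theorem cosConv_deriv : cosConv g' z t = g t - cosTime z t * g 0 - z * sinConv g z t := by
  rw [cosConv, sinConv, cosInt_deriv hg hg', sinInt_deriv hg hg']
  linear_combination g t * cosTime_sq_add_mul_sinTime_sq z t

end IntegrationByParts

theorem timeTransform_omega (hg : Continuous g) (k : ℂ) (t : ℝ) :
    timeTransform g (omega k) t
      = cosInt g (omegaSq k) t - I * omega k * sinInt g (omegaSq k) t := by
  rw [timeTransform, cosInt, sinInt, ← intervalIntegral.integral_const_mul,
    ← intervalIntegral.integral_sub (Continuous.intervalIntegrable (by fun_prop) _ _)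
      (Continuous.intervalIntegrable (by fun_prop) _ _)]
  congr 1 with τ
  rw [exp_neg_I_mul_omega]
  ring

theorem timeTransform_neg_omega (hg : Continuous g) (k : ℂ) (t : ℝ) :
    timeTransform g (-omega k) t
      = cosInt g (omegaSq k) t + I * omega k * sinInt g (omegaSq k) t := by
  rw [timeTransform, cosInt, sinInt, ← intervalIntegral.integral_const_mul,
    ← intervalIntegral.integral_add (Continuous.intervalIntegrable (by fun_prop) _ _)
      (Continuous.intervalIntegrable (by fun_prop) _ _)]
  congr 1 with τ
  rw [neg_mul_neg, exp_I_mul_omega]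
  ring

theorem exp_mul_timeTransform_add (hg : Continuous g) (k : ℂ) (t : ℝ) :
    exp (I * omega k * t) * timeTransform g (omega k) t
      + exp (-I * omega k * t) * timeTransform g (-omega k) t
      = 2 * cosConv g (omegaSq k) t := by
  rw [exp_I_mul_omega, exp_neg_I_mul_omega, timeTransform_omega hg, timeTransform_neg_omega hg,
    cosConv, ← omega_sq]
  linear_combination
    (-2 * omega k ^ 2 * sinTime (omega k ^ 2) t * sinInt g (omega k ^ 2) t) * I_sq

theorem exp_mul_timeTransform_sub (hg : Continuous g) (k : ℂ) (t : ℝ) :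
    exp (I * omega k * t) * timeTransform g (omega k) t
      - exp (-I * omega k * t) * timeTransform g (-omega k) t
      = 2 * I * omega k * sinConv g (omegaSq k) t := by
  rw [exp_I_mul_omega, exp_neg_I_mul_omega, timeTransform_omega hg, timeTransform_neg_omega hg,
    sinConv]
  ring

end Duhamel

/-! ### The integrands in terms of `ω²` -/

theorem lineIntegrandR_eq (r₀ q₀ : ℝ → ℂ) (x t k : ℝ) :
    lineIntegrandR r₀ q₀ x t k = exp (I * k * x) * (cosTime (omegaSq k) t * halfLineFourier r₀ k
      - I * k * sinTime (omegaSq k) t * halfLineFourier q₀ k) := by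
  have hk : (1 : ℂ) + (k : ℂ) ^ 2 ≠ 0 := by
    norm_cast
    positivity
  rw [lineIntegrandR, exp_add_exp_neg_omega, exp_sub_exp_neg_omega]
  linear_combination (-exp (I * k * x) * I * sinTime (omegaSq k) t * halfLineFourier q₀ k)
    * mu_mul_omega hk

theorem lineIntegrandQ_eq (r₀ q₀ : ℝ → ℂ) (x t k : ℝ) :
    lineIntegrandQ r₀ q₀ x t k = exp (I * k * x) * (cosTime (omegaSq k) t * halfLineFourier q₀ k
      - I * (k / (1 + k ^ 2)) * sinTime (omegaSq k) t * halfLineFourier r₀ k) := by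
  rw [lineIntegrandQ, exp_add_exp_neg_omega, exp_sub_exp_neg_omega]
  linear_combination (-exp (I * k * x) * I * sinTime (omegaSq k) t * halfLineFourier r₀ k)
    * one_div_mu_mul_omega (k : ℂ)

theorem contourIntegrandR₁_eq (r₀ q₀ : ℝ → ℂ) (x t : ℝ) {k : ℂ} (hk : 1 + k ^ 2 ≠ 0) :
    contourIntegrandR₁ r₀ q₀ x t k
      = exp (I * k * x) * (cosTime (omegaSq k) t * halfLineFourier r₀ (-k)
        + I * k * sinTime (omegaSq k) t * halfLineFourier q₀ (-k)) := by
  rw [contourIntegrandR₁, exp_add_exp_neg_omega, exp_sub_exp_neg_omega]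
  linear_combination (exp (I * k * x) * I * sinTime (omegaSq k) t * halfLineFourier q₀ (-k))
    * mu_mul_omega hk

theorem contourIntegrandQ₁_eq (r₀ q₀ : ℝ → ℂ) (x t : ℝ) (k : ℂ) :
    contourIntegrandQ₁ r₀ q₀ x t k
      = exp (I * k * x) * (cosTime (omegaSq k) t * halfLineFourier q₀ (-k)
        + I * (k / (1 + k ^ 2)) * sinTime (omegaSq k) t * halfLineFourier r₀ (-k)) := by
  rw [contourIntegrandQ₁, exp_add_exp_neg_omega, exp_sub_exp_neg_omega]
  linear_combination (exp (I * k * x) * I * sinTime (omegaSq k) t * halfLineFourier r₀ (-k))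
    * one_div_mu_mul_omega k

section BoundaryIntegrands

variable {g₀ : ℝ → ℂ} (hg : Continuous g₀) (hg' : Continuous (deriv g₀)) (x t : ℝ) (k : ℂ)
include hg hg'

theorem contourIntegrandR₂_eq :
    contourIntegrandR₂ g₀ x t k = exp (I * k * x) *
      (2 * cosConv g₀ (omegaSq k) t - 2 * omegaSq k * sinConv (deriv g₀) (omegaSq k) t) := by
  rw [contourIntegrandR₂, exp_mul_timeTransform_add hg, exp_mul_timeTransform_sub hg', ← omega_sq]
  linear_combination
    (2 * exp (I * k * x) * omega k ^ 2 * sinConv (deriv g₀) (omega k ^ 2) t) * I_sq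

theorem contourIntegrandQ₂_eq :
    contourIntegrandQ₂ g₀ x t k = exp (I * k * x) * (2 * I * (k / (1 + k ^ 2)) *
      (sinConv g₀ (omegaSq k) t + cosConv (deriv g₀) (omegaSq k) t)) := by
  rw [contourIntegrandQ₂, exp_mul_timeTransform_sub hg, exp_mul_timeTransform_add hg']
  linear_combination (2 * I * exp (I * k * x) * sinConv g₀ (omegaSq k) t) * one_div_mu_mul_omega k

end BoundaryIntegrands

/-! ### The half-line Fourier transform -/

theorem norm_exp_neg_I_mul_le_one {k : ℂ} (hk : k.im ≤ 0) {x : ℝ} (hx : 0 ≤ x) :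
    ‖exp (-I * k * x)‖ ≤ 1 := by
  rw [norm_exp, Real.exp_le_one_iff]
  have hre : (-I * k * x).re = k.im * x := by simp
  exact hre ▸ mul_nonpos_of_nonpos_of_nonneg hk hx

theorem one_add_I_mul_ne_zero {k : ℂ} (hk : k ≠ I) : 1 + I * k ≠ 0 := by
  intro h
  apply hk
  linear_combination (-I) * h + k * I_sq

theorem ne_I_of_im_nonpos {k : ℂ} (hk : k.im ≤ 0) : k ≠ I := by
  rintro rfl
  norm_num at hk

section HalfLine

variable {f : ℝ → ℂ}

theorem norm_halfLine_integrand_le (f : ℝ → ℂ) {k : ℂ} (hk : k.im ≤ 0) :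
    ∀ᵐ x : ℝ ∂volume.restrict (Ioi 0), ‖exp (-I * k * x) * f x‖ ≤ ‖f x‖ := by
  filter_upwards [ae_restrict_mem measurableSet_Ioi] with x hx
  rw [norm_mul]
  exact mul_le_of_le_one_left (norm_nonneg _) (norm_exp_neg_I_mul_le_one hk (le_of_lt hx))

theorem aestronglyMeasurable_halfLine_integrand (hf : IntegrableOn f (Ioi 0)) (k : ℂ) :
    AEStronglyMeasurable (fun x : ℝ => exp (-I * k * x) * f x) (volume.restrict (Ioi 0)) :=
  (Continuous.aestronglyMeasurable (by fun_prop)).mul hf.aestronglyMeasurable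

theorem integrableOn_halfLine (hf : IntegrableOn f (Ioi 0)) {k : ℂ} (hk : k.im ≤ 0) :
    IntegrableOn (fun x : ℝ => exp (-I * k * x) * f x) (Ioi 0) :=
  Integrable.mono hf (aestronglyMeasurable_halfLine_integrand hf k)
    (norm_halfLine_integrand_le f hk)

theorem norm_halfLineFourier_le (hf : IntegrableOn f (Ioi 0)) {k : ℂ} (hk : k.im ≤ 0) :
    ‖halfLineFourier f k‖ ≤ ∫ x in Ioi (0 : ℝ), ‖f x‖ :=
  norm_integral_le_of_norm_le hf.norm (norm_halfLine_integrand_le f hk)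

theorem continuousOn_halfLineFourier (hf : IntegrableOn f (Ioi 0)) :
    ContinuousOn (halfLineFourier f) {k : ℂ | k.im ≤ 0} :=
  continuousOn_of_dominated (bound := fun x => ‖f x‖)
    (fun k _ => aestronglyMeasurable_halfLine_integrand hf k)
    (fun _ hk => norm_halfLine_integrand_le f hk) hf.norm (ae_of_all _ fun x => by fun_prop)

theorem differentiableOn_halfLineFourier (hf : IntegrableOn f (Ioi 0))
    (hxf : IntegrableOn (fun x : ℝ => (x : ℂ) * f x) (Ioi 0)) :
    DifferentiableOn ℂ (halfLineFourier f) {k : ℂ | k.im < 0} := by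
  intro k hk
  have hnhds : {k : ℂ | k.im < 0} ∈ 𝓝 k := (isOpen_lt continuous_im continuous_const).mem_nhds hk
  have hderiv : ∀ (x : ℝ) (w : ℂ), HasDerivAt (fun w : ℂ => exp (-I * w * x) * f x)
      (-I * (exp (-I * w * x) * (x * f x))) w := by
    intro x w
    have hlin : HasDerivAt (fun w : ℂ => -I * w * x) (-I * x) w := by
      simpa using ((hasDerivAt_id w).const_mul (-I)).mul_const (x : ℂ)
    convert! hlin.cexp.mul_const (f x) using 1
    ring
  refine (hasDerivAt_integral_of_dominated_loc_of_deriv_le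
    (bound := fun x : ℝ => ‖(x : ℂ) * f x‖) hnhds
    (Eventually.of_forall (aestronglyMeasurable_halfLine_integrand hf))
    (integrableOn_halfLine hf (le_of_lt hk))
    ((aestronglyMeasurable_halfLine_integrand hxf k).const_mul _) ?_ hxf.norm
    (ae_of_all _ fun x w _ => hderiv x w)).2.differentiableAt.differentiableWithinAt
  filter_upwards [ae_restrict_mem measurableSet_Ioi] with x hx w hw
  rw [norm_mul, norm_neg, norm_I, one_mul, norm_mul]
  exact mul_le_of_le_one_left (norm_nonneg _)
    (norm_exp_neg_I_mul_le_one (le_of_lt hw) (le_of_lt hx))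

end HalfLine

section Schwartz

variable (f : 𝓢(ℝ, ℂ))

theorem integrableOn_mul_schwartz : IntegrableOn (fun x : ℝ => (x : ℂ) * f x) (Ioi 0) := by
  refine Integrable.mono (f.integrable_pow_mul volume 1).integrableOn (by fun_prop)
    (ae_of_all _ fun x => ?_)
  simp

/-- The operator `f ↦ f + f'`, which the half-line Fourier transform turns into multiplication by
`1 + ik` up to a boundary term. -/
def oneAddDeriv (f : 𝓢(ℝ, ℂ)) : 𝓢(ℝ, ℂ) := f + SchwartzMap.derivCLM ℂ ℂ f

theorem oneAddDeriv_apply (x : ℝ) : oneAddDeriv f x = f x + deriv f x := by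
  simp [oneAddDeriv]

theorem tendsto_exp_mul_schwartz {k : ℂ} (hk : k.im ≤ 0) :
    Tendsto (fun x : ℝ => exp (-I * k * x) * f x) atTop (𝓝 0) := by
  refine squeeze_zero_norm' (a := fun x => ‖f x‖) ?_ ?_
  · filter_upwards [eventually_ge_atTop 0] with x hx
    rw [norm_mul]
    exact mul_le_of_le_one_left (norm_nonneg _) (norm_exp_neg_I_mul_le_one hk hx)
  · simpa using (f.tendsto_cocompact.mono_left atTop_le_cocompact).norm

theorem one_add_mul_halfLineFourier {k : ℂ} (hk : k.im ≤ 0) :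
    (1 + I * k) * halfLineFourier f k = f 0 + halfLineFourier (oneAddDeriv f) k := by
  have hderiv : ∀ x ∈ Ici (0 : ℝ), HasDerivAt (fun x : ℝ => exp (-I * k * x) * f x)
      (exp (-I * k * x) * oneAddDeriv f x - (1 + I * k) * (exp (-I * k * x) * f x)) x := by
    intro x _
    have hlin : HasDerivAt (fun y : ℝ => -I * k * (y : ℂ)) (-I * k) x := by
      simpa using ((hasDerivAt_id (x : ℂ)).const_mul (-I * k)).comp_ofReal
    convert! hlin.cexp.mul (f.differentiableAt (x := x)).hasDerivAt using 1
    rw [oneAddDeriv_apply]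
    ring
  have hf := (integrableOn_halfLine f.integrable.integrableOn hk).const_mul (1 + I * k)
  have hf' := integrableOn_halfLine (oneAddDeriv f).integrable.integrableOn hk
  have hftc := integral_Ioi_of_hasDerivAt_of_tendsto' hderiv (hf'.sub hf)
    (tendsto_exp_mul_schwartz f hk)
  rw [integral_sub hf' hf, integral_const_mul, ← halfLineFourier, ← halfLineFourier, ofReal_zero,
    mul_zero, exp_zero, one_mul, zero_sub] at hftc
  linear_combination -hftc

/-- The part of the half-line Fourier transform of `f` that carries the derivatives of `f` at `0`
up to order `n - 1`: a rational function whose only pole is `k = i`. -/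
def jetFourier (n : ℕ) (k : ℂ) : ℂ :=
  ∑ j ∈ Finset.range n, (oneAddDeriv^[j] f) 0 / (1 + I * k) ^ (j + 1)

/-- What remains of the half-line Fourier transform of `f` after removal of `jetFourier f n`; it
decays like `k⁻ⁿ`. -/
def tailFourier (n : ℕ) (k : ℂ) : ℂ := halfLineFourier (oneAddDeriv^[n] f) k / (1 + I * k) ^ n

theorem halfLineFourier_eq_jet_add_tail (n : ℕ) {k : ℂ} (hk : k.im ≤ 0) :
    halfLineFourier f k = jetFourier f n k + tailFourier f n k := by
  have hk0 := one_add_I_mul_ne_zero (ne_I_of_im_nonpos hk)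
  induction n with
  | zero => simp [jetFourier, tailFourier]
  | succ n ih =>
    rw [ih, jetFourier, jetFourier, Finset.sum_range_succ, add_assoc]
    congr 1
    rw [tailFourier, tailFourier, Function.iterate_succ_apply', ← add_div,
      ← one_add_mul_halfLineFourier (oneAddDeriv^[n] f) hk, pow_succ]
    field_simp

theorem exists_norm_tailFourier_le (n : ℕ) : ∃ M : ℝ, 0 ≤ M ∧ ∀ k : ℂ, k.im ≤ 0 →
    ‖tailFourier f n k‖ ≤ M / ‖1 + I * k‖ ^ n := by
  refine ⟨∫ x in Ioi (0 : ℝ), ‖(oneAddDeriv^[n] f) x‖, integral_nonneg fun _ => norm_nonneg _,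
    fun k hk => ?_⟩
  rw [tailFourier, norm_div, norm_pow]
  gcongr
  exact norm_halfLineFourier_le (SchwartzMap.integrable _).integrableOn hk

theorem continuousOn_tailFourier (n : ℕ) :
    ContinuousOn (tailFourier f n) {k : ℂ | k.im ≤ 0} :=
  (continuousOn_halfLineFourier (SchwartzMap.integrable _).integrableOn).div (by fun_prop)
    fun _ hk => pow_ne_zero _ (one_add_I_mul_ne_zero (ne_I_of_im_nonpos hk))

theorem differentiableOn_tailFourier (n : ℕ) :
    DifferentiableOn ℂ (tailFourier f n) {k : ℂ | k.im < 0} :=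
  (differentiableOn_halfLineFourier (SchwartzMap.integrable _).integrableOn
    (integrableOn_mul_schwartz _)).div (by fun_prop)
    fun _ hk => pow_ne_zero _ (one_add_I_mul_ne_zero (ne_I_of_im_nonpos (le_of_lt hk)))

end Schwartz

/-! ### Fourier inversion with a Gaussian cut-off -/

section FourierInversion

open scoped FourierTransform RealInnerProductSpace

variable {V E : Type*} [NormedAddCommGroup V] [InnerProductSpace ℝ V] [FiniteDimensional ℝ V]
  [MeasurableSpace V] [BorelSpace V] [NormedAddCommGroup E] [NormedSpace ℂ E] {f : V → E}

theorem integral_fourier_smul_eq_integral_smul_fourier [CompleteSpace E] {φ : V → ℂ}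
    (hφ : Integrable φ) (hf : Integrable f) : ∫ w, 𝓕 φ w • f w = ∫ w, φ w • 𝓕 f w :=
  (VectorFourier.integral_fourierIntegral_smul_eq_flip (L := innerₗ V)
    Real.continuous_fourierChar continuous_inner hφ hf).trans (by rw [flip_innerₗ]; rfl)

theorem fourier_cexp_neg_inv_mul_sq_add_inner {c : ℝ} (hc : 0 < c) (v w : V) :
    𝓕 (fun u : V => cexp (-c⁻¹ * ‖u‖ ^ 2 + 2 * Real.pi * I * ⟪v, u⟫)) w
      = (Real.pi * c : ℂ) ^ (Module.finrank ℝ V / 2 : ℂ)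
        * cexp (-Real.pi ^ 2 * c * ‖v - w‖ ^ 2) := by
  have hre : 0 < ((c⁻¹ : ℝ) : ℂ).re := by rwa [ofReal_re, inv_pos]
  rw [fourier_gaussian_innerProductSpace' hre, ofReal_inv, div_inv_eq_mul, div_inv_eq_mul,
    mul_right_comm]

theorem tendsto_integral_cexp_neg_mul_sq_smul_fourier [CompleteSpace E] (hf : Integrable f)
    {v : V} (hfv : ContinuousAt f v) :
    Tendsto (fun c : ℝ => ∫ w : V, cexp (-c⁻¹ * ‖w‖ ^ 2 + 2 * Real.pi * I * ⟪v, w⟫) • 𝓕 f w)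
      atTop (𝓝 (f v)) := by
  refine (Real.tendsto_integral_gaussian_smul' hf hfv).congr' ?_
  filter_upwards [Ioi_mem_atTop 0] with c hc
  have hgauss : Integrable fun w : V => cexp (-c⁻¹ * ‖w‖ ^ 2 + 2 * Real.pi * I * ⟪v, w⟫) :=
    GaussianFourier.integrable_cexp_neg_mul_sq_norm_add
      (by rwa [ofReal_re, inv_pos]) _ v
  simp only [← integral_fourier_smul_eq_integral_smul_fourier hgauss hf,
    fourier_cexp_neg_inv_mul_sq_add_inner hc]

theorem fourier_indicator_Ioi (f : ℝ → ℂ) (w : ℝ) :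
    𝓕 ((Ioi (0 : ℝ)).indicator f) w = halfLineFourier f ((2 * Real.pi * w : ℝ) : ℂ) := by
  rw [Real.fourier_eq', halfLineFourier, ← integral_indicator measurableSet_Ioi]
  congr 1 with y
  by_cases hy : y ∈ Ioi (0 : ℝ)
  · rw [indicator_of_mem hy, indicator_of_mem hy, smul_eq_mul]
    congr 2
    simp
    ring
  · rw [indicator_of_notMem hy, indicator_of_notMem hy, smul_zero]

theorem tendsto_inv_const_mul_nhdsGT_zero {a : ℝ} (ha : 0 < a) :
    Tendsto (fun ε : ℝ => (a * ε)⁻¹) (𝓝[>] 0) atTop := by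
  simp only [mul_inv]
  exact tendsto_inv_nhdsGT_zero.const_mul_atTop (inv_pos.2 ha)

theorem hasGaussIntegral_halfLineFourier {f : ℝ → ℂ} (hf : IntegrableOn f (Ioi 0)) {x : ℝ}
    (hx : 0 < x) (hfx : ContinuousAt f x) :
    HasGaussIntegral (fun k : ℝ => exp (I * k * x) * halfLineFourier f k)
      (2 * Real.pi * f x) := by
  have hcont : ContinuousAt ((Ioi (0 : ℝ)).indicator f) x :=
    hfx.congr (by filter_upwards [Ioi_mem_nhds hx] with y hy using (indicator_of_mem hy f).symm)
  have hinv := ((tendsto_integral_cexp_neg_mul_sq_smul_fourier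
    ((integrable_indicator_iff measurableSet_Ioi).2 hf) hcont).comp
      (tendsto_inv_const_mul_nhdsGT_zero (a := 4 * Real.pi ^ 2) (by positivity))).const_mul
        (2 * Real.pi : ℂ)
  rw [indicator_of_mem (mem_Ioi.2 hx)] at hinv
  refine hinv.congr fun ε => ?_
  set G : ℝ → ℂ := fun k =>
    (Real.exp (-ε * k ^ 2) : ℂ) * (exp (I * k * x) * halfLineFourier f k) with hG
  have hscale : ∫ w : ℝ, G (2 * Real.pi * w) = (2 * Real.pi)⁻¹ • ∫ k, G k := by
    rw [Measure.integral_comp_mul_left, abs_of_pos (by positivity)]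
  have hpi : (Real.pi : ℂ) ≠ 0 := ofReal_ne_zero.2 Real.pi_ne_zero
  calc _ = 2 * Real.pi * ∫ w : ℝ, G (2 * Real.pi * w) := by
        simp only [Function.comp_apply]
        congr 2 with w
        rw [fourier_indicator_Ioi, smul_eq_mul, hG]
        dsimp only
        rw [← mul_assoc, ofReal_exp, ← exp_add]
        congr 2
        rw [← ofReal_pow ‖w‖, Real.norm_eq_abs, sq_abs, inv_inv, RCLike.inner_apply, conj_trivial]
        push_cast
        ring
    _ = ∫ k, G k := by
        rw [hscale, real_smul]
        push_cast
        field_simp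

end FourierInversion

/-! ### Contour integrals and rectangles in the upper half-plane -/

/-- The open upper half-plane. -/
def upper : Set ℂ := {k | 0 < k.im}

/-- The closed upper half-plane. -/
def closedUpper : Set ℂ := {k | 0 ≤ k.im}

theorem isOpen_upper : IsOpen upper := isOpen_lt continuous_const continuous_im

theorem upper_subset_closedUpper : upper ⊆ closedUpper := fun k h => (show 0 < k.im from h).le

theorem I_mem_upper : I ∈ upper := by simp [upper]

theorem upper_mem_nhds_I : upper ∈ 𝓝 I := isOpen_upper.mem_nhds I_mem_upper

theorem closedUpper_mem_nhds_I : closedUpper ∈ 𝓝 I :=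
  mem_of_superset upper_mem_nhds_I upper_subset_closedUpper

/-- The closed upper half-plane without the pole `i` of `ω²`, where all the integrands are
continuous. -/
def puncturedUpper : Set ℂ := closedUpper \ {I}

theorem sub_I_ne_zero {k : ℂ} (hk : k ∈ puncturedUpper) : k - I ≠ 0 := sub_ne_zero.2 hk.2

theorem add_I_ne_zero {k : ℂ} (hk : k ∈ closedUpper) : k + I ≠ 0 := by
  intro h
  have him : k.im + 1 = 0 := by simpa using congrArg im h
  linarith [show 0 ≤ k.im from hk]

theorem one_add_sq_eq (k : ℂ) : 1 + k ^ 2 = (k + I) * (k - I) := by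
  linear_combination I_sq

theorem one_add_sq_ne_zero {k : ℂ} (hk : k ∈ puncturedUpper) : 1 + k ^ 2 ≠ 0 := by
  rw [one_add_sq_eq]
  exact mul_ne_zero (add_I_ne_zero hk.1) (sub_I_ne_zero hk)

theorem continuousOn_omegaSq : ContinuousOn omegaSq puncturedUpper :=
  ContinuousOn.div (by fun_prop) (by fun_prop) fun _ hk => one_add_sq_ne_zero hk

section Contour

variable {γ : ℝ → ℂ}

theorem IsContourAroundI.mem_upper (hγ : IsContourAroundI γ) {u : ℝ} (hu : u ∈ Icc (0 : ℝ) 1) :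
    γ u ∈ upper := hγ.im_pos u hu

theorem IsContourAroundI.mem_puncturedUpper (hγ : IsContourAroundI γ) {u : ℝ}
    (hu : u ∈ Icc (0 : ℝ) 1) : γ u ∈ puncturedUpper :=
  ⟨upper_subset_closedUpper (hγ.mem_upper hu), hγ.ne_I u hu⟩

theorem IsContourAroundI.continuousOn_derivWithin (hγ : IsContourAroundI γ) :
    ContinuousOn (derivWithin γ (Icc 0 1)) (Icc 0 1) :=
  hγ.contDiffOn.continuousOn_derivWithin (uniqueDiffOn_Icc one_pos) le_rfl

theorem IsContourAroundI.hasDerivAt (hγ : IsContourAroundI γ) {u : ℝ} (hu : u ∈ Ioo (0 : ℝ) 1) :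
    HasDerivAt γ (derivWithin γ (Icc 0 1) u) u :=
  (hγ.contDiffOn.differentiableOn one_ne_zero u
    (Ioo_subset_Icc_self hu)).hasDerivWithinAt.hasDerivAt (Icc_mem_nhds hu.1 hu.2)

theorem IsContourAroundI.intervalIntegrable (hγ : IsContourAroundI γ) {F : ℂ → ℂ}
    (hF : ContinuousOn (fun u => F (γ u)) (Icc 0 1)) :
    IntervalIntegrable (fun u => F (γ u) * derivWithin γ (Icc 0 1) u) volume 0 1 :=
  (hF.mul hγ.continuousOn_derivWithin).intervalIntegrable_of_Icc zero_le_one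

theorem contourIntegral_congr {F G : ℂ → ℂ} (h : ∀ u ∈ Icc (0 : ℝ) 1, F (γ u) = G (γ u)) :
    contourIntegral γ F = contourIntegral γ G := by
  refine intervalIntegral.integral_congr fun u hu => ?_
  rw [uIcc_of_le zero_le_one] at hu
  simp only [h u hu]

theorem IsContourAroundI.comp_continuousOn (hγ : IsContourAroundI γ) {F : ℂ → ℂ}
    (hF : ContinuousOn F puncturedUpper) : ContinuousOn (fun u => F (γ u)) (Icc 0 1) :=
  hF.comp hγ.contDiffOn.continuousOn fun _ hu => hγ.mem_puncturedUpper hu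

theorem IsContourAroundI.contourIntegral_add (hγ : IsContourAroundI γ) {F G : ℂ → ℂ}
    (hF : ContinuousOn F puncturedUpper) (hG : ContinuousOn G puncturedUpper) :
    contourIntegral γ (fun k => F k + G k) = contourIntegral γ F + contourIntegral γ G := by
  rw [contourIntegral, contourIntegral, contourIntegral, ← intervalIntegral.integral_add
    (hγ.intervalIntegrable (hγ.comp_continuousOn hF))
    (hγ.intervalIntegrable (hγ.comp_continuousOn hG))]
  simp only [add_mul]

theorem contourIntegral_const_mul (c : ℂ) (F : ℂ → ℂ) :
    contourIntegral γ (fun k => c * F k) = c * contourIntegral γ F := by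
  rw [contourIntegral, contourIntegral, ← intervalIntegral.integral_const_mul]
  simp only [mul_assoc]

theorem IsContourAroundI.contourIntegral_sub (hγ : IsContourAroundI γ) {F G : ℂ → ℂ}
    (hF : ContinuousOn F puncturedUpper) (hG : ContinuousOn G puncturedUpper) :
    contourIntegral γ (fun k => F k - G k) = contourIntegral γ F - contourIntegral γ G := by
  simp only [sub_eq_add_neg, ← neg_one_mul (G _), ← neg_one_mul (contourIntegral γ G)]
  rw [hγ.contourIntegral_add hF (hG.const_mul (-1)), contourIntegral_const_mul]

theorem IsContourAroundI.contourIntegral_eq_zero_of_hasDerivAt (hγ : IsContourAroundI γ)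
    {f f' : ℂ → ℂ} (hf : ∀ u ∈ Icc (0 : ℝ) 1, HasDerivAt f (f' (γ u)) (γ u))
    (hf' : ContinuousOn (fun u => f' (γ u)) (Icc 0 1)) : contourIntegral γ f' = 0 := by
  rw [contourIntegral, intervalIntegral.integral_eq_sub_of_hasDerivAt_of_le (f := fun u => f (γ u))
    zero_le_one ?_ ?_ (hγ.intervalIntegrable hf'), hγ.closed, sub_self]
  · intro u hu
    exact (hf u hu).continuousAt.comp_continuousWithinAt (hγ.contDiffOn.continuousOn u hu)
  · intro u hu
    exact (hf u (Ioo_subset_Icc_self hu)).comp_of_eq u (hγ.hasDerivAt hu) rfl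

theorem norm_sub_mul_I_sq (k : ℂ) (R : ℝ) :
    ‖k - R * I‖ ^ 2 = ‖k‖ ^ 2 - 2 * R * k.im + R ^ 2 := by
  rw [← normSq_eq_norm_sq, ← normSq_eq_norm_sq, normSq_apply, normSq_apply]
  simp only [sub_re, mul_re, ofReal_re, I_re, mul_zero, ofReal_im, I_im, mul_one, sub_self,
    sub_zero, sub_im, mul_im, add_zero]
  ring

theorem ball_mul_I_subset_upper {R : ℝ} (hR : 0 < R) : Metric.ball (R * I) R ⊆ upper := by
  intro k hk
  rw [mem_ball_iff_norm] at hk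
  have hsq := pow_lt_pow_left₀ hk (norm_nonneg _) two_ne_zero
  rw [norm_sub_mul_I_sq] at hsq
  refine pos_of_mul_pos_right (a := 2 * R) ?_ (by positivity)
  linarith [sq_nonneg ‖k‖]

theorem exists_subset_ball_mul_I {K : Set ℂ} (hK : IsCompact K) (hKu : K ⊆ upper) :
    ∃ R : ℝ, 0 < R ∧ K ⊆ Metric.ball (R * I) R := by
  have hc : ContinuousOn (fun k : ℂ => ‖k‖ ^ 2 / (2 * k.im)) K := by
    refine ContinuousOn.div (by fun_prop) (by fun_prop) fun k hk => ?_
    have : 0 < k.im := hKu hk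
    positivity
  obtain ⟨M, hM⟩ := hK.exists_bound_of_continuousOn hc
  refine ⟨|M| + 1, by positivity, fun k hk => ?_⟩
  have him : 0 < k.im := hKu hk
  have hle := hM k hk
  rw [Real.norm_eq_abs, abs_of_nonneg (by positivity), div_le_iff₀ (by positivity)] at hle
  rw [mem_ball_iff_norm]
  refine lt_of_pow_lt_pow_left₀ 2 (by positivity) ?_
  rw [norm_sub_mul_I_sq]
  nlinarith [le_abs_self M]

theorem IsContourAroundI.contourIntegral_eq_zero (hγ : IsContourAroundI γ) {f : ℂ → ℂ}
    (hf : DifferentiableOn ℂ f upper) : contourIntegral γ f = 0 := by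
  have hK : IsCompact (γ '' Icc 0 1) :=
    isCompact_Icc.image_of_continuousOn hγ.contDiffOn.continuousOn
  obtain ⟨R, hR0, hR⟩ := exists_subset_ball_mul_I hK
    (by rintro _ ⟨u, hu, rfl⟩; exact hγ.mem_upper hu)
  obtain ⟨F, hF⟩ := (hf.mono (ball_mul_I_subset_upper hR0)).isExactOn_ball
  refine hγ.contourIntegral_eq_zero_of_hasDerivAt (f := F)
    (fun u hu => hF _ (hR (mem_image_of_mem γ hu))) ?_
  exact hf.continuousOn.comp hγ.contDiffOn.continuousOn fun u hu => hγ.mem_upper hu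

/-- The integral of `F` along the boundary of the rectangle with vertices `a`, `b`, `b + iH` and
`a + iH`, run through counterclockwise if `a < b` and `0 < H`. -/
def rectIntegral (F : ℂ → ℂ) (a b H : ℝ) : ℂ :=
  (∫ x in a..b, F (x + (0 : ℝ) * I)) - (∫ x in a..b, F (x + H * I))
    + I * (∫ y in (0 : ℝ)..H, F (b + y * I)) - I * ∫ y in (0 : ℝ)..H, F (a + y * I)

/-- The integral of `F` along `γ` agrees with the integral along the boundary of each rectangle
in the upper half-plane that is based on the real axis and contains `i`. -/
structure DeformsToRect (γ : ℝ → ℂ) (F : ℂ → ℂ) : Prop where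
  continuousOn : ContinuousOn F puncturedUpper
  eq : ∀ a b H : ℝ, a < 0 → 0 < b → 1 < H → rectIntegral F a b H = contourIntegral γ F

section Sides

variable {F G : ℂ → ℂ} {a b H : ℝ}

theorem real_mem_puncturedUpper (x : ℝ) : (x : ℂ) + (0 : ℝ) * I ∈ puncturedUpper :=
  ⟨by simp [closedUpper], fun h => by simpa using congrArg im (mem_singleton_iff.1 h)⟩

theorem horizontal_mem_puncturedUpper (x : ℝ) (hH : 1 < H) : (x : ℂ) + H * I ∈ puncturedUpper :=
  ⟨by simpa [closedUpper] using (zero_lt_one.trans hH).le,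
    fun h => hH.ne' (by simpa using congrArg im (mem_singleton_iff.1 h))⟩

theorem vertical_mem_puncturedUpper {x : ℝ} (hx : x ≠ 0) (hH : 0 ≤ H) :
    ∀ y ∈ uIcc 0 H, (x : ℂ) + y * I ∈ puncturedUpper := fun y hy =>
  ⟨by rw [uIcc_of_le hH] at hy; simpa [closedUpper] using hy.1,
    fun h => hx (by simpa using congrArg re (mem_singleton_iff.1 h))⟩

theorem continuous_real (hF : ContinuousOn F puncturedUpper) :
    Continuous (fun x : ℝ => F (x + (0 : ℝ) * I)) :=
  hF.comp_continuous (by fun_prop) real_mem_puncturedUpper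

theorem continuous_horizontal (hF : ContinuousOn F puncturedUpper) (hH : 1 < H) :
    Continuous (fun x : ℝ => F (x + H * I)) :=
  hF.comp_continuous (by fun_prop) fun x => horizontal_mem_puncturedUpper x hH

theorem continuousOn_vertical (hF : ContinuousOn F puncturedUpper) (hb : b ≠ 0) (hH : 0 ≤ H) :
    ContinuousOn (fun y : ℝ => F (b + y * I)) (uIcc 0 H) :=
  hF.comp (by fun_prop) (vertical_mem_puncturedUpper hb hH)

theorem rectIntegral_congr (h : EqOn F G puncturedUpper) (ha : a < 0) (hb : 0 < b) (hH : 1 < H) :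
    rectIntegral F a b H = rectIntegral G a b H := by
  have hH0 : 0 ≤ H := (zero_lt_one.trans hH).le
  have hv (c : ℝ) (hc : c ≠ 0) :
      ∫ y in (0 : ℝ)..H, F (c + y * I) = ∫ y in (0 : ℝ)..H, G (c + y * I) :=
    intervalIntegral.integral_congr fun y hy => h (vertical_mem_puncturedUpper hc hH0 y hy)
  simp only [rectIntegral, hv a ha.ne, hv b hb.ne', h (real_mem_puncturedUpper _),
    h (horizontal_mem_puncturedUpper _ hH)]

theorem rectIntegral_add (hF : ContinuousOn F puncturedUpper) (hG : ContinuousOn G puncturedUpper)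
    (ha : a < 0) (hb : 0 < b) (hH : 1 < H) :
    rectIntegral (fun k => F k + G k) a b H = rectIntegral F a b H + rectIntegral G a b H := by
  have hH0 : 0 ≤ H := (zero_lt_one.trans hH).le
  have hv (c : ℝ) (hc : c ≠ 0) : ∫ y in (0 : ℝ)..H, (F (c + y * I) + G (c + y * I))
      = (∫ y in (0 : ℝ)..H, F (c + y * I)) + ∫ y in (0 : ℝ)..H, G (c + y * I) :=
    intervalIntegral.integral_add (continuousOn_vertical hF hc hH0).intervalIntegrable
      (continuousOn_vertical hG hc hH0).intervalIntegrable
  rw [rectIntegral, rectIntegral, rectIntegral, hv a ha.ne, hv b hb.ne',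
    intervalIntegral.integral_add ((continuous_real hF).intervalIntegrable _ _)
      ((continuous_real hG).intervalIntegrable _ _),
    intervalIntegral.integral_add ((continuous_horizontal hF hH).intervalIntegrable _ _)
      ((continuous_horizontal hG hH).intervalIntegrable _ _)]
  ring

theorem rectIntegral_const_mul (c : ℂ) (F : ℂ → ℂ) (a b H : ℝ) :
    rectIntegral (fun k => c * F k) a b H = c * rectIntegral F a b H := by
  simp only [rectIntegral, intervalIntegral.integral_const_mul]
  ring

theorem integral_horizontal_eq_sub {Φ : ℂ → ℂ} {y : ℝ}
    (hΦ : ∀ x ∈ uIcc a b, HasDerivAt Φ (F (x + y * I)) (x + y * I))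
    (hF : ContinuousOn (fun x : ℝ => F (x + y * I)) (uIcc a b)) :
    ∫ x in a..b, F (x + y * I) = Φ (b + y * I) - Φ (a + y * I) := by
  rw [intervalIntegral.integral_eq_sub_of_hasDerivAt (f := fun x : ℝ => Φ (x + y * I))
    (fun x hx => ?_) hF.intervalIntegrable]
  have hline : HasDerivAt (fun x : ℂ => x + y * I) 1 (x : ℂ) := (hasDerivAt_id _).add_const _
  simpa using ((hΦ x hx).comp (x : ℂ) hline).comp_ofReal

theorem I_mul_integral_vertical_eq_sub {Φ : ℂ → ℂ} {x : ℝ}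
    (hΦ : ∀ y ∈ uIcc a b, HasDerivAt Φ (F (x + y * I)) (x + y * I))
    (hF : ContinuousOn (fun y : ℝ => F (x + y * I)) (uIcc a b)) :
    I * ∫ y in a..b, F (x + y * I) = Φ (x + b * I) - Φ (x + a * I) := by
  rw [← intervalIntegral.integral_const_mul,
    intervalIntegral.integral_eq_sub_of_hasDerivAt (f := fun y : ℝ => Φ (x + y * I))
    (fun y hy => ?_) (hF.const_mul I).intervalIntegrable]
  have hline : HasDerivAt (fun y : ℂ => x + y * I) I (y : ℂ) := by
    simpa using ((hasDerivAt_id (y : ℂ)).mul_const I).const_add (x : ℂ)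
  simpa [mul_comm] using ((hΦ y hy).comp (y : ℂ) hline).comp_ofReal

theorem rectIntegral_eq_zero_of_hasDerivAt {Φ : ℂ → ℂ}
    (hΦ : ∀ k ∈ puncturedUpper, HasDerivAt Φ (F k) k) (hF : ContinuousOn F puncturedUpper)
    (ha : a < 0) (hb : 0 < b) (hH : 1 < H) : rectIntegral F a b H = 0 := by
  have hH0 : 0 ≤ H := (zero_lt_one.trans hH).le
  have hv (c : ℝ) (hc : c ≠ 0) : I * ∫ y in (0 : ℝ)..H, F (c + y * I)
      = Φ (c + H * I) - Φ (c + (0 : ℝ) * I) :=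
    I_mul_integral_vertical_eq_sub
      (fun y hy => hΦ _ (vertical_mem_puncturedUpper hc hH0 y hy)) (continuousOn_vertical hF hc hH0)
  rw [rectIntegral, hv a ha.ne, hv b hb.ne',
    integral_horizontal_eq_sub (fun x _ => hΦ _ (real_mem_puncturedUpper x))
      (continuous_real hF).continuousOn,
    integral_horizontal_eq_sub (fun x _ => hΦ _ (horizontal_mem_puncturedUpper x hH))
      (continuous_horizontal hF hH).continuousOn]
  ring

theorem rectIntegral_eq_zero_of_differentiableOn (hc : ContinuousOn F closedUpper)
    (hd : DifferentiableOn ℂ F upper) (hH : 0 ≤ H) : rectIntegral F a b H = 0 := by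
  have h := integral_boundary_rect_eq_zero_of_continuousOn_of_differentiableOn F (a : ℂ) (b + H * I)
    (hc.mono fun k hk => ?_) (hd.mono fun k hk => ?_)
  · simpa [rectIntegral] using h
  · have him := hk.2
    simp only [ofReal_im, add_im, mul_im, ofReal_re, I_im, mul_one, I_re, mul_zero, add_zero,
      zero_add, uIcc_of_le hH] at him
    exact him.1
  · have him := hk.2
    simp only [ofReal_im, add_im, mul_im, ofReal_re, I_im, mul_one, I_re, mul_zero, add_zero,
      zero_add, min_eq_left hH] at him
    exact him.1

theorem hasDerivAt_log_const_mul_sub {c z k : ℂ} (hk : c * (k - z) ∈ slitPlane) :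
    HasDerivAt (fun k => log (c * (k - z))) (1 / (k - z)) k := by
  have hc : c ≠ 0 := by rintro rfl; simp at hk
  have hkz : k - z ≠ 0 := by intro h; simp [h] at hk
  have hlin : HasDerivAt (fun k : ℂ => c * (k - z)) c k := by
    simpa using ((hasDerivAt_id k).sub_const z).const_mul c
  convert! hlin.clog hk using 1
  field_simp

theorem log_neg_of_im_pos {z : ℂ} (hz : 0 < z.im) : log (-z) = log z - Real.pi * I := by
  rw [log, log, norm_neg, arg_neg_eq_arg_sub_pi_of_im_pos hz]
  push_cast
  ring

theorem log_neg_of_im_neg {z : ℂ} (hz : z.im < 0) : log (-z) = log z + Real.pi * I := by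
  rw [log, log, norm_neg, arg_neg_eq_arg_add_pi_of_im_neg hz]
  push_cast
  ring

theorem continuousOn_one_div_sub_I : ContinuousOn (fun k : ℂ => 1 / (k - I)) puncturedUpper :=
  ContinuousOn.div (by fun_prop) (by fun_prop) fun _ hk => sub_I_ne_zero hk

/-- `log (-i(k - i))` is a primitive on the upper three sides and `log (i(k - i))` on the base; the
two branches differ by `πi` at each of the vertices `a` and `b`. -/
theorem rectIntegral_one_div_sub_I (ha : a < 0) (hb : 0 < b) (hH : 1 < H) :
    rectIntegral (fun k => 1 / (k - I)) a b H = 2 * Real.pi * I := by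
  have hH0 : 0 ≤ H := (zero_lt_one.trans hH).le
  have hside (c : ℝ) (hc : c ≠ 0) : I * ∫ y in (0 : ℝ)..H, 1 / ((c : ℂ) + y * I - I)
      = log (-I * (c + H * I - I)) - log (-I * (c + (0 : ℝ) * I - I)) :=
    I_mul_integral_vertical_eq_sub (F := fun k => 1 / (k - I)) (Φ := fun k => log (-I * (k - I)))
      (fun y _ => hasDerivAt_log_const_mul_sub (mem_slitPlane_iff.2 (.inr (by simpa using hc))))
      (continuousOn_vertical continuousOn_one_div_sub_I hc hH0)
  have hbase := integral_horizontal_eq_sub (F := fun k => 1 / (k - I))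
    (Φ := fun k => log (I * (k - I))) (a := a) (b := b) (y := 0)
    (fun x _ => hasDerivAt_log_const_mul_sub (mem_slitPlane_iff.2 (.inl (by simp))))
    (continuous_real continuousOn_one_div_sub_I).continuousOn
  have htop := integral_horizontal_eq_sub (F := fun k => 1 / (k - I))
    (Φ := fun k => log (-I * (k - I))) (a := a) (b := b) (y := H)
    (fun x _ => hasDerivAt_log_const_mul_sub (mem_slitPlane_iff.2 (.inl (by simpa using hH))))
    (continuous_horizontal continuousOn_one_div_sub_I hH).continuousOn
  have hvertex (c : ℝ) : I * ((c : ℂ) + (0 : ℝ) * I - I) = 1 + c * I := by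
    push_cast
    linear_combination -I_sq
  rw [rectIntegral, hside a ha.ne, hside b hb.ne', hbase, htop,
    neg_mul I ((a : ℂ) + (0 : ℝ) * I - I), neg_mul I ((b : ℂ) + (0 : ℝ) * I - I), hvertex, hvertex,
    log_neg_of_im_neg (z := 1 + a * I) (by simpa using ha),
    log_neg_of_im_pos (z := 1 + b * I) (by simpa using hb)]
  ring

end Sides

section Deformation

variable {F G : ℂ → ℂ}

theorem DeformsToRect.congr (hF : DeformsToRect γ F) (hγ : IsContourAroundI γ)
    (h : EqOn G F puncturedUpper) : DeformsToRect γ G := by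
  refine ⟨hF.continuousOn.congr h, fun a b H ha hb hH => ?_⟩
  rw [contourIntegral_congr fun u hu => h (hγ.mem_puncturedUpper hu), ← hF.eq a b H ha hb hH,
    rectIntegral_congr h ha hb hH]

theorem DeformsToRect.add (hγ : IsContourAroundI γ) (hF : DeformsToRect γ F)
    (hG : DeformsToRect γ G) : DeformsToRect γ (fun k => F k + G k) := by
  refine ⟨hF.continuousOn.add hG.continuousOn, fun a b H ha hb hH => ?_⟩
  rw [hγ.contourIntegral_add hF.continuousOn hG.continuousOn, ← hF.eq a b H ha hb hH,
    ← hG.eq a b H ha hb hH, rectIntegral_add hF.continuousOn hG.continuousOn ha hb hH]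

theorem DeformsToRect.const_mul (hF : DeformsToRect γ F) (c : ℂ) :
    DeformsToRect γ (fun k => c * F k) := by
  refine ⟨hF.continuousOn.const_mul c, fun a b H ha hb hH => ?_⟩
  rw [contourIntegral_const_mul, ← hF.eq a b H ha hb hH, rectIntegral_const_mul]

theorem DeformsToRect.sub (hγ : IsContourAroundI γ) (hF : DeformsToRect γ F)
    (hG : DeformsToRect γ G) : DeformsToRect γ (fun k => F k - G k) :=
  (hF.add hγ (hG.const_mul (-1))).congr hγ fun k _ => by ring

theorem deformsToRect_of_differentiableOn (hγ : IsContourAroundI γ)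
    (hc : ContinuousOn F closedUpper) (hd : DifferentiableOn ℂ F upper) : DeformsToRect γ F := by
  refine ⟨hc.mono sdiff_subset, fun a b H _ _ hH => ?_⟩
  rw [hγ.contourIntegral_eq_zero hd,
    rectIntegral_eq_zero_of_differentiableOn hc hd (zero_lt_one.trans hH).le]

theorem deformsToRect_of_hasDerivAt (hγ : IsContourAroundI γ) {Φ : ℂ → ℂ}
    (hΦ : ∀ k ∈ puncturedUpper, HasDerivAt Φ (F k) k) (hF : ContinuousOn F puncturedUpper) :
    DeformsToRect γ F := by
  refine ⟨hF, fun a b H ha hb hH => ?_⟩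
  rw [hγ.contourIntegral_eq_zero_of_hasDerivAt (f := Φ)
    (fun u hu => hΦ _ (hγ.mem_puncturedUpper hu)) (hγ.comp_continuousOn hF),
    rectIntegral_eq_zero_of_hasDerivAt hΦ hF ha hb hH]

theorem deformsToRect_one_div_sub_I (hγ : IsContourAroundI γ) :
    DeformsToRect γ (fun k => 1 / (k - I)) :=
  ⟨continuousOn_one_div_sub_I,
    fun a b H ha hb hH => by rw [rectIntegral_one_div_sub_I ha hb hH, hγ.winding]⟩

theorem deformsToRect_one_div_sub_I_pow (hγ : IsContourAroundI γ) (n : ℕ) :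
    DeformsToRect γ (fun k => 1 / (k - I) ^ (n + 1)) := by
  rcases n with _ | n
  · simpa using deformsToRect_one_div_sub_I hγ
  refine deformsToRect_of_hasDerivAt hγ (Φ := fun k => (-1 / (n + 1)) * ((k - I) ^ (n + 1))⁻¹)
    (fun k hk => ?_) (ContinuousOn.div (by fun_prop) (by fun_prop)
      fun k hk => pow_ne_zero _ (sub_I_ne_zero hk))
  have hkI := sub_I_ne_zero hk
  have hpow : HasDerivAt (fun k : ℂ => (k - I) ^ (n + 1)) ((n + 1) * (k - I) ^ n) k := by
    simpa using ((hasDerivAt_id k).sub_const I).fun_pow (n + 1)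
  convert! (hpow.inv (pow_ne_zero _ hkI)).const_mul (-1 / ((n : ℂ) + 1)) using 1
  have : (n : ℂ) + 1 ≠ 0 := by exact_mod_cast n.succ_ne_zero
  field_simp
  ring

theorem deformsToRect_div_sub_I_pow (hγ : IsContourAroundI γ) (n : ℕ) {f : ℂ → ℂ}
    (hc : ContinuousOn f closedUpper) (hd : DifferentiableOn ℂ f upper) :
    DeformsToRect γ (fun k => f k / (k - I) ^ n) := by
  induction n generalizing f with
  | zero => simpa using deformsToRect_of_differentiableOn hγ hc hd
  | succ n ih =>
    -- split off the leading pole: `f k = f I + (k - I) * dslope f I k`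
    have hdI : DifferentiableAt ℂ f I := hd.differentiableAt upper_mem_nhds_I
    have hslope := ih ((continuousOn_dslope closedUpper_mem_nhds_I).2 ⟨hc, hdI⟩)
      ((differentiableOn_dslope upper_mem_nhds_I).2 hd)
    refine (((deformsToRect_one_div_sub_I_pow hγ n).const_mul (f I)).add hγ hslope).congr hγ
      fun k hk => ?_
    have hkI := sub_I_ne_zero hk
    have hsplit := sub_smul_dslope f I k
    rw [smul_eq_mul] at hsplit
    simp only [pow_succ]
    field_simp
    linear_combination -hsplit

end Deformation

theorem hasSum_integral_mul_powerSeries_comp {c : ℕ → ℂ} {E : ℂ → ℂ}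
    (hE : ∀ z, HasSum (fun n => c n * z ^ n) (E z)) {G Z : ℝ → ℂ} {a b : ℝ}
    (hG : ContinuousOn G (uIcc a b)) (hZ : ContinuousOn Z (uIcc a b)) :
    HasSum (fun n => ∫ u in a..b, G u * (c n * Z u ^ n)) (∫ u in a..b, G u * E (Z u)) := by
  obtain ⟨M, hM⟩ := isCompact_uIcc.exists_bound_of_continuousOn hZ
  obtain ⟨A, hA⟩ := isCompact_uIcc.exists_bound_of_continuousOn hG
  refine intervalIntegral.hasSum_integral_of_dominated_convergence
    (fun n _ => A * ‖c n * (M : ℂ) ^ n‖) (fun n => ?_) (fun n => ae_of_all _ fun u hu => ?_)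
    (ae_of_all _ fun u _ => (hE M).summable.norm.mul_left A) intervalIntegrable_const
    (ae_of_all _ fun u _ => (hE (Z u)).mul_left _)
  · exact ((hG.mul ((hZ.pow n).const_mul _)).mono uIoc_subset_uIcc).aestronglyMeasurable
      measurableSet_uIoc
  · have hGu := hA u (uIoc_subset_uIcc hu)
    have hZu : ‖Z u‖ ≤ ‖(M : ℂ)‖ :=
      (hM u (uIoc_subset_uIcc hu)).trans (by simpa using le_abs_self M)
    have hA0 : 0 ≤ A := (norm_nonneg _).trans hGu
    simp only [norm_mul, norm_pow]
    gcongr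

section EntireOfOmegaSq

variable {c : ℕ → ℂ} {E g : ℂ → ℂ}

theorem IsContourAroundI.hasSum_contourIntegral (hγ : IsContourAroundI γ)
    (hE : ∀ z, HasSum (fun n => c n * z ^ n) (E z)) (hg : ContinuousOn g puncturedUpper) :
    HasSum (fun n => contourIntegral γ (fun k => g k * (c n * omegaSq k ^ n)))
      (contourIntegral γ (fun k => g k * E (omegaSq k))) := by
  have hI : uIcc (0 : ℝ) 1 = Icc 0 1 := uIcc_of_le zero_le_one
  have hsum := hasSum_integral_mul_powerSeries_comp hE (a := 0) (b := 1)
    (by rw [hI]; exact (hγ.comp_continuousOn hg).mul hγ.continuousOn_derivWithin)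
    (by rw [hI]; exact hγ.comp_continuousOn continuousOn_omegaSq)
  simpa only [contourIntegral, Pi.mul_apply, mul_right_comm] using hsum

theorem hasSum_rectIntegral (hE : ∀ z, HasSum (fun n => c n * z ^ n) (E z))
    (hg : ContinuousOn g puncturedUpper) {a b H : ℝ} (ha : a < 0) (hb : 0 < b) (hH : 1 < H) :
    HasSum (fun n => rectIntegral (fun k => g k * (c n * omegaSq k ^ n)) a b H)
      (rectIntegral (fun k => g k * E (omegaSq k)) a b H) := by
  have hH0 : 0 ≤ H := (zero_lt_one.trans hH).le
  have hhor (y : ℝ) (hy : ∀ x : ℝ, (x : ℂ) + y * I ∈ puncturedUpper) :=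
    hasSum_integral_mul_powerSeries_comp hE (a := a) (b := b)
      (hg.comp_continuous (by fun_prop) hy).continuousOn
      (continuousOn_omegaSq.comp_continuous (by fun_prop) hy).continuousOn
  have hvert (x : ℝ) (hx : x ≠ 0) := hasSum_integral_mul_powerSeries_comp hE
    (continuousOn_vertical hg hx hH0) (continuousOn_vertical continuousOn_omegaSq hx hH0)
  exact (((hhor 0 real_mem_puncturedUpper).sub
    (hhor H fun x => horizontal_mem_puncturedUpper x hH)).add
    ((hvert b hb.ne').mul_left I)).sub ((hvert a ha.ne).mul_left I)

end EntireOfOmegaSq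

section Rational

variable {f : ℂ → ℂ}

theorem continuousOn_div_add_I (hc : ContinuousOn f closedUpper) :
    ContinuousOn (fun k => f k / (k + I)) closedUpper :=
  hc.div (by fun_prop) fun _ hk => add_I_ne_zero hk

theorem differentiableOn_div_add_I (hd : DifferentiableOn ℂ f upper) :
    DifferentiableOn ℂ (fun k => f k / (k + I)) upper :=
  hd.div (by fun_prop) fun _ hk => add_I_ne_zero (upper_subset_closedUpper hk)

theorem deformsToRect_div_pow_mul_omegaSq_pow (hγ : IsContourAroundI γ)
    (hc : ContinuousOn f closedUpper) (hd : DifferentiableOn ℂ f upper) (m n : ℕ) :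
    DeformsToRect γ (fun k => f k / (k - I) ^ m * omegaSq k ^ n) := by
  refine (deformsToRect_div_sub_I_pow hγ (m + n) (f := fun k => f k * (k ^ 2 / (k + I)) ^ n)
    (hc.mul ((continuousOn_div_add_I (by fun_prop)).pow n))
    (hd.mul ((differentiableOn_div_add_I (by fun_prop)).pow n))).congr hγ fun k hk => ?_
  have hsub := sub_I_ne_zero hk
  have hadd := add_I_ne_zero hk.1
  simp only [omegaSq, one_add_sq_eq, div_pow, mul_pow, pow_add]
  field_simp

/-- `ω²` has a pole at `i`, so `E ∘ ω²` has an essential singularity there; expanding `E` into its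
Taylor series reduces the claim to poles. -/
theorem deformsToRect_div_pow_mul_entire (hγ : IsContourAroundI γ) {E : ℂ → ℂ}
    (hE : Differentiable ℂ E) (hc : ContinuousOn f closedUpper) (hd : DifferentiableOn ℂ f upper)
    (m : ℕ) : DeformsToRect γ (fun k => f k / (k - I) ^ m * E (omegaSq k)) := by
  have hg : ContinuousOn (fun k => f k / (k - I) ^ m) puncturedUpper :=
    (hc.mono sdiff_subset).div (by fun_prop) fun k hk => pow_ne_zero _ (sub_I_ne_zero hk)
  have hsum (z : ℂ) : HasSum (fun n : ℕ => ((n.factorial : ℂ)⁻¹ * iteratedDeriv n E 0) * z ^ n)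
      (E z) := by
    convert! hasSum_taylorSeries_of_entire hE 0 z using 2 with n
    simp only [smul_eq_mul, sub_zero]
    ring
  have hterm (n : ℕ) := ((deformsToRect_div_pow_mul_omegaSq_pow hγ hc hd m n).const_mul
    ((n.factorial : ℂ)⁻¹ * iteratedDeriv n E 0)).congr hγ
      (G := fun k => f k / (k - I) ^ m * (((n.factorial : ℂ)⁻¹ * iteratedDeriv n E 0)
        * omegaSq k ^ n)) fun k _ => by ring
  refine ⟨hg.mul (hE.continuous.comp_continuousOn continuousOn_omegaSq), fun a b H ha hb hH => ?_⟩
  refine (hasSum_rectIntegral hsum hg ha hb hH).unique ?_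
  simp only [(hterm _).eq a b H ha hb hH]
  exact hγ.hasSum_contourIntegral hsum hg

end Rational

/-! ### Closing the real line in the upper half-plane -/

/-- The filter of neighbourhoods of infinity in the closed upper half-plane. -/
def upperInfty : Filter ℂ := Bornology.cobounded ℂ ⊓ 𝓟 closedUpper

theorem eventually_upperInfty {P : ℂ → Prop} (h : ∀ᶠ k in upperInfty, P k) :
    ∃ R : ℝ, 1 < R ∧ ∀ k ∈ closedUpper, R ≤ ‖k‖ → P k := by
  rw [upperInfty, eventually_inf_principal, ← comap_norm_atTop, eventually_comap] at h
  obtain ⟨R, hR⟩ := eventually_atTop.1 h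
  exact ⟨max R 2, by simp, fun k hk hk' => hR ‖k‖ (le_of_max_le_left hk') k rfl hk⟩

theorem tendsto_ofReal_upperInfty :
    Tendsto (fun k : ℝ => (k : ℂ)) (Bornology.cobounded ℝ) upperInfty := by
  refine tendsto_inf.2 ⟨?_, tendsto_principal.2 (.of_forall fun _ => by simp [closedUpper])⟩
  rw [← tendsto_norm_atTop_iff_cobounded]
  simp only [norm_real]
  exact tendsto_norm_cobounded_atTop (E := ℝ)

theorem norm_exp_I_mul (k : ℂ) (x : ℝ) : ‖exp (I * k * x)‖ = Real.exp (-x * k.im) := by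
  have hre : (I * k * x).re = -x * k.im := by
    simp
    ring
  rw [norm_exp, hre]

theorem integral_exp_neg_mul_le {x : ℝ} (hx : 0 < x) (H : ℝ) :
    ∫ y in (0 : ℝ)..H, Real.exp (-x * y) ≤ 1 / x := by
  have hderiv (y : ℝ) :
      HasDerivAt (fun y => -(1 / x) * Real.exp (-x * y)) (Real.exp (-x * y)) y := by
    convert! ((hasDerivAt_id y).const_mul (-x)).exp.const_mul (-(1 / x)) using 1
    field_simp
    simp
  rw [intervalIntegral.integral_eq_sub_of_hasDerivAt (fun y _ => hderiv y)
    (Continuous.intervalIntegrable (by fun_prop) _ _)]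
  have : 0 < 1 / x * Real.exp (-x * H) := by positivity
  simp only [mul_zero, Real.exp_zero]
  linarith

section Closing

variable {F : ℂ → ℂ} {a b H : ℝ}

theorem DeformsToRect.integral_sub_contourIntegral (hF : DeformsToRect γ F)
    (ha : a < 0) (hb : 0 < b) (hH : 1 < H) :
    (∫ k in a..b, F k) - contourIntegral γ F = (∫ k in a..b, F (k + H * I))
      - (I * (∫ y in (0 : ℝ)..H, F (b + y * I)) - I * ∫ y in (0 : ℝ)..H, F (a + y * I)) := by
  rw [← hF.eq a b H ha hb hH, rectIntegral]
  simp only [ofReal_zero, zero_mul, add_zero]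
  ring

theorem DeformsToRect.norm_integral_sub_contourIntegral_le (hF : DeformsToRect γ F)
    (ha : a < 0) (hb : 0 < b) (hH : 1 < H) {T S : ℝ} (htop : ‖∫ k in a..b, F (k + H * I)‖ ≤ T)
    (hright : ‖∫ y in (0 : ℝ)..H, F (b + y * I)‖ ≤ S)
    (hleft : ‖∫ y in (0 : ℝ)..H, F (a + y * I)‖ ≤ S) :
    ‖(∫ k in a..b, F k) - contourIntegral γ F‖ ≤ T + (S + S) := by
  rw [hF.integral_sub_contourIntegral ha hb hH]
  refine (norm_sub_le _ _).trans (add_le_add htop ((norm_sub_le _ _).trans (add_le_add ?_ ?_)))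
  · rwa [norm_mul, norm_I, one_mul]
  · rwa [norm_mul, norm_I, one_mul]

theorem mem_closedUpper_add_mul_I (c : ℝ) {y : ℝ} (hy : 0 ≤ y) :
    (c : ℂ) + y * I ∈ closedUpper := by
  simpa [closedUpper] using hy

theorem abs_le_norm_add_mul_I (c y : ℝ) : |c| ≤ ‖(c : ℂ) + y * I‖ := by
  simpa using abs_re_le_norm ((c : ℂ) + y * I)

theorem le_norm_add_mul_I (c y : ℝ) : y ≤ ‖(c : ℂ) + y * I‖ := by
  simpa using (le_abs_self _).trans (abs_im_le_norm ((c : ℂ) + y * I))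

theorem norm_integral_vertical_le {δ x R c : ℝ} (hδ : 0 ≤ δ) (hx : 0 < x)
    (hF : ∀ k ∈ closedUpper, R ≤ ‖k‖ → ‖F k‖ ≤ δ * Real.exp (-x * k.im))
    (hc : R ≤ |c|) (hH : 0 ≤ H) : ‖∫ y in (0 : ℝ)..H, F (c + y * I)‖ ≤ δ / x := by
  calc _ ≤ ∫ y in (0 : ℝ)..H, δ * Real.exp (-x * y) := by
        refine intervalIntegral.norm_integral_le_of_norm_le hH (ae_of_all _ fun y hy => ?_)
          (Continuous.intervalIntegrable (by fun_prop) _ _)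
        simpa using hF (c + y * I) (mem_closedUpper_add_mul_I c hy.1.le)
          (hc.trans (abs_le_norm_add_mul_I c y))
    _ ≤ δ * (1 / x) := by
        rw [intervalIntegral.integral_const_mul]
        gcongr
        exact integral_exp_neg_mul_le hx H
    _ = δ / x := by ring

theorem DeformsToRect.norm_integral_sub_contourIntegral_le_of_exp (hP : DeformsToRect γ F)
    {δ x R : ℝ} (hδ : 0 ≤ δ) (hx : 0 < x) (hR : 1 < R)
    (hF : ∀ k ∈ closedUpper, R ≤ ‖k‖ → ‖F k‖ ≤ δ * Real.exp (-x * k.im))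
    (ha : a ≤ -R) (hb : R ≤ b) :
    ‖(∫ k in a..b, F k) - contourIntegral γ F‖ ≤ δ / x + δ / x := by
  have hrect : ∀ᶠ H : ℝ in atTop, ‖(∫ k in a..b, F k) - contourIntegral γ F‖
      ≤ δ * Real.exp (-x * H) * |b - a| + (δ / x + δ / x) := by
    filter_upwards [eventually_gt_atTop R] with H hHR
    have hH0 : 0 ≤ H := by linarith
    refine hP.norm_integral_sub_contourIntegral_le (by linarith) (by linarith) (hR.trans hHR)
      (intervalIntegral.norm_integral_le_of_norm_le_const fun k _ => ?_)
      (norm_integral_vertical_le hδ hx hF (hb.trans (le_abs_self _)) hH0)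
      (norm_integral_vertical_le hδ hx hF ((le_neg.2 ha).trans (neg_le_abs _)) hH0)
    simpa using hF (k + H * I) (mem_closedUpper_add_mul_I k hH0)
      (hHR.le.trans (le_norm_add_mul_I k H))
  have hexp : Tendsto (fun H : ℝ => Real.exp (-x * H)) atTop (𝓝 0) :=
    Real.tendsto_exp_atBot.comp (tendsto_id.const_mul_atTop_of_neg (by linarith))
  have hlim := ((hexp.const_mul δ).mul_const |b - a|).add_const (δ / x + δ / x)
  rw [mul_zero, zero_mul, zero_add] at hlim
  exact ge_of_tendsto hlim hrect

/-- Jordan's lemma. -/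
theorem hasImproperIntegral_of_tendsto_zero {h : ℂ → ℂ} {x : ℝ} (hx : 0 < x)
    (hP : DeformsToRect γ (fun k => exp (I * k * x) * h k)) (hh : Tendsto h upperInfty (𝓝 0)) :
    HasImproperIntegral (fun k : ℝ => exp (I * k * x) * h k)
      (contourIntegral γ (fun k => exp (I * k * x) * h k)) := by
  refine Metric.tendsto_nhds.2 fun ε hε => ?_
  have hδ : 0 < ε * x / 4 := by positivity
  obtain ⟨R, hR1, hR⟩ := eventually_upperInfty (hh.eventually (Metric.ball_mem_nhds 0 hδ))
  filter_upwards [prod_mem_prod (Iic_mem_atBot (-R)) (Ici_mem_atTop R)] with ⟨a, b⟩ ⟨ha, hb⟩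
  rw [dist_eq_norm]
  refine (hP.norm_integral_sub_contourIntegral_le_of_exp hδ.le hx hR1 (fun k hk hk' => ?_)
    ha hb).trans_lt ?_
  · have hhk := hR k hk hk'
    rw [dist_zero_right] at hhk
    rw [norm_mul, norm_exp_I_mul, mul_comm]
    gcongr
  · field_simp
    linarith

theorem DeformsToRect.norm_integral_sub_contourIntegral_le_of_const (hP : DeformsToRect γ F)
    {R δ : ℝ} (hR : 1 < R) (hF : ∀ k ∈ closedUpper, R ≤ ‖k‖ → ‖F k‖ ≤ δ / R) :
    ‖(∫ k in (-R)..R, F k) - contourIntegral γ F‖ ≤ 2 * δ + (δ + δ) := by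
  have hR0 : 0 < R := zero_lt_one.trans hR
  have hside (c : ℝ) (hc : R ≤ |c|) : ‖∫ y in (0 : ℝ)..R, F (c + y * I)‖ ≤ δ := by
    have hle := intervalIntegral.norm_integral_le_of_norm_le_const (a := 0) (b := R) (C := δ / R)
      (f := fun y : ℝ => F (c + y * I)) fun y hy => hF _
        (mem_closedUpper_add_mul_I c (uIoc_of_le hR0.le ▸ hy).1.le)
        (hc.trans (abs_le_norm_add_mul_I c y))
    rwa [sub_zero, abs_of_pos hR0, div_mul_cancel₀ _ hR0.ne'] at hle
  refine hP.norm_integral_sub_contourIntegral_le (neg_lt_zero.2 hR0) hR0 hR ?_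
    (hside R (le_abs_self _)) (hside (-R) (by rw [abs_neg]; exact le_abs_self _))
  refine (intervalIntegral.norm_integral_le_of_norm_le_const (C := δ / R) fun k _ =>
    hF _ (mem_closedUpper_add_mul_I k hR0.le) (le_norm_add_mul_I k R)).trans_eq ?_
  rw [sub_neg_eq_add, ← two_mul, abs_of_pos (by linarith)]
  field_simp

theorem tendsto_integral_of_mul_tendsto_zero (hP : DeformsToRect γ F)
    (hF : Tendsto (fun k => k * F k) upperInfty (𝓝 0)) :
    Tendsto (fun R : ℝ => ∫ k in (-R)..R, F k) atTop (𝓝 (contourIntegral γ F)) := by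
  refine Metric.tendsto_nhds.2 fun ε hε => ?_
  obtain ⟨R₀, hR1, hR⟩ := eventually_upperInfty
    (hF.eventually (Metric.ball_mem_nhds 0 (by positivity : 0 < ε / 5)))
  filter_upwards [eventually_ge_atTop R₀] with R hRR
  have hR0 : 0 < R := by linarith
  rw [dist_eq_norm]
  refine (hP.norm_integral_sub_contourIntegral_le_of_const (δ := ε / 5) (hR1.trans_le hRR)
    fun k hk hk' => ?_).trans_lt (by linarith)
  have hkF := hR k hk (hRR.trans hk')
  rw [dist_zero_right, norm_mul] at hkF
  rw [le_div_iff₀ hR0, mul_comm]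
  exact (mul_le_mul_of_nonneg_right hk' (norm_nonneg _)).trans hkF.le

end Closing

theorem tendsto_mul_div_one_add_sq :
    Tendsto (fun k : ℂ => k * (k / (1 + k ^ 2))) (Bornology.cobounded ℂ) (𝓝 1) := by
  have hinv : Tendsto (fun k : ℂ => ((k⁻¹) ^ 2 + 1)⁻¹) (Bornology.cobounded ℂ) (𝓝 1) := by
    simpa using ((tendsto_inv₀_cobounded (α := ℂ).pow 2).add_const 1).inv₀ (by simp)
  refine hinv.congr' ?_
  filter_upwards [Bornology.eventually_ne_cobounded 0] with k hk
  field_simp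

theorem deformsToRect_div_one_add_sq (hγ : IsContourAroundI γ) :
    DeformsToRect γ (fun k => k / (1 + k ^ 2)) := by
  refine (deformsToRect_div_sub_I_pow hγ 1 (f := fun k => k / (k + I))
    (continuousOn_div_add_I (by fun_prop)) (differentiableOn_div_add_I (by fun_prop))).congr hγ
    fun _ _ => ?_
  simp only [one_add_sq_eq, pow_one, div_div]

theorem IsContourAroundI.contourIntegral_div_one_add_sq (hγ : IsContourAroundI γ) :
    contourIntegral γ (fun k => k / (1 + k ^ 2)) = Real.pi * I := by
  have hadd : ContinuousOn (fun k => 1 / (k + I)) puncturedUpper :=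
    (continuousOn_div_add_I (by fun_prop)).mono sdiff_subset
  rw [contourIntegral_congr (G := fun k => 1 / 2 * (1 / (k - I) + 1 / (k + I))),
    contourIntegral_const_mul, hγ.contourIntegral_add continuousOn_one_div_sub_I hadd, hγ.winding,
    hγ.contourIntegral_eq_zero (differentiableOn_div_add_I (by fun_prop))]
  · ring
  · intro u hu
    have hsub := sub_I_ne_zero (hγ.mem_puncturedUpper hu)
    have hadd := add_I_ne_zero (hγ.mem_puncturedUpper hu).1
    simp only [one_add_sq_eq]
    field_simp
    ring

theorem integral_neg_self_eq_zero_of_odd {f : ℝ → ℂ} (hf : ∀ k, f (-k) = -f k) (R : ℝ) :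
    ∫ k in (-R)..R, f k = 0 := by
  have hneg := intervalIntegral.integral_comp_neg (a := -R) (b := R) f
  rw [neg_neg] at hneg
  simp only [hf, intervalIntegral.integral_neg] at hneg
  exact self_eq_neg.1 hneg.symm

/-- Subtracting `L k / (1 + k²)`, which has the same residue at infinity, leaves an odd function
whose integral along the real line, taken symmetrically, both vanishes and closes in the upper
half-plane. -/
theorem contourIntegral_of_odd (hγ : IsContourAroundI γ) {F : ℂ → ℂ} (hP : DeformsToRect γ F)
    (hodd : ∀ k : ℝ, F (-k) = -F k) {L : ℂ}
    (hF : Tendsto (fun k => k * F k) upperInfty (𝓝 L)) :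
    contourIntegral γ F = Real.pi * I * L := by
  have hrat := (deformsToRect_div_one_add_sq hγ).const_mul L
  have hdecay : Tendsto (fun k => k * (F k - L * (k / (1 + k ^ 2)))) upperInfty (𝓝 0) := by
    have hsub := hF.sub ((tendsto_mul_div_one_add_sq.mono_left inf_le_left).const_mul L)
    rw [mul_one, sub_self] at hsub
    exact hsub.congr fun k => by ring
  have hline := tendsto_integral_of_mul_tendsto_zero (hP.sub hγ hrat) hdecay
  have hzero (R : ℝ) : ∫ k in (-R)..R, (F k - L * ((k : ℂ) / (1 + (k : ℂ) ^ 2))) = 0 :=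
    integral_neg_self_eq_zero_of_odd
      (f := fun k : ℝ => F k - L * ((k : ℂ) / (1 + (k : ℂ) ^ 2)))
      (fun k => by push_cast; rw [hodd]; ring) R
  simp only [hzero] at hline
  have hcontour := tendsto_nhds_unique hline tendsto_const_nhds
  rw [hγ.contourIntegral_sub hP.continuousOn hrat.continuousOn,
    contourIntegral_const_mul, hγ.contourIntegral_div_one_add_sq] at hcontour
  linear_combination hcontour

end Contour

/-! ### Gaussian summation of oscillatory integrals -/

theorem integrable_gauss_mul {F : ℝ → ℂ} (hF : Continuous F) {M : ℝ} (hM : ∀ k, ‖F k‖ ≤ M)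
    {ε : ℝ} (hε : 0 < ε) : Integrable (fun k : ℝ => (Real.exp (-ε * k ^ 2) : ℂ) * F k) :=
  (integrable_exp_neg_mul_sq hε).ofReal.mul_bdd hF.aestronglyMeasurable (ae_of_all _ hM)

theorem HasGaussIntegral.add {F G : ℝ → ℂ} {J K : ℂ} (hF : HasGaussIntegral F J)
    (hG : HasGaussIntegral G K)
    (hFi : ∀ ε > 0, Integrable (fun k : ℝ => (Real.exp (-ε * k ^ 2) : ℂ) * F k))
    (hGi : ∀ ε > 0, Integrable (fun k : ℝ => (Real.exp (-ε * k ^ 2) : ℂ) * G k)) :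
    HasGaussIntegral (fun k => F k + G k) (J + K) := by
  refine (Tendsto.add hF hG).congr' ?_
  filter_upwards [self_mem_nhdsWithin] with ε hε
  rw [← integral_add (hFi ε hε) (hGi ε hε)]
  simp only [mul_add]

theorem norm_exp_neg_mul_sq_le_one {ε : ℝ} (hε : 0 < ε) (k : ℝ) :
    ‖(Real.exp (-ε * k ^ 2) : ℂ)‖ ≤ 1 := by
  rw [norm_real, Real.norm_eq_abs, Real.abs_exp, Real.exp_le_one_iff, neg_mul, neg_nonpos]
  positivity

theorem integrable_gauss_mul_of_integrable {F : ℝ → ℂ} (hF : Integrable F) {ε : ℝ} (hε : 0 < ε) :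
    Integrable (fun k : ℝ => (Real.exp (-ε * k ^ 2) : ℂ) * F k) :=
  hF.bdd_mul (Continuous.aestronglyMeasurable (by fun_prop))
    (ae_of_all _ (norm_exp_neg_mul_sq_le_one hε))

theorem hasGaussIntegral_of_integrable {F : ℝ → ℂ} (hF : Integrable F) :
    HasGaussIntegral F (∫ k, F k) := by
  refine ((Real.tendsto_integral_cexp_sq_smul hF).comp tendsto_inv_nhdsGT_zero).congr fun ε => ?_
  simp [← ofReal_pow]

theorem hasImproperIntegral_of_integrable {F : ℝ → ℂ} (hF : Integrable F) :
    HasImproperIntegral F (∫ k, F k) :=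
  intervalIntegral_tendsto_integral hF tendsto_fst tendsto_snd

section Abel

variable {F Ψ : ℝ → ℂ} {J : ℂ}

theorem hasDerivAt_neg_exp_neg_sq (s : ℝ) :
    HasDerivAt (fun s : ℝ => -Real.exp (-s ^ 2)) (2 * s * Real.exp (-s ^ 2)) s := by
  convert! (hasDerivAt_pow 2 s).fun_neg.exp.fun_neg using 1
  push_cast
  ring

theorem two_mul_exp_neg_sq_nonneg {s : ℝ} (hs : s ∈ Ioi (0 : ℝ)) :
    0 ≤ 2 * s * Real.exp (-s ^ 2) := by
  have : 0 < s := hs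
  positivity

theorem tendsto_neg_exp_neg_sq_atTop :
    Tendsto (fun s : ℝ => -Real.exp (-s ^ 2)) atTop (𝓝 0) := by
  simpa using (Real.tendsto_exp_neg_atTop_nhds_zero.comp (tendsto_pow_atTop two_ne_zero)).neg

theorem integrableOn_two_mul_exp_neg_sq :
    IntegrableOn (fun s : ℝ => 2 * s * Real.exp (-s ^ 2)) (Ioi 0) :=
  integrableOn_Ioi_deriv_of_nonneg' (fun s _ => hasDerivAt_neg_exp_neg_sq s)
    (fun _ hs => two_mul_exp_neg_sq_nonneg hs) tendsto_neg_exp_neg_sq_atTop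

theorem integral_Ioi_two_mul_exp_neg_sq :
    ∫ s in Ioi (0 : ℝ), 2 * s * Real.exp (-s ^ 2) = 1 := by
  rw [integral_Ioi_of_hasDerivAt_of_nonneg' (fun s _ => hasDerivAt_neg_exp_neg_sq s)
    (fun _ hs => two_mul_exp_neg_sq_nonneg hs) tendsto_neg_exp_neg_sq_atTop]
  simp

theorem hasDerivAt_integral_neg_self (hF : Continuous F) (s : ℝ) :
    HasDerivAt (fun s => ∫ k in (-s)..s, F k) (F s + F (-s)) s := by
  have hsplit : (fun s => ∫ k in (-s)..s, F k)
      = fun s => (∫ k in (0 : ℝ)..s, F k) - ∫ k in (0 : ℝ)..(-s), F k := by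
    ext s
    rw [intervalIntegral.integral_interval_sub_left] <;> exact hF.intervalIntegrable _ _
  have hright := (hF.integral_hasStrictDerivAt 0 s).hasDerivAt
  have hleft := (hF.integral_hasStrictDerivAt 0 (-s)).hasDerivAt.scomp s (hasDerivAt_neg s)
  rw [hsplit]
  convert! hright.sub hleft using 1
  simp

theorem exists_norm_le_of_tendsto_atTop (hΨ : Continuous Ψ) (h : Tendsto Ψ atTop (𝓝 J)) :
    ∃ B, ∀ s ∈ Ici (0 : ℝ), ‖Ψ s‖ ≤ B := by
  obtain ⟨R, hR⟩ := eventually_atTop.1 (h.norm.eventually (gt_mem_nhds (lt_add_one ‖J‖)))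
  obtain ⟨B, hB⟩ :=
    (isCompact_Icc (a := 0) (b := R)).exists_bound_of_continuousOn hΨ.continuousOn
  refine ⟨max B (‖J‖ + 1), fun s hs => ?_⟩
  rcases le_total s R with hsR | hsR
  · exact (hB s ⟨hs, hsR⟩).trans (le_max_left _ _)
  · exact (hR s hsR).le.trans (le_max_right _ _)

theorem integral_eq_integral_Ioi_add_comp_neg {f : ℝ → ℂ} (hf : Integrable f) :
    ∫ k, f k = ∫ k in Ioi (0 : ℝ), (f k + f (-k)) := by
  have hneg := integral_comp_neg_Ioi (0 : ℝ) f
  rw [neg_zero] at hneg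
  rw [integral_add hf.integrableOn hf.comp_neg.integrableOn, hneg, add_comm,
    intervalIntegral.integral_Iic_add_Ioi hf.integrableOn hf.integrableOn]

theorem integral_Ioi_gauss_mul_by_parts {ψ : ℝ → ℂ} (hΨ : ∀ s, HasDerivAt Ψ (ψ s) s)
    (hΨ0 : Ψ 0 = 0) {B : ℝ} (hB : ∀ s ∈ Ici (0 : ℝ), ‖Ψ s‖ ≤ B) {ε : ℝ} (hε : 0 < ε)
    (hψ : IntegrableOn (fun k : ℝ => (Real.exp (-ε * k ^ 2) : ℂ) * ψ k) (Ioi 0)) :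
    ∫ k in Ioi (0 : ℝ), (Real.exp (-ε * k ^ 2) : ℂ) * ψ k
      = ∫ k in Ioi (0 : ℝ), ((2 * ε * k * Real.exp (-ε * k ^ 2) : ℝ) : ℂ) * Ψ k := by
  have hΨc : Continuous Ψ := continuous_iff_continuousAt.2 fun s => (hΨ s).continuousAt
  have hint : IntegrableOn
      (fun k : ℝ => ((2 * ε * k * Real.exp (-ε * k ^ 2) : ℝ) : ℂ) * Ψ k) (Ioi 0) := by
    have hgauss : Integrable (fun k : ℝ => 2 * ε * k * Real.exp (-ε * k ^ 2)) := by
      simpa only [mul_assoc] using (integrable_mul_exp_neg_mul_sq hε).const_mul (2 * ε)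
    refine hgauss.ofReal.integrableOn.mul_bdd (c := B) hΨc.aestronglyMeasurable ?_
    filter_upwards [ae_restrict_mem measurableSet_Ioi] with k hk using hB k (mem_Ici_of_Ioi hk)
  have hderiv (k : ℝ) : HasDerivAt (fun k : ℝ => (Real.exp (-ε * k ^ 2) : ℂ) * Ψ k)
      ((Real.exp (-ε * k ^ 2) : ℂ) * ψ k
        - ((2 * ε * k * Real.exp (-ε * k ^ 2) : ℝ) : ℂ) * Ψ k) k := by
    convert! ((hasDerivAt_pow 2 k).const_mul (-ε)).exp.ofReal_comp.mul (hΨ k) using 1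
    push_cast
    ring
  have hexp : Tendsto (fun k : ℝ => Real.exp (-ε * k ^ 2)) atTop (𝓝 0) :=
    Real.tendsto_exp_atBot.comp
      ((tendsto_pow_atTop two_ne_zero).const_mul_atTop_of_neg (by linarith))
  have hlim : Tendsto (fun k : ℝ => (Real.exp (-ε * k ^ 2) : ℂ) * Ψ k) atTop (𝓝 0) := by
    refine squeeze_zero_norm' (a := fun k => Real.exp (-ε * k ^ 2) * B) ?_
      (by simpa only [zero_mul] using hexp.mul_const B)
    filter_upwards [eventually_ge_atTop 0] with k hk
    rw [norm_mul, norm_real, Real.norm_eq_abs, Real.abs_exp]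
    exact mul_le_mul_of_nonneg_left (hB k hk) (Real.exp_pos _).le
  have hparts := integral_Ioi_of_hasDerivAt_of_tendsto' (fun k _ => hderiv k) (hψ.sub hint) hlim
  rwa [integral_sub hψ hint, hΨ0, mul_zero, sub_zero, sub_eq_zero] at hparts

theorem integral_Ioi_two_mul_exp_neg_mul_sq_mul (Ψ : ℝ → ℂ) {ε : ℝ} (hε : 0 < ε) :
    ∫ k in Ioi (0 : ℝ), ((2 * ε * k * Real.exp (-ε * k ^ 2) : ℝ) : ℂ) * Ψ k
      = ∫ s in Ioi (0 : ℝ), ((2 * s * Real.exp (-s ^ 2) : ℝ) : ℂ) * Ψ (s / √ε) := by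
  have hε' : 0 < √ε := Real.sqrt_pos.2 hε
  have hscale := integral_comp_mul_left_Ioi
    (fun s : ℝ => ((2 * s * Real.exp (-s ^ 2) : ℝ) : ℂ) * Ψ (s / √ε)) 0 hε'
  rw [mul_zero, eq_inv_smul_iff₀ hε'.ne', ← integral_smul] at hscale
  rw [← hscale]
  refine integral_congr_ae (ae_of_all _ fun k => ?_)
  simp only
  rw [mul_div_cancel_left₀ _ hε'.ne', mul_pow, Real.sq_sqrt hε.le, real_smul, ← mul_assoc,
    ← ofReal_mul, neg_mul]
  congr 2
  linear_combination (-2 * k * Real.exp (-(ε * k ^ 2))) * Real.mul_self_sqrt hε.le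

theorem tendsto_sqrt_nhdsGT_zero : Tendsto (fun ε : ℝ => √ε) (𝓝[>] 0) (𝓝[>] 0) := by
  refine tendsto_nhdsWithin_of_tendsto_nhds_of_eventually_within _ ?_ ?_
  · simpa using (Real.continuous_sqrt.tendsto 0).mono_left nhdsWithin_le_nhds
  · filter_upwards [self_mem_nhdsWithin] with ε hε using Real.sqrt_pos.2 hε

theorem tendsto_integral_Ioi_two_mul_exp_neg_sq_mul (hΨ : Continuous Ψ)
    (h : Tendsto Ψ atTop (𝓝 J)) {B : ℝ} (hB : ∀ s ∈ Ici (0 : ℝ), ‖Ψ s‖ ≤ B) :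
    Tendsto (fun ε : ℝ => ∫ s in Ioi (0 : ℝ),
      ((2 * s * Real.exp (-s ^ 2) : ℝ) : ℂ) * Ψ (s / √ε)) (𝓝[>] 0) (𝓝 J) := by
  have hJ : ∫ s in Ioi (0 : ℝ), ((2 * s * Real.exp (-s ^ 2) : ℝ) : ℂ) * J = J := by
    rw [integral_mul_const, integral_complex_ofReal, integral_Ioi_two_mul_exp_neg_sq, ofReal_one,
      one_mul]
  refine Eq.subst (motive := fun z => Tendsto _ _ (𝓝 z)) hJ ?_
  refine tendsto_integral_filter_of_dominated_convergence
    (fun s => ‖2 * s * Real.exp (-s ^ 2)‖ * B)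
    (.of_forall fun ε => Continuous.aestronglyMeasurable (by fun_prop)) (.of_forall fun ε => ?_)
    (integrableOn_two_mul_exp_neg_sq.norm.mul_const B) ?_
  · filter_upwards [ae_restrict_mem measurableSet_Ioi] with s hs
    rw [norm_mul, norm_real]
    gcongr
    exact hB _ (div_nonneg (le_of_lt hs) (Real.sqrt_nonneg _))
  · filter_upwards [ae_restrict_mem measurableSet_Ioi] with s hs
    refine Tendsto.const_mul _ (h.comp ?_)
    simpa [div_eq_mul_inv] using (tendsto_inv_nhdsGT_zero.comp
      tendsto_sqrt_nhdsGT_zero).const_mul_atTop (show 0 < s from hs)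

/-- Abel's theorem for the Gaussian cut-off: after an integration by parts and a rescaling, the
Gaussian integral is an average of the partial integrals `∫_{-s/√ε}^{s/√ε} F` against the
probability density `2 s exp(-s²)`. -/
theorem HasImproperIntegral.hasGaussIntegral (h : HasImproperIntegral F J)
    (hF : Continuous F) (hb : ∃ M, ∀ k, ‖F k‖ ≤ M) : HasGaussIntegral F J := by
  obtain ⟨M, hM⟩ := hb
  have hderiv := hasDerivAt_integral_neg_self hF
  have hcont : Continuous (fun s => ∫ k in (-s)..s, F k) :=
    continuous_iff_continuousAt.2 fun s => (hderiv s).continuousAt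
  have hlim : Tendsto (fun s => ∫ k in (-s)..s, F k) atTop (𝓝 J) :=
    Tendsto.comp h (tendsto_neg_atTop_atBot.prodMk tendsto_id)
  obtain ⟨B, hB⟩ := exists_norm_le_of_tendsto_atTop hcont hlim
  refine (tendsto_integral_Ioi_two_mul_exp_neg_sq_mul hcont hlim hB).congr' ?_
  filter_upwards [self_mem_nhdsWithin] with ε hε
  have hint := integrable_gauss_mul hF hM hε
  have hfold : (fun k : ℝ => (Real.exp (-ε * k ^ 2) : ℂ) * (F k + F (-k)))
      = fun k => (Real.exp (-ε * k ^ 2) : ℂ) * F k + (Real.exp (-ε * (-k) ^ 2) : ℂ) * F (-k) := by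
    simp only [neg_sq, mul_add]
  rw [integral_eq_integral_Ioi_add_comp_neg hint, ← hfold,
    integral_Ioi_gauss_mul_by_parts hderiv (by simp) hB hε
      (hfold ▸ (hint.add hint.comp_neg).integrableOn),
    integral_Ioi_two_mul_exp_neg_mul_sq_mul _ hε]

end Abel

theorem norm_fourierIntegral_gaussian {ε : ℝ} (hε : 0 < ε) (x : ℝ) :
    ‖∫ k : ℝ, exp (I * x * k) * exp (-ε * k ^ 2)‖
      = Real.pi ^ (1 / 2 : ℝ) * (ε⁻¹ ^ (1 / 2 : ℝ) * Real.exp (-(x ^ 2 / 4) * ε⁻¹)) := by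
  have hnorm : ‖(Real.pi / ε : ℂ) ^ (1 / 2 : ℂ)‖ = Real.pi ^ (1 / 2 : ℝ) * ε⁻¹ ^ (1 / 2 : ℝ) := by
    rw [← Real.mul_rpow Real.pi_pos.le (by positivity), ← div_eq_mul_inv, ← ofReal_div,
      norm_cpow_eq_rpow_re_of_pos (by positivity)]
    norm_num
  have hexp : -(x : ℂ) ^ 2 / (4 * ε) = ((-(x ^ 2 / 4) * ε⁻¹ : ℝ) : ℂ) := by
    push_cast
    field_simp
  rw [fourierIntegral_gaussian (by simpa using hε), norm_mul, hnorm, hexp, norm_exp, ofReal_re,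
    mul_assoc]

theorem hasGaussIntegral_exp_mul_const (c : ℂ) {x : ℝ} (hx : x ≠ 0) :
    HasGaussIntegral (fun k : ℝ => exp (I * k * x) * c) 0 := by
  have hdecay := (tendsto_rpow_mul_exp_neg_mul_atTop_nhds_zero (1 / 2) (x ^ 2 / 4)
    (by positivity)).comp tendsto_inv_nhdsGT_zero
  have hbound := (hdecay.const_mul (Real.pi ^ (1 / 2 : ℝ))).mul_const ‖c‖
  rw [mul_zero, zero_mul] at hbound
  refine squeeze_zero_norm' ?_ hbound
  filter_upwards [self_mem_nhdsWithin] with ε hε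
  have hfactor (k : ℝ) : (Real.exp (-ε * k ^ 2) : ℂ) * (exp (I * k * x) * c)
      = exp (I * x * k) * exp (-ε * k ^ 2) * c := by
    push_cast
    rw [mul_right_comm I (x : ℂ) k]
    ring
  simp only [hfactor]
  rw [integral_mul_const, norm_mul, norm_fourierIntegral_gaussian hε]
  rfl

theorem exists_bound_of_tendsto_cobounded {F : ℝ → ℂ} (hF : Continuous F) {c : ℂ}
    (h : Tendsto F (Bornology.cobounded ℝ) (𝓝 c)) : ∃ M, ∀ k, ‖F k‖ ≤ M := by
  have hnear := h.norm.eventually (gt_mem_nhds (lt_add_one ‖c‖))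
  rw [← comap_norm_atTop, eventually_comap] at hnear
  obtain ⟨R, hR⟩ := eventually_atTop.1 hnear
  obtain ⟨B, hB⟩ := (isCompact_closedBall (0 : ℝ) R).exists_bound_of_continuousOn hF.continuousOn
  refine ⟨max B (‖c‖ + 1), fun k => ?_⟩
  rcases le_total ‖k‖ R with hk | hk
  · exact (hB k (by simpa using hk)).trans (le_max_left _ _)
  · exact (hR ‖k‖ hk k rfl).le.trans (le_max_right _ _)

theorem norm_exp_I_mul_ofReal (k x : ℝ) : ‖exp (I * k * x)‖ = 1 := by
  rw [norm_exp_I_mul, ofReal_im, mul_zero, Real.exp_zero]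

section ClosingGauss

variable {γ : ℝ → ℂ}

theorem deformsToRect_exp_mul_const (hγ : IsContourAroundI γ) (c : ℂ) (x : ℝ) :
    DeformsToRect γ (fun k => exp (I * k * x) * c) :=
  deformsToRect_of_differentiableOn hγ (by fun_prop) (by fun_prop)

theorem contourIntegral_exp_mul_sub_const (hγ : IsContourAroundI γ) {h : ℂ → ℂ}
    (hh : ContinuousOn h puncturedUpper) (c : ℂ) (x : ℝ) :
    contourIntegral γ (fun k => exp (I * k * x) * (h k - c))
      = contourIntegral γ (fun k => exp (I * k * x) * h k) := by
  have hexp : contourIntegral γ (fun k => exp (I * k * x) * c) = 0 :=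
    hγ.contourIntegral_eq_zero (by fun_prop)
  simp only [mul_sub]
  rw [hγ.contourIntegral_sub (F := fun k => exp (I * k * x) * h k)
    (G := fun k => exp (I * k * x) * c) (ContinuousOn.mul (by fun_prop) hh) (by fun_prop), hexp,
    sub_zero]

theorem hasGaussIntegral_of_tendsto (hγ : IsContourAroundI γ) {h : ℂ → ℂ} {x : ℝ}
    (hx : 0 < x) (hc : ContinuousOn h puncturedUpper)
    (hP : DeformsToRect γ (fun k => exp (I * k * x) * h k)) {c : ℂ}
    (hh : Tendsto h upperInfty (𝓝 c)) :
    HasGaussIntegral (fun k : ℝ => exp (I * k * x) * h k)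
      (contourIntegral γ (fun k => exp (I * k * x) * h k)) := by
  have hP' : DeformsToRect γ (fun k => exp (I * k * x) * (h k - c)) :=
    (hP.sub hγ (deformsToRect_exp_mul_const hγ c x)).congr hγ fun k _ => by ring
  have hh' : Tendsto (fun k => h k - c) upperInfty (𝓝 0) := by simpa using hh.sub_const c
  have hreal : Continuous (fun k : ℝ => h k - c) := by
    have := continuous_real hc
    simp only [ofReal_zero, zero_mul, add_zero] at this
    exact this.sub continuous_const
  obtain ⟨M, hM⟩ := exists_bound_of_tendsto_cobounded hreal (hh'.comp tendsto_ofReal_upperInfty)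
  have hFc : Continuous (fun k : ℝ => exp (I * k * x) * (h k - c)) := by fun_prop
  have hFb (k : ℝ) : ‖exp (I * k * x) * (h k - c)‖ ≤ M := by
    rw [norm_mul, norm_exp_I_mul_ofReal, one_mul]
    exact hM k
  have hcb (k : ℝ) : ‖exp (I * k * x) * c‖ ≤ ‖c‖ := by
    rw [norm_mul, norm_exp_I_mul_ofReal, one_mul]
  have hgauss :=
    ((hasImproperIntegral_of_tendsto_zero hx hP' hh').hasGaussIntegral hFc ⟨M, hFb⟩).add
      (hasGaussIntegral_exp_mul_const c hx.ne') (fun ε hε => integrable_gauss_mul hFc hFb hε)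
      fun ε hε => integrable_gauss_mul (by fun_prop) hcb hε
  rw [add_zero, contourIntegral_exp_mul_sub_const hγ hc] at hgauss
  simpa only [← mul_add, sub_add_cancel] using hgauss

end ClosingGauss

/-! ### Superpositions of plane waves -/

/-- The superposition `∫ e^{iκx} Φ(κ, t) dν` of plane waves with wave numbers `κ` and
time-dependent amplitude `Φ`, as a function of `p = (x, t)`. Both the integrals over the line and
the contour integrals of the solution have this form. -/
def superpose (ν : Measure ℝ) (κ : ℝ → ℂ) (Φ : ℝ → ℝ → ℂ) (p : ℝ × ℝ) : ℂ :=
  ∫ u, exp (I * κ u * p.1) * Φ u p.2 ∂ν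

/-- Amplitudes that are continuous in time and dominated, locally uniformly in time, by an
integrable function. -/
structure Dominated (ν : Measure ℝ) (Φ : ℝ → ℝ → ℂ) : Prop where
  aestronglyMeasurable : ∀ t, AEStronglyMeasurable (fun u => Φ u t) ν
  continuous : ∀ u, Continuous (Φ u)
  bound : ∀ T : ℝ, ∃ b : ℝ → ℝ, Integrable b ν ∧ ∀ u t, |t| ≤ T → ‖Φ u t‖ ≤ b u

/-- Amplitudes whose superposition may be differentiated `n` times under the integral sign: each
`x`-derivative multiplies the amplitude by `iκ`, each `t`-derivative differentiates it. -/
def SmoothAmplitude (ν : Measure ℝ) (κ : ℝ → ℂ) : ℕ → (ℝ → ℝ → ℂ) → Prop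
  | 0, Φ => Dominated ν Φ
  | n + 1, Φ => Dominated ν Φ ∧ SmoothAmplitude ν κ n (fun u t => I * κ u * Φ u t) ∧
      ∃ Φ' : ℝ → ℝ → ℂ, (∀ u t, HasDerivAt (Φ u) (Φ' u t) t) ∧ SmoothAmplitude ν κ n Φ'

/-- Admissible families of wave numbers: `±i` is avoided, and the imaginary part, `κ²/(1+κ²)` and
`κ/(1+κ²)` are bounded. -/
structure WaveNumbers (κ : ℝ → ℂ) : Prop where
  continuous : Continuous κ
  one_add_sq_ne_zero : ∀ u, 1 + κ u ^ 2 ≠ 0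
  bound_im : ∃ B, ∀ u, |(κ u).im| ≤ B
  bound_omegaSq : ∃ B, ∀ u, ‖omegaSq (κ u)‖ ≤ B
  bound_div : ∃ B, ∀ u, ‖κ u / (1 + κ u ^ 2)‖ ≤ B

/-- The real-linear map `(x, t) ↦ x z + t w` on the plane, depending linearly on `(z, w)`: the
differential with partial derivatives `z` and `w`. -/
def differentialOfPartials : ℂ × ℂ →L[ℝ] (ℝ × ℝ →L[ℝ] ℂ) :=
  (ContinuousLinearMap.smulRightL ℝ (ℝ × ℝ) ℂ (.fst ℝ ℝ ℝ)).comp (.fst ℝ ℂ ℂ)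
    + (ContinuousLinearMap.smulRightL ℝ (ℝ × ℝ) ℂ (.snd ℝ ℝ ℝ)).comp (.snd ℝ ℂ ℂ)

@[simp] theorem differentialOfPartials_apply (z : ℂ × ℂ) (p : ℝ × ℝ) :
    differentialOfPartials z p = p.1 * z.1 + p.2 * z.2 := by
  simp [differentialOfPartials]

theorem norm_differentialOfPartials_le (z : ℂ × ℂ) :
    ‖differentialOfPartials z‖ ≤ ‖z.1‖ + ‖z.2‖ := by
  refine ContinuousLinearMap.opNorm_le_bound _ (by positivity) fun p => ?_
  rw [differentialOfPartials_apply, add_mul, mul_comm ‖z.1‖, mul_comm ‖z.2‖]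
  refine (norm_add_le _ _).trans ?_
  rw [norm_mul, norm_mul, norm_real, norm_real]
  gcongr
  exacts [norm_fst_le p, norm_snd_le p]

theorem hasFDerivAt_planeWave {φ : ℝ → ℂ} {φ' : ℂ} (c : ℂ) {p : ℝ × ℝ}
    (hφ : HasDerivAt φ φ' p.2) :
    HasFDerivAt (fun q : ℝ × ℝ => exp (c * q.1) * φ q.2)
      (differentialOfPartials (exp (c * p.1) * (c * φ p.2), exp (c * p.1) * φ')) p := by
  have hexp : HasDerivAt (fun x : ℝ => exp (c * x)) (exp (c * p.1) * c) p.1 := by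
    simpa using ((hasDerivAt_id (p.1 : ℂ)).const_mul c).comp_ofReal.cexp
  convert! (hexp.hasFDerivAt.comp p (hasFDerivAt_fst (p := p))).mul
    (hφ.hasFDerivAt.comp p (hasFDerivAt_snd (p := p))) using 1
  ext
  · simp
    ring
  · simp

theorem abs_fst_le_of_mem_closedBall {p q : ℝ × ℝ} (hq : q ∈ Metric.closedBall p 1) :
    |q.1| ≤ |p.1| + 1 ∧ |q.2| ≤ |p.2| + 1 := by
  rw [mem_closedBall_iff_norm, Prod.norm_def, max_le_iff] at hq
  exact ⟨by linarith [abs_sub_abs_le_abs_sub q.1 p.1, show |q.1 - p.1| ≤ 1 from hq.1],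
    by linarith [abs_sub_abs_le_abs_sub q.2 p.2, show |q.2 - p.2| ≤ 1 from hq.2]⟩

theorem WaveNumbers.exists_norm_exp_le {κ : ℝ → ℂ} (hκ : WaveNumbers κ) (X : ℝ) :
    ∃ A, ∀ u x : ℝ, |x| ≤ X → ‖exp (I * κ u * x)‖ ≤ A := by
  obtain ⟨B, hB⟩ := hκ.bound_im
  refine ⟨Real.exp (X * B), fun u x hx => ?_⟩
  rw [norm_exp_I_mul, Real.exp_le_exp]
  calc -x * (κ u).im ≤ |-x * (κ u).im| := le_abs_self _
    _ = |x| * |(κ u).im| := by rw [abs_mul, abs_neg]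
    _ ≤ X * B := mul_le_mul hx (hB u) (abs_nonneg _) ((abs_nonneg x).trans hx)

section Superpose

variable {ν : Measure ℝ} {κ : ℝ → ℂ} {Φ Φ' Ψ : ℝ → ℝ → ℂ} {n : ℕ}

theorem Dominated.add (hΦ : Dominated ν Φ) (hΨ : Dominated ν Ψ) :
    Dominated ν (fun u t => Φ u t + Ψ u t) := by
  refine ⟨fun t => (hΦ.aestronglyMeasurable t).add (hΨ.aestronglyMeasurable t),
    fun u => (hΦ.continuous u).add (hΨ.continuous u), fun T => ?_⟩
  obtain ⟨b, hb, hΦb⟩ := hΦ.bound T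
  obtain ⟨c, hc, hΨc⟩ := hΨ.bound T
  exact ⟨fun u => b u + c u, hb.add hc,
    fun u t ht => (norm_add_le _ _).trans (add_le_add (hΦb u t ht) (hΨc u t ht))⟩

theorem SmoothAmplitude.dominated (h : SmoothAmplitude ν κ n Φ) : Dominated ν Φ := by
  cases n with
  | zero => exact h
  | succ n => exact h.1

theorem SmoothAmplitude.add (hΦ : SmoothAmplitude ν κ n Φ) (hΨ : SmoothAmplitude ν κ n Ψ) :
    SmoothAmplitude ν κ n (fun u t => Φ u t + Ψ u t) := by
  induction n generalizing Φ Ψ with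
  | zero => exact Dominated.add hΦ hΨ
  | succ n ih =>
    obtain ⟨hΦ₀, hΦx, Φ', hΦ', hΦt⟩ := hΦ
    obtain ⟨hΨ₀, hΨx, Ψ', hΨ', hΨt⟩ := hΨ
    refine ⟨hΦ₀.add hΨ₀, ?_, fun u t => Φ' u t + Ψ' u t, fun u t => (hΦ' u t).add (hΨ' u t),
      ih hΦt hΨt⟩
    simpa only [mul_add] using ih hΦx hΨx

theorem SmoothAmplitude.deriv (h : SmoothAmplitude ν κ (n + 1) Φ)
    (hΦ' : ∀ u t, HasDerivAt (Φ u) (Φ' u t) t) : SmoothAmplitude ν κ n Φ' := by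
  obtain ⟨-, -, Ψ, hΨ, hsmooth⟩ := h
  have hunique : Φ' = Ψ := by
    ext u t
    exact (hΦ' u t).unique (hΨ u t)
  rwa [hunique]

theorem Dominated.exists_bound (h : Dominated ν Φ) (hκ : WaveNumbers κ) (p : ℝ × ℝ) :
    ∃ b : ℝ → ℝ, Integrable b ν ∧ ∀ q ∈ Metric.closedBall p 1, ∀ u,
      ‖exp (I * κ u * q.1) * Φ u q.2‖ ≤ b u := by
  obtain ⟨A, hA⟩ := hκ.exists_norm_exp_le (|p.1| + 1)
  obtain ⟨b, hb, hΦb⟩ := h.bound (|p.2| + 1)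
  refine ⟨fun u => A * b u, hb.const_mul A, fun q hq u => ?_⟩
  obtain ⟨hx, ht⟩ := abs_fst_le_of_mem_closedBall hq
  rw [norm_mul]
  exact mul_le_mul (hA u q.1 hx) (hΦb u q.2 ht) (norm_nonneg _)
    ((norm_nonneg _).trans (hA u q.1 hx))

theorem Dominated.integrable (h : Dominated ν Φ) (hκ : WaveNumbers κ) (p : ℝ × ℝ) :
    Integrable (fun u => exp (I * κ u * p.1) * Φ u p.2) ν := by
  obtain ⟨b, hb, hΦb⟩ := h.exists_bound hκ p
  have hκc := hκ.continuous
  exact hb.mono' ((Continuous.aestronglyMeasurable (by fun_prop)).mul (h.aestronglyMeasurable _))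
    (ae_of_all _ (hΦb p (Metric.mem_closedBall_self zero_le_one)))

theorem Dominated.continuous_superpose (h : Dominated ν Φ) (hκ : WaveNumbers κ) :
    Continuous (superpose ν κ Φ) := by
  refine continuous_iff_continuousAt.2 fun p => ?_
  obtain ⟨b, hb, hΦb⟩ := h.exists_bound hκ p
  refine continuousAt_of_dominated (.of_forall fun q => (h.integrable hκ q).1) ?_ hb
    (ae_of_all _ fun u => ?_)
  · filter_upwards [Metric.closedBall_mem_nhds p one_pos] with q hq using ae_of_all _ (hΦb q hq)
  · have hΦ := h.continuous u
    fun_prop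

theorem hasFDerivAt_superpose (hκ : WaveNumbers κ) (h : Dominated ν Φ)
    (hx : Dominated ν (fun u t => I * κ u * Φ u t)) (hΦ' : ∀ u t, HasDerivAt (Φ u) (Φ' u t) t)
    (ht : Dominated ν Φ') (p : ℝ × ℝ) :
    HasFDerivAt (superpose ν κ Φ) (differentialOfPartials
      (superpose ν κ (fun u t => I * κ u * Φ u t) p, superpose ν κ Φ' p)) p := by
  obtain ⟨b, hb, hxb⟩ := hx.exists_bound hκ p
  obtain ⟨c, hc, htc⟩ := ht.exists_bound hκ p
  have hpartials := (hx.integrable hκ p).prodMk (ht.integrable hκ p)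
  have hderiv := hasFDerivAt_integral_of_dominated_of_fderiv_le (𝕜 := ℝ) (μ := ν)
    (F := fun (q : ℝ × ℝ) u => exp (I * κ u * q.1) * Φ u q.2)
    (F' := fun q u => differentialOfPartials
      (exp (I * κ u * q.1) * (I * κ u * Φ u q.2), exp (I * κ u * q.1) * Φ' u q.2))
    (bound := fun u => b u + c u) (Metric.closedBall_mem_nhds p one_pos)
    (.of_forall fun q => (h.integrable hκ q).1) (h.integrable hκ p)
    (differentialOfPartials.integrable_comp hpartials).1
    (ae_of_all _ fun u q hq => (norm_differentialOfPartials_le _).trans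
      (add_le_add (hxb q hq u) (htc q hq u)))
    (hb.add hc) (ae_of_all _ fun u q _ => hasFDerivAt_planeWave (I * κ u) (hΦ' u q.2))
  rwa [differentialOfPartials.integral_comp_comm hpartials,
    integral_pair (hx.integrable hκ p) (ht.integrable hκ p)] at hderiv

theorem SmoothAmplitude.contDiff (hκ : WaveNumbers κ) (h : SmoothAmplitude ν κ n Φ) :
    ContDiff ℝ n (superpose ν κ Φ) := by
  induction n generalizing Φ with
  | zero => exact contDiff_zero.2 (Dominated.continuous_superpose h hκ)
  | succ n ih =>
    obtain ⟨hΦ, hx, Φ', hΦ', ht⟩ := h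
    push_cast
    exact contDiff_succ_iff_hasFDerivAt.2
      ⟨_, differentialOfPartials.contDiff.comp ((ih hx).prodMk (ih ht)),
        hasFDerivAt_superpose hκ hΦ hx.dominated hΦ' ht.dominated⟩

theorem SmoothAmplitude.hasDerivAt_fst (hκ : WaveNumbers κ) (h : SmoothAmplitude ν κ (n + 1) Φ)
    (x t : ℝ) :
    HasDerivAt (fun y => superpose ν κ Φ (y, t))
      (superpose ν κ (fun u t => I * κ u * Φ u t) (x, t)) x := by
  obtain ⟨hΦ, hx, Φ', hΦ', ht⟩ := h
  have hcomp := (hasFDerivAt_superpose hκ hΦ hx.dominated hΦ' ht.dominated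
    (x, t)).comp_hasDerivAt x ((hasDerivAt_id x).prodMk (hasDerivAt_const x t))
  simpa [Function.comp_def] using hcomp

theorem SmoothAmplitude.hasDerivAt_snd (hκ : WaveNumbers κ) (h : SmoothAmplitude ν κ (n + 1) Φ)
    (hΦ' : ∀ u t, HasDerivAt (Φ u) (Φ' u t) t) (x t : ℝ) :
    HasDerivAt (fun s => superpose ν κ Φ (x, s)) (superpose ν κ Φ' (x, t)) t := by
  have hcomp := (hasFDerivAt_superpose hκ h.1 h.2.1.dominated hΦ' (h.deriv hΦ').dominated
    (x, t)).comp_hasDerivAt t ((hasDerivAt_const t x).prodMk (hasDerivAt_id t))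
  simpa [Function.comp_def] using hcomp

end Superpose

/-- Functions of `z` and `t` that are `n` times differentiable in `t` with jointly continuous
derivatives; the amplitudes of the solution are combinations of such functions at
`z = κ²/(1+κ²)`. -/
def TimeSmooth : ℕ → (ℂ → ℝ → ℂ) → Prop
  | 0, φ => Continuous (fun p : ℂ × ℝ => φ p.1 p.2)
  | n + 1, φ => Continuous (fun p : ℂ × ℝ => φ p.1 p.2) ∧
      ∃ φ' : ℂ → ℝ → ℂ, (∀ z t, HasDerivAt (φ z) (φ' z t) t) ∧ TimeSmooth n φ'

section TimeSmooth

variable {n : ℕ} {φ ψ : ℂ → ℝ → ℂ}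

theorem TimeSmooth.of_succ (h : TimeSmooth (n + 1) φ) : TimeSmooth n φ := by
  induction n generalizing φ with
  | zero => exact h.1
  | succ n ih =>
    obtain ⟨hφ, φ', hφ', h'⟩ := h
    exact ⟨hφ, φ', hφ', ih h'⟩

theorem TimeSmooth.add (hφ : TimeSmooth n φ) (hψ : TimeSmooth n ψ) :
    TimeSmooth n (fun z t => φ z t + ψ z t) := by
  induction n generalizing φ ψ with
  | zero => exact Continuous.add hφ hψ
  | succ n ih =>
    obtain ⟨hφ, φ', hφ', hφn⟩ := hφ
    obtain ⟨hψ, ψ', hψ', hψn⟩ := hψ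
    exact ⟨hφ.add hψ, fun z t => φ' z t + ψ' z t, fun z t => (hφ' z t).add (hψ' z t), ih hφn hψn⟩

theorem TimeSmooth.mul_left {a : ℂ → ℂ} (ha : Continuous a) (hφ : TimeSmooth n φ) :
    TimeSmooth n (fun z t => a z * φ z t) := by
  induction n generalizing φ with
  | zero => exact (ha.comp continuous_fst).mul hφ
  | succ n ih =>
    obtain ⟨hφ, φ', hφ', hφn⟩ := hφ
    exact ⟨(ha.comp continuous_fst).mul hφ, fun z t => a z * φ' z t,
      fun z t => (hφ' z t).const_mul (a z), ih hφn⟩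

end TimeSmooth

theorem timeSmooth_cosTime_sinTime (n : ℕ) : TimeSmooth n cosTime ∧ TimeSmooth n sinTime := by
  have hcos := continuous_cosTime (X := ℂ × ℝ) continuous_fst continuous_snd
  have hsin := continuous_sinTime (X := ℂ × ℝ) continuous_fst continuous_snd
  induction n with
  | zero => exact ⟨hcos, hsin⟩
  | succ n ih =>
    exact ⟨⟨hcos, fun z t => -z * sinTime z t, hasDerivAt_cosTime, ih.2.mul_left continuous_neg⟩,
      ⟨hsin, cosTime, hasDerivAt_sinTime, ih.1⟩⟩

theorem timeSmooth_schwartz (n : ℕ) (g : 𝓢(ℝ, ℂ)) : TimeSmooth n (fun _ t => g t) := by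
  induction n generalizing g with
  | zero => exact g.continuous.comp continuous_snd
  | succ n ih =>
    exact ⟨g.continuous.comp continuous_snd, fun _ t => SchwartzMap.derivCLM ℂ ℂ g t,
      fun _ t => g.differentiableAt.hasDerivAt, ih _⟩

theorem timeSmooth_cosConv_sinConv (n : ℕ) (g : 𝓢(ℝ, ℂ)) :
    TimeSmooth n (cosConv g) ∧ TimeSmooth n (sinConv g) := by
  have hcos := continuous_cosConv (X := ℂ × ℝ) g.continuous continuous_fst continuous_snd
  have hsin := continuous_sinConv (X := ℂ × ℝ) g.continuous continuous_fst continuous_snd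
  induction n with
  | zero => exact ⟨hcos, hsin⟩
  | succ n ih =>
    refine ⟨⟨hcos, fun z t => g t + -z * sinConv g z t, fun z t => ?_,
      (timeSmooth_schwartz n g).add (ih.2.mul_left continuous_neg)⟩,
      ⟨hsin, cosConv g, hasDerivAt_sinConv g.continuous, ih.1⟩⟩
    simp only [neg_mul, ← sub_eq_add_neg]
    exact hasDerivAt_cosConv g.continuous z t

/-- Weights `w` with `∫ (1 + |κ|)ⁿ |w| dν < ∞`. -/
def HasMoments (ν : Measure ℝ) (κ : ℝ → ℂ) (n : ℕ) (w : ℝ → ℂ) : Prop :=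
  AEStronglyMeasurable w ν ∧ Integrable (fun u => (1 + ‖κ u‖) ^ n * ‖w u‖) ν

section Moments

variable {ν : Measure ℝ} {κ v w : ℝ → ℂ} {m n : ℕ}

theorem HasMoments.of_le (hκ : WaveNumbers κ) (hw : HasMoments ν κ n w)
    (hv : AEStronglyMeasurable v ν) {B : ℝ}
    (h : ∀ u, (1 + ‖κ u‖) ^ m * ‖v u‖ ≤ B * ((1 + ‖κ u‖) ^ n * ‖w u‖)) : HasMoments ν κ m v := by
  have hκc := hκ.continuous
  refine ⟨hv, (hw.2.const_mul B).mono'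
    ((Continuous.aestronglyMeasurable (by fun_prop)).mul hv.norm) (ae_of_all _ fun u => ?_)⟩
  rw [Real.norm_of_nonneg (by positivity)]
  exact h u

theorem HasMoments.of_succ (hκ : WaveNumbers κ) (hw : HasMoments ν κ (n + 1) w) :
    HasMoments ν κ n w := by
  refine hw.of_le hκ hw.1 (B := 1) fun u => ?_
  rw [one_mul]
  gcongr
  · linarith [norm_nonneg (κ u)]
  · omega

theorem HasMoments.mul_bdd {a : ℝ → ℂ} (hκ : WaveNumbers κ) (hw : HasMoments ν κ n w)
    (ha : Continuous a) (hb : ∃ B, ∀ u, ‖a u‖ ≤ B) : HasMoments ν κ n (fun u => a u * w u) := by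
  obtain ⟨B, hB⟩ := hb
  refine hw.of_le hκ (ha.aestronglyMeasurable.mul hw.1) (B := B) fun u => ?_
  rw [norm_mul, mul_left_comm]
  gcongr
  exact hB u

theorem HasMoments.mul_waveNumber (hκ : WaveNumbers κ) (hw : HasMoments ν κ (n + 1) w) :
    HasMoments ν κ n (fun u => I * κ u * w u) := by
  have hκc := hκ.continuous
  refine hw.of_le hκ ((Continuous.aestronglyMeasurable (by fun_prop)).mul hw.1) (B := 1) fun u => ?_
  rw [norm_mul, norm_mul, norm_I, one_mul, one_mul, pow_succ, mul_assoc]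
  gcongr
  linarith

theorem HasMoments.const_mul (hκ : WaveNumbers κ) (hw : HasMoments ν κ n w) (c : ℂ) :
    HasMoments ν κ n (fun u => c * w u) :=
  hw.mul_bdd hκ continuous_const ⟨‖c‖, fun _ => le_rfl⟩

theorem WaveNumbers.continuous_omegaSq (hκ : WaveNumbers κ) :
    Continuous (fun u => omegaSq (κ u)) := by
  have hκc := hκ.continuous
  exact Continuous.div (by fun_prop) (by fun_prop) hκ.one_add_sq_ne_zero

theorem WaveNumbers.continuous_div (hκ : WaveNumbers κ) :
    Continuous (fun u => κ u / (1 + κ u ^ 2)) := by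
  have hκc := hκ.continuous
  exact Continuous.div (by fun_prop) (by fun_prop) hκ.one_add_sq_ne_zero

theorem HasMoments.dominated {φ : ℂ → ℝ → ℂ} (hκ : WaveNumbers κ) (hw : HasMoments ν κ n w)
    (hφ : Continuous (fun p : ℂ × ℝ => φ p.1 p.2)) :
    Dominated ν (fun u t => w u * φ (omegaSq (κ u)) t) := by
  refine ⟨fun t => hw.1.mul (Continuous.aestronglyMeasurable ?_), fun u => ?_, fun T => ?_⟩
  · exact hφ.comp (hκ.continuous_omegaSq.prodMk continuous_const)
  · exact continuous_const.mul (hφ.comp (continuous_const.prodMk continuous_id))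
  · obtain ⟨Z, hZ⟩ := hκ.bound_omegaSq
    obtain ⟨M, hM⟩ := ((isCompact_closedBall (0 : ℂ) Z).prod
      (isCompact_Icc (a := -T) (b := T))).exists_bound_of_continuousOn hφ.continuousOn
    refine ⟨fun u => |M| * ((1 + ‖κ u‖) ^ n * ‖w u‖), hw.2.const_mul _, fun u t ht => ?_⟩
    have hφM : ‖φ (omegaSq (κ u)) t‖ ≤ |M| :=
      (hM (omegaSq (κ u), t) ⟨by simpa using hZ u, abs_le.1 ht⟩).trans (le_abs_self _)
    have hone : 1 ≤ (1 + ‖κ u‖) ^ n := one_le_pow₀ (by linarith [norm_nonneg (κ u)])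
    rw [norm_mul, mul_comm ‖w u‖]
    exact mul_le_mul hφM (le_mul_of_one_le_left (norm_nonneg _) hone) (norm_nonneg _)
      (abs_nonneg _)

theorem HasMoments.smoothAmplitude {φ : ℂ → ℝ → ℂ} (hκ : WaveNumbers κ)
    (hw : HasMoments ν κ n w) (hφ : TimeSmooth n φ) :
    SmoothAmplitude ν κ n (fun u t => w u * φ (omegaSq (κ u)) t) := by
  induction n generalizing w φ with
  | zero => exact hw.dominated hκ hφ
  | succ n ih =>
    obtain ⟨hφc, φ', hφ', hφn⟩ := id hφ
    refine ⟨hw.dominated hκ hφc, ?_, fun u t => w u * φ' (omegaSq (κ u)) t,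
      fun u t => (hφ' _ t).const_mul _, ih (hw.of_succ hκ) hφn⟩
    simpa only [mul_assoc] using ih (hw.mul_waveNumber hκ) hφ.of_succ

end Moments

/-! ### The system for a single wave number -/

/-- The `r`-component of the solution of `r' = -ik q`, `q' = -ik/(1+k²) r` with initial values
`F(k)`, `G(k)`: the amplitude of `e^{ikx}` in the solution without boundary. -/
def evolveR (F G : ℂ → ℂ) (t : ℝ) (k : ℂ) : ℂ :=
  cosTime (omegaSq k) t * F k - I * k * sinTime (omegaSq k) t * G k

/-- The `q`-component of the solution of `r' = -ik q`, `q' = -ik/(1+k²) r` with initial values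
`F(k)`, `G(k)`. -/
def evolveQ (F G : ℂ → ℂ) (t : ℝ) (k : ℂ) : ℂ :=
  cosTime (omegaSq k) t * G k - I * (k / (1 + k ^ 2)) * sinTime (omegaSq k) t * F k

/-- The response to the boundary data `g` in the amplitude of `r`. -/
def forcingR (g : ℝ → ℂ) (t : ℝ) (k : ℂ) : ℂ :=
  2 * cosConv g (omegaSq k) t - 2 * omegaSq k * sinConv (deriv g) (omegaSq k) t

/-- The response to the boundary data `g` in the amplitude of `q`. -/
def forcingQ (g : ℝ → ℂ) (t : ℝ) (k : ℂ) : ℂ :=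
  -2 * I * (k / (1 + k ^ 2)) * (sinConv g (omegaSq k) t + cosConv (deriv g) (omegaSq k) t)

theorem omegaSq_eq_mul_div (k : ℂ) : omegaSq k = k * (k / (1 + k ^ 2)) := by
  rw [omegaSq]
  ring

theorem omegaSq_neg (k : ℂ) : omegaSq (-k) = omegaSq k := by
  rw [omegaSq, omegaSq, neg_sq]

section Evolution

variable (F G : ℂ → ℂ)

theorem evolveR_neg (t : ℝ) (k : ℂ) :
    evolveR F G t (-k) = evolveR (fun k => F (-k)) (fun k => -G (-k)) t k := by
  rw [evolveR, evolveR, omegaSq_neg]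
  ring

theorem evolveQ_neg (t : ℝ) (k : ℂ) :
    evolveQ F G t (-k) = evolveQ (fun k => -F (-k)) (fun k => G (-k)) t k := by
  rw [evolveQ, evolveQ, omegaSq_neg, neg_sq]
  ring

@[simp] theorem evolveR_zero (k : ℂ) : evolveR F G 0 k = F k := by simp [evolveR]

@[simp] theorem evolveQ_zero (k : ℂ) : evolveQ F G 0 k = G k := by simp [evolveQ]

theorem hasDerivAt_evolveR (k : ℂ) (t : ℝ) :
    HasDerivAt (fun t => evolveR F G t k) (-(I * k) * evolveQ F G t k) t := by
  convert! ((hasDerivAt_cosTime (omegaSq k) t).mul_const (F k)).sub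
    (((hasDerivAt_sinTime (omegaSq k) t).const_mul (I * k)).mul_const (G k)) using 1
  rw [evolveQ, omegaSq_eq_mul_div]
  linear_combination (k * (k / (1 + k ^ 2)) * sinTime (k * (k / (1 + k ^ 2))) t * F k) * I_sq

theorem hasDerivAt_evolveQ (k : ℂ) (t : ℝ) :
    HasDerivAt (fun t => evolveQ F G t k) (-I * (k / (1 + k ^ 2)) * evolveR F G t k) t := by
  convert! ((hasDerivAt_cosTime (omegaSq k) t).mul_const (G k)).sub
    (((hasDerivAt_sinTime (omegaSq k) t).const_mul (I * (k / (1 + k ^ 2)))).mul_const (F k)) using 1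
  rw [evolveR, omegaSq_eq_mul_div]
  linear_combination (k * (k / (1 + k ^ 2)) * sinTime (k * (k / (1 + k ^ 2))) t * G k) * I_sq

end Evolution

section Forcing

variable {g : ℝ → ℂ}

@[simp] theorem forcingR_zero (g : ℝ → ℂ) (k : ℂ) : forcingR g 0 k = 0 := by simp [forcingR]

@[simp] theorem forcingQ_zero (g : ℝ → ℂ) (k : ℂ) : forcingQ g 0 k = 0 := by simp [forcingQ]

theorem forcingQ_neg (g : ℝ → ℂ) (t : ℝ) (k : ℂ) : forcingQ g t (-k) = -forcingQ g t k := by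
  rw [forcingQ, forcingQ, omegaSq_neg, neg_sq]
  ring

theorem hasDerivAt_forcingR (hg : Continuous g) (hg' : Continuous (deriv g)) (k : ℂ) (t : ℝ) :
    HasDerivAt (fun t => forcingR g t k) (2 * g t - I * k * forcingQ g t k) t := by
  convert! ((hasDerivAt_cosConv hg (omegaSq k) t).const_mul 2).sub
    ((hasDerivAt_sinConv hg' (omegaSq k) t).const_mul (2 * omegaSq k)) using 1
  rw [forcingQ, omegaSq_eq_mul_div]
  linear_combination 2 * k * (k / (1 + k ^ 2)) * (sinConv g (k * (k / (1 + k ^ 2))) t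
    + cosConv (deriv g) (k * (k / (1 + k ^ 2))) t) * I_sq

theorem hasDerivAt_forcingQ (hg : Continuous g) (hg' : Continuous (deriv g)) (k : ℂ) (t : ℝ) :
    HasDerivAt (fun t => forcingQ g t k)
      (-I * (k / (1 + k ^ 2)) * (forcingR g t k + 2 * deriv g t)) t := by
  convert! ((hasDerivAt_sinConv hg (omegaSq k) t).add
    (hasDerivAt_cosConv hg' (omegaSq k) t)).const_mul (-2 * I * (k / (1 + k ^ 2))) using 1
  rw [forcingR]
  ring

end Forcing

theorem continuous_deriv_schwartz (g : 𝓢(ℝ, ℂ)) : Continuous (deriv g) :=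
  (SchwartzMap.derivCLM ℂ ℂ g).continuous

theorem lineIntegrandR_eq_evolveR (r₀ q₀ : ℝ → ℂ) (x t k : ℝ) :
    lineIntegrandR r₀ q₀ x t k
      = exp (I * k * x) * evolveR (halfLineFourier r₀) (halfLineFourier q₀) t k :=
  lineIntegrandR_eq r₀ q₀ x t k

theorem lineIntegrandQ_eq_evolveQ (r₀ q₀ : ℝ → ℂ) (x t k : ℝ) :
    lineIntegrandQ r₀ q₀ x t k
      = exp (I * k * x) * evolveQ (halfLineFourier r₀) (halfLineFourier q₀) t k :=
  lineIntegrandQ_eq r₀ q₀ x t k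

theorem contourIntegrandR₁_eq_evolveR (r₀ q₀ : ℝ → ℂ) (x t : ℝ) {k : ℂ} (hk : 1 + k ^ 2 ≠ 0) :
    contourIntegrandR₁ r₀ q₀ x t k
      = exp (I * k * x) * evolveR (halfLineFourier r₀) (halfLineFourier q₀) t (-k) := by
  rw [contourIntegrandR₁_eq r₀ q₀ x t hk, evolveR_neg, evolveR]
  ring

theorem contourIntegrandQ₁_eq_evolveQ (r₀ q₀ : ℝ → ℂ) (x t : ℝ) (k : ℂ) :
    contourIntegrandQ₁ r₀ q₀ x t k
      = exp (I * k * x) * evolveQ (halfLineFourier r₀) (halfLineFourier q₀) t (-k) := by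
  rw [contourIntegrandQ₁_eq, evolveQ_neg, evolveQ]
  ring

theorem contourIntegrandR₂_eq_forcingR (g₀ : 𝓢(ℝ, ℂ)) (x t : ℝ) (k : ℂ) :
    contourIntegrandR₂ g₀ x t k = exp (I * k * x) * forcingR g₀ t k :=
  contourIntegrandR₂_eq g₀.continuous (continuous_deriv_schwartz g₀) x t k

theorem contourIntegrandQ₂_eq_neg_forcingQ (g₀ : 𝓢(ℝ, ℂ)) (x t : ℝ) (k : ℂ) :
    contourIntegrandQ₂ g₀ x t k = -(exp (I * k * x) * forcingQ g₀ t k) := by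
  rw [contourIntegrandQ₂_eq g₀.continuous (continuous_deriv_schwartz g₀), forcingQ]
  ring

/-! ### Superpositions that solve the linear system -/

/-- `(r, q)` solves `r_t + q_x = 0`, `q_t + r_x - q_{xxt} = 0` on the whole plane, all derivatives
that occur being classical. -/
def SolvesSystem (r q : ℝ → ℝ → ℂ) : Prop :=
  ∃ rx rt qx qxx qt qxxt : ℝ → ℝ → ℂ,
    (∀ x t, HasDerivAt (fun y => r y t) (rx x t) x) ∧
    (∀ x t, HasDerivAt (fun s => r x s) (rt x t) t) ∧
    (∀ x t, HasDerivAt (fun y => q y t) (qx x t) x) ∧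
    (∀ x t, HasDerivAt (fun y => qx y t) (qxx x t) x) ∧
    (∀ x t, HasDerivAt (fun s => q x s) (qt x t) t) ∧
    (∀ x t, HasDerivAt (fun s => qxx x s) (qxxt x t) t) ∧
    (∀ x t, rt x t + qx x t = 0) ∧
    ∀ x t, qt x t + rx x t - qxxt x t = 0

section SolvesSystem

variable {r q r₁ q₁ : ℝ → ℝ → ℂ}

theorem SolvesSystem.add (h : SolvesSystem r q) (h₁ : SolvesSystem r₁ q₁) :
    SolvesSystem (fun x t => r x t + r₁ x t) (fun x t => q x t + q₁ x t) := by
  obtain ⟨rx, rt, qx, qxx, qt, qxxt, hrx, hrt, hqx, hqxx, hqt, hqxxt, heq₁, heq₂⟩ := h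
  obtain ⟨sx, st, px, pxx, pt, pxxt, hsx, hst, hpx, hpxx, hpt, hpxxt, heq₁', heq₂'⟩ := h₁
  refine ⟨_, _, _, _, _, _, fun x t => (hrx x t).add (hsx x t), fun x t => (hrt x t).add (hst x t),
    fun x t => (hqx x t).add (hpx x t), fun x t => (hqxx x t).add (hpxx x t),
    fun x t => (hqt x t).add (hpt x t), fun x t => (hqxxt x t).add (hpxxt x t),
    fun x t => ?_, fun x t => ?_⟩
  · linear_combination heq₁ x t + heq₁' x t
  · linear_combination heq₂ x t + heq₂' x t

theorem SolvesSystem.const_mul (h : SolvesSystem r q) (c : ℂ) :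
    SolvesSystem (fun x t => c * r x t) (fun x t => c * q x t) := by
  obtain ⟨rx, rt, qx, qxx, qt, qxxt, hrx, hrt, hqx, hqxx, hqt, hqxxt, heq₁, heq₂⟩ := h
  refine ⟨_, _, _, _, _, _, fun x t => (hrx x t).const_mul c, fun x t => (hrt x t).const_mul c,
    fun x t => (hqx x t).const_mul c, fun x t => (hqxx x t).const_mul c,
    fun x t => (hqt x t).const_mul c, fun x t => (hqxxt x t).const_mul c,
    fun x t => ?_, fun x t => ?_⟩
  · linear_combination c * heq₁ x t
  · linear_combination c * heq₂ x t

theorem SolvesSystem.first_equation (h : SolvesSystem r q) (x t : ℝ) :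
    deriv (fun s => r x s) t + deriv (fun y => q y t) x = 0 := by
  obtain ⟨_, _, _, _, _, _, -, hrt, hqx, -, -, -, heq₁, -⟩ := h
  rw [(hrt x t).deriv, (hqx x t).deriv, heq₁]

theorem SolvesSystem.second_equation (h : SolvesSystem r q) (x t : ℝ) :
    deriv (fun s => q x s) t + deriv (fun y => r y t) x
      - deriv (fun s => iteratedDeriv 2 (fun y => q y s) x) t = 0 := by
  obtain ⟨_, _, _, qxx, _, _, hrx, -, hqx, hqxx, hqt, hqxxt, -, heq₂⟩ := h
  have hiter : ∀ s, iteratedDeriv 2 (fun y => q y s) x = qxx x s := fun s => by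
    rw [iteratedDeriv_succ, iteratedDeriv_one, funext fun y => (hqx y s).deriv, (hqxx x s).deriv]
  rw [(hqt x t).deriv, (hrx x t).deriv, funext hiter, (hqxxt x t).deriv, heq₂]

end SolvesSystem

/-- A family of plane waves with parameters distributed by the measure `ν`: the wave numbers `κ`,
the initial amplitudes `a` of `r` and `b` of `q`, and the strength `d` with which the boundary data
act. -/
structure WaveFamily where
  ν : Measure ℝ
  κ : ℝ → ℂ
  a : ℝ → ℂ
  b : ℝ → ℂ
  d : ℝ → ℂ

namespace WaveFamily

/-- The amplitude of `r`. -/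
def amplitudeR (W : WaveFamily) (g : ℝ → ℂ) (u t : ℝ) : ℂ :=
  evolveR (fun _ => W.a u) (fun _ => W.b u) t (W.κ u) + W.d u * forcingR g t (W.κ u)

/-- The amplitude of `q`. -/
def amplitudeQ (W : WaveFamily) (g : ℝ → ℂ) (u t : ℝ) : ℂ :=
  evolveQ (fun _ => W.a u) (fun _ => W.b u) t (W.κ u) + W.d u * forcingQ g t (W.κ u)

/-- The time derivative of `amplitudeR`. -/
def amplitudeR' (W : WaveFamily) (g : ℝ → ℂ) (u t : ℝ) : ℂ :=
  -(I * W.κ u) * W.amplitudeQ g u t + 2 * g t * W.d u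

/-- The time derivative of `amplitudeQ`. -/
def amplitudeQ' (W : WaveFamily) (g : ℝ → ℂ) (u t : ℝ) : ℂ :=
  -I * (W.κ u / (1 + W.κ u ^ 2)) * (W.amplitudeR g u t + 2 * deriv g t * W.d u)

/-- The function `r` obtained by superposing the family. -/
def fieldR (W : WaveFamily) (g : ℝ → ℂ) (x t : ℝ) : ℂ :=
  superpose W.ν W.κ (W.amplitudeR g) (x, t)

/-- The function `q` obtained by superposing the family. -/
def fieldQ (W : WaveFamily) (g : ℝ → ℂ) (x t : ℝ) : ℂ :=
  superpose W.ν W.κ (W.amplitudeQ g) (x, t)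

/-- The amplitudes have enough moments for the superpositions to be `C³`. -/
structure Admissible (W : WaveFamily) : Prop where
  waveNumbers : WaveNumbers W.κ
  moments_a : HasMoments W.ν W.κ 3 W.a
  moments_b : HasMoments W.ν W.κ 4 W.b
  moments_d : HasMoments W.ν W.κ 3 W.d

variable {W : WaveFamily} {g : ℝ → ℂ}

theorem hasDerivAt_amplitudeR (W : WaveFamily) (hg : Continuous g) (hg' : Continuous (deriv g))
    (u t : ℝ) : HasDerivAt (W.amplitudeR g u) (W.amplitudeR' g u t) t := by
  convert! (hasDerivAt_evolveR (fun _ => W.a u) (fun _ => W.b u) (W.κ u) t).add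
    ((hasDerivAt_forcingR hg hg' (W.κ u) t).const_mul (W.d u)) using 1
  rw [amplitudeR', amplitudeQ]
  ring

theorem hasDerivAt_amplitudeQ (W : WaveFamily) (hg : Continuous g) (hg' : Continuous (deriv g))
    (u t : ℝ) : HasDerivAt (W.amplitudeQ g u) (W.amplitudeQ' g u t) t := by
  convert! (hasDerivAt_evolveQ (fun _ => W.a u) (fun _ => W.b u) (W.κ u) t).add
    ((hasDerivAt_forcingQ hg hg' (W.κ u) t).const_mul (W.d u)) using 1
  rw [amplitudeQ', amplitudeR]
  ring

theorem Admissible.smoothAmplitude_amplitudeR (h : W.Admissible) (g : 𝓢(ℝ, ℂ)) :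
    SmoothAmplitude W.ν W.κ 3 (W.amplitudeR g) := by
  have hκ := h.waveNumbers
  obtain ⟨hcos, hsin⟩ := timeSmooth_cosTime_sinTime 3
  have hforcing : TimeSmooth 3 fun z t => 2 * cosConv g z t + -2 * z * sinConv (deriv g) z t :=
    ((timeSmooth_cosConv_sinConv 3 g).1.mul_left continuous_const).add
      ((timeSmooth_cosConv_sinConv 3 (SchwartzMap.derivCLM ℂ ℂ g)).2.mul_left
        (a := fun z => -2 * z) (by fun_prop))
  convert ((h.moments_a.smoothAmplitude hκ hcos).add
    (((h.moments_b.mul_waveNumber hκ).const_mul hκ (-1)).smoothAmplitude hκ hsin)).add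
    (h.moments_d.smoothAmplitude hκ hforcing) using 3
  rw [amplitudeR, evolveR, forcingR]
  ring

theorem Admissible.smoothAmplitude_amplitudeQ (h : W.Admissible) (g : 𝓢(ℝ, ℂ)) :
    SmoothAmplitude W.ν W.κ 3 (W.amplitudeQ g) := by
  have hκ := h.waveNumbers
  obtain ⟨hcos, hsin⟩ := timeSmooth_cosTime_sinTime 3
  have hforcing : TimeSmooth 3 fun z t => sinConv g z t + cosConv (deriv g) z t :=
    (timeSmooth_cosConv_sinConv 3 g).2.add
      (timeSmooth_cosConv_sinConv 3 (SchwartzMap.derivCLM ℂ ℂ g)).1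
  have hdiv {w : ℝ → ℂ} (hw : HasMoments W.ν W.κ 3 w) (c : ℂ) :=
    (hw.mul_bdd hκ hκ.continuous_div hκ.bound_div).const_mul hκ c
  convert (((h.moments_b.of_succ hκ).smoothAmplitude hκ hcos).add
    ((hdiv h.moments_a (-I)).smoothAmplitude hκ hsin)).add
    ((hdiv h.moments_d (-2 * I)).smoothAmplitude hκ hforcing) using 3
  rw [amplitudeQ, evolveQ, forcingQ]
  ring

theorem Admissible.smoothAmplitude_amplitudeR' (h : W.Admissible) (g : 𝓢(ℝ, ℂ)) :
    SmoothAmplitude W.ν W.κ 2 (W.amplitudeR' g) :=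
  (h.smoothAmplitude_amplitudeR g).deriv
    (W.hasDerivAt_amplitudeR g.continuous (continuous_deriv_schwartz g))

theorem Admissible.smoothAmplitude_amplitudeQ' (h : W.Admissible) (g : 𝓢(ℝ, ℂ)) :
    SmoothAmplitude W.ν W.κ 2 (W.amplitudeQ' g) :=
  (h.smoothAmplitude_amplitudeQ g).deriv
    (W.hasDerivAt_amplitudeQ g.continuous (continuous_deriv_schwartz g))

theorem Admissible.contDiff_fieldR (h : W.Admissible) (g : 𝓢(ℝ, ℂ)) :
    ContDiff ℝ 3 (fun p : ℝ × ℝ => W.fieldR g p.1 p.2) :=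
  (h.smoothAmplitude_amplitudeR g).contDiff h.waveNumbers

theorem Admissible.contDiff_fieldQ (h : W.Admissible) (g : 𝓢(ℝ, ℂ)) :
    ContDiff ℝ 3 (fun p : ℝ × ℝ => W.fieldQ g p.1 p.2) :=
  (h.smoothAmplitude_amplitudeQ g).contDiff h.waveNumbers

theorem Admissible.superpose_first_equation (h : W.Admissible) (g : 𝓢(ℝ, ℂ)) (p : ℝ × ℝ) :
    superpose W.ν W.κ (W.amplitudeR' g) p
      + superpose W.ν W.κ (fun u t => I * W.κ u * W.amplitudeQ g u t) p
      = 2 * g p.2 * ∫ u, exp (I * W.κ u * p.1) * W.d u ∂W.ν := by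
  have hRt := (h.smoothAmplitude_amplitudeR' g).dominated.integrable h.waveNumbers p
  have hQx := (h.smoothAmplitude_amplitudeQ g).2.1.dominated.integrable h.waveNumbers p
  rw [superpose, superpose, ← integral_add hRt hQx, ← integral_const_mul]
  congr 1 with u
  rw [amplitudeR']
  ring

theorem Admissible.superpose_second_equation (h : W.Admissible) (g : 𝓢(ℝ, ℂ)) (p : ℝ × ℝ) :
    superpose W.ν W.κ (W.amplitudeQ' g) p
      + superpose W.ν W.κ (fun u t => I * W.κ u * W.amplitudeR g u t) p
      - superpose W.ν W.κ (fun u t => I * W.κ u * (I * W.κ u * W.amplitudeQ' g u t)) p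
      = -2 * deriv g p.2 * ∫ u, exp (I * W.κ u * p.1) * (I * W.κ u * W.d u) ∂W.ν := by
  have hκ := h.waveNumbers
  have hQ' := h.smoothAmplitude_amplitudeQ' g
  have hQt := hQ'.dominated.integrable hκ p
  have hRx := (h.smoothAmplitude_amplitudeR g).2.1.dominated.integrable hκ p
  have hQxxt := hQ'.2.1.2.1.dominated.integrable hκ p
  have hsum : Integrable (fun u => exp (I * W.κ u * p.1) * W.amplitudeQ' g u p.2
      + exp (I * W.κ u * p.1) * (I * W.κ u * W.amplitudeR g u p.2)) W.ν := hQt.add hRx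
  rw [superpose, superpose, superpose, ← integral_add hQt hRx, ← integral_sub hsum hQxxt,
    ← integral_const_mul]
  congr 1 with u
  have hdiv : (1 + W.κ u ^ 2) * (W.κ u / (1 + W.κ u ^ 2)) = W.κ u :=
    mul_div_cancel₀ _ (hκ.one_add_sq_ne_zero u)
  simp only [amplitudeQ']
  generalize W.κ u / (1 + W.κ u ^ 2) = c at hdiv ⊢
  linear_combination exp (I * W.κ u * p.1) * (-I * (W.amplitudeR g u p.2
      + 2 * deriv g p.2 * W.d u)) * (hdiv - W.κ u ^ 2 * c * I_sq)

theorem Admissible.solvesSystem (h : W.Admissible) (g : 𝓢(ℝ, ℂ))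
    (hd : ∀ x : ℝ, ∫ u, exp (I * W.κ u * x) * W.d u ∂W.ν = 0)
    (hκd : ∀ x : ℝ, ∫ u, exp (I * W.κ u * x) * (I * W.κ u * W.d u) ∂W.ν = 0) :
    SolvesSystem (W.fieldR g) (W.fieldQ g) := by
  have hκ := h.waveNumbers
  have hR := h.smoothAmplitude_amplitudeR g
  have hQ := h.smoothAmplitude_amplitudeQ g
  have hg := g.continuous
  have hg' := continuous_deriv_schwartz g
  refine ⟨_, _, _, _, _, _, hR.hasDerivAt_fst hκ,
    hR.hasDerivAt_snd hκ (W.hasDerivAt_amplitudeR hg hg'), hQ.hasDerivAt_fst hκ,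
    hQ.2.1.hasDerivAt_fst hκ, hQ.hasDerivAt_snd hκ (W.hasDerivAt_amplitudeQ hg hg'),
    hQ.2.1.2.1.hasDerivAt_snd hκ fun u t =>
      ((W.hasDerivAt_amplitudeQ hg hg' u t).const_mul _).const_mul _, fun x t => ?_, fun x t => ?_⟩
  · rw [h.superpose_first_equation, hd, mul_zero]
  · rw [h.superpose_second_equation, hκd, mul_zero]

end WaveFamily

/-! ### Amplitudes on the closed upper half-plane -/

section Evolution

variable (F G F₁ G₁ : ℂ → ℂ)

theorem evolveR_add (t : ℝ) (k : ℂ) : evolveR (fun k => F k + F₁ k) (fun k => G k + G₁ k) t k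
    = evolveR F G t k + evolveR F₁ G₁ t k := by
  simp only [evolveR]
  ring

theorem evolveQ_add (t : ℝ) (k : ℂ) : evolveQ (fun k => F k + F₁ k) (fun k => G k + G₁ k) t k
    = evolveQ F G t k + evolveQ F₁ G₁ t k := by
  simp only [evolveQ]
  ring

theorem evolveR_add_reflect (t : ℝ) (k : ℂ) :
    evolveR (fun k => F k + F₁ (-k)) (fun k => G k - G₁ (-k)) t k
      = evolveR F G t k + evolveR F₁ G₁ t (-k) := by
  rw [evolveR_neg, ← evolveR_add]
  simp only [sub_eq_add_neg]

theorem evolveQ_sub_reflect (t : ℝ) (k : ℂ) :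
    evolveQ (fun k => F k + F₁ (-k)) (fun k => G k - G₁ (-k)) t k
      = evolveQ F G t k - evolveQ F₁ G₁ t (-k) := by
  rw [evolveQ_neg]
  simp only [evolveQ]
  ring

end Evolution

theorem neg_im_nonpos {k : ℂ} (hk : k ∈ closedUpper) : (-k).im ≤ 0 := by
  rw [neg_im]
  exact neg_nonpos.2 hk

theorem neg_im_neg {k : ℂ} (hk : k ∈ upper) : (-k).im < 0 := by
  rw [neg_im]
  exact neg_neg_of_pos hk

section Reflection

variable {F : ℂ → ℂ}

theorem continuousOn_comp_neg (hF : ContinuousOn F {k | k.im ≤ 0}) :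
    ContinuousOn (fun k => F (-k)) closedUpper :=
  hF.comp continuousOn_neg fun _ => neg_im_nonpos

theorem differentiableOn_comp_neg (hF : DifferentiableOn ℂ F {k | k.im < 0}) :
    DifferentiableOn ℂ (fun k => F (-k)) upper :=
  hF.comp differentiable_neg.differentiableOn fun _ => neg_im_neg

end Reflection

theorem continuousOn_comp_omegaSq {E : ℂ → ℂ} (hE : Differentiable ℂ E) :
    ContinuousOn (fun k => E (omegaSq k)) puncturedUpper :=
  hE.continuous.comp_continuousOn continuousOn_omegaSq

theorem continuousOn_div_one_add_sq : ContinuousOn (fun k : ℂ => k / (1 + k ^ 2)) puncturedUpper :=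
  ContinuousOn.div (by fun_prop) (by fun_prop) fun _ => one_add_sq_ne_zero

section Continuity

variable {F G : ℂ → ℂ}

theorem continuousOn_evolveR (hF : ContinuousOn F puncturedUpper)
    (hG : ContinuousOn G puncturedUpper) (t : ℝ) : ContinuousOn (evolveR F G t) puncturedUpper := by
  have hcos := continuousOn_comp_omegaSq (differentiable_cosTime t)
  have hsin := continuousOn_comp_omegaSq (differentiable_sinTime t)
  unfold evolveR
  fun_prop

theorem continuousOn_evolveQ (hF : ContinuousOn F puncturedUpper)
    (hG : ContinuousOn G puncturedUpper) (t : ℝ) : ContinuousOn (evolveQ F G t) puncturedUpper := by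
  have hcos := continuousOn_comp_omegaSq (differentiable_cosTime t)
  have hsin := continuousOn_comp_omegaSq (differentiable_sinTime t)
  have hdiv := continuousOn_div_one_add_sq
  unfold evolveQ
  fun_prop

theorem continuousOn_forcingR (g : 𝓢(ℝ, ℂ)) (t : ℝ) :
    ContinuousOn (forcingR g t) puncturedUpper := by
  have hcos := continuousOn_comp_omegaSq (differentiable_cosConv g.continuous t)
  have hsin := continuousOn_comp_omegaSq (differentiable_sinConv (continuous_deriv_schwartz g) t)
  have hω := continuousOn_omegaSq
  unfold forcingR
  fun_prop

theorem continuousOn_forcingQ (g : 𝓢(ℝ, ℂ)) (t : ℝ) :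
    ContinuousOn (forcingQ g t) puncturedUpper := by
  have hsin := continuousOn_comp_omegaSq (differentiable_sinConv g.continuous t)
  have hcos := continuousOn_comp_omegaSq (differentiable_cosConv (continuous_deriv_schwartz g) t)
  have hdiv := continuousOn_div_one_add_sq
  unfold forcingQ
  fun_prop

end Continuity

section Deformation

variable {γ : ℝ → ℂ} {w E : ℂ → ℂ}

theorem deformsToRect_div_one_add_sq_mul (hγ : IsContourAroundI γ) (hE : Differentiable ℂ E)
    (hc : ContinuousOn w closedUpper) (hd : DifferentiableOn ℂ w upper) :
    DeformsToRect γ (fun k => k / (1 + k ^ 2) * w k * E (omegaSq k)) := by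
  refine (deformsToRect_div_pow_mul_entire hγ hE
    (continuousOn_div_add_I (continuousOn_id.mul hc))
    (differentiableOn_div_add_I (differentiableOn_id.mul hd)) 1).congr hγ fun k hk => ?_
  have hsub := sub_I_ne_zero hk
  have hadd := add_I_ne_zero hk.1
  simp only [one_add_sq_eq, pow_one, Pi.mul_apply, id_eq]
  field_simp

theorem deformsToRect_evolveQ {F G : ℂ → ℂ} (hγ : IsContourAroundI γ)
    (hFc : ContinuousOn F closedUpper) (hFd : DifferentiableOn ℂ F upper)
    (hGc : ContinuousOn G closedUpper) (hGd : DifferentiableOn ℂ G upper) (t : ℝ) :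
    DeformsToRect γ (evolveQ F G t) := by
  refine ((deformsToRect_div_pow_mul_entire hγ (differentiable_cosTime t) hGc hGd 0).sub hγ
    ((deformsToRect_div_one_add_sq_mul hγ (differentiable_sinTime t) hFc hFd).const_mul I)).congr
    hγ fun k _ => ?_
  simp only [evolveQ, pow_zero, div_one]
  ring

theorem deformsToRect_forcingQ (hγ : IsContourAroundI γ) (g : 𝓢(ℝ, ℂ)) (t : ℝ) :
    DeformsToRect γ (forcingQ g t) := by
  have hE : Differentiable ℂ fun z => sinConv g z t + cosConv (deriv g) z t :=
    (differentiable_sinConv g.continuous t).add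
      (differentiable_cosConv (continuous_deriv_schwartz g) t)
  refine ((deformsToRect_div_one_add_sq_mul hγ hE (w := fun _ => 1) continuousOn_const
    (differentiableOn_const 1)).const_mul (-2 * I)).congr hγ fun k _ => ?_
  rw [forcingQ]
  ring

theorem one_add_I_mul_eq (k : ℂ) : 1 + I * k = I * (k - I) := by
  linear_combination I_sq

theorem differentiableOn_jetFourier (f : 𝓢(ℝ, ℂ)) (n : ℕ) :
    DifferentiableOn ℂ (jetFourier f n) {I}ᶜ := by
  unfold jetFourier
  exact DifferentiableOn.fun_sum fun j _ => DifferentiableOn.div (by fun_prop) (by fun_prop)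
    fun k hk => pow_ne_zero _ (one_add_I_mul_ne_zero hk)

theorem continuousOn_jetFourier (f : 𝓢(ℝ, ℂ)) (n : ℕ) :
    ContinuousOn (jetFourier f n) puncturedUpper :=
  (differentiableOn_jetFourier f n).continuousOn.mono fun _ hk => hk.2

theorem deformsToRect_jetFourier (hγ : IsContourAroundI γ) (f : 𝓢(ℝ, ℂ)) (n m : ℕ)
    (hE : Differentiable ℂ E) (hc : ContinuousOn w closedUpper) (hd : DifferentiableOn ℂ w upper) :
    DeformsToRect γ (fun k => w k / (k - I) ^ m * jetFourier f n k * E (omegaSq k)) := by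
  induction n with
  | zero =>
    simpa [jetFourier] using
      deformsToRect_of_differentiableOn hγ continuousOn_const (differentiableOn_const 0)
  | succ n ih =>
    have hlast := (deformsToRect_div_pow_mul_entire hγ hE hc hd (m + (n + 1))).const_mul
      ((oneAddDeriv^[n] f) 0 / I ^ (n + 1))
    refine (ih.add hγ hlast).congr hγ fun k hk => ?_
    have hsub := sub_I_ne_zero hk
    have hI := I_ne_zero
    simp only [jetFourier, Finset.sum_range_succ, one_add_I_mul_eq, mul_pow, pow_add, pow_one]
    field_simp

theorem deformsToRect_mul_evolveR_jetFourier (hγ : IsContourAroundI γ) (r₀ q₀ : 𝓢(ℝ, ℂ)) (n : ℕ)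
    (hw : Differentiable ℂ w) (t : ℝ) :
    DeformsToRect γ (fun k => w k * evolveR (jetFourier r₀ n) (jetFourier q₀ n) t k) := by
  have hcos := deformsToRect_jetFourier hγ r₀ n 0 (differentiable_cosTime t)
    hw.continuous.continuousOn hw.differentiableOn
  have hw' : Differentiable ℂ fun k => w k * (I * k) := by fun_prop
  have hsin := deformsToRect_jetFourier hγ q₀ n 0 (differentiable_sinTime t)
    hw'.continuous.continuousOn hw'.differentiableOn
  refine (hcos.sub hγ hsin).congr hγ fun k _ => ?_
  simp only [evolveR, pow_zero, div_one]
  ring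

theorem deformsToRect_mul_evolveQ_jetFourier (hγ : IsContourAroundI γ) (r₀ q₀ : 𝓢(ℝ, ℂ)) (n : ℕ)
    (hw : Differentiable ℂ w) (t : ℝ) :
    DeformsToRect γ (fun k => w k * evolveQ (jetFourier r₀ n) (jetFourier q₀ n) t k) := by
  have hcos := deformsToRect_jetFourier hγ q₀ n 0 (differentiable_cosTime t)
    hw.continuous.continuousOn hw.differentiableOn
  have hw' : Differentiable ℂ fun k => w k * (I * k) := by fun_prop
  have hsin := deformsToRect_jetFourier hγ r₀ n 1 (differentiable_sinTime t)
    (continuousOn_div_add_I hw'.continuous.continuousOn)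
    (differentiableOn_div_add_I hw'.differentiableOn)
  refine (hcos.sub hγ hsin).congr hγ fun k hk => ?_
  have hsub := sub_I_ne_zero hk
  have hadd := add_I_ne_zero hk.1
  simp only [evolveQ, pow_zero, div_one, one_add_sq_eq, pow_one]
  field_simp

end Deformation

/-! ### Behaviour at infinity -/

section Infinity

open Bornology

variable {F G : ℂ → ℂ} {l : Filter ℂ} {a b : ℂ}

theorem tendsto_zero_of_mul_tendsto (hl : l ≤ cobounded ℂ)
    (hF : Tendsto (fun k => k * F k) l (𝓝 a)) : Tendsto F l (𝓝 0) := by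
  have h := (tendsto_inv₀_cobounded.mono_left hl).mul hF
  rw [zero_mul] at h
  refine h.congr' ?_
  filter_upwards [hl (eventually_ne_cobounded 0)] with k hk
  rw [inv_mul_cancel_left₀ hk]

theorem tendsto_omegaSq : Tendsto omegaSq (cobounded ℂ) (𝓝 1) :=
  tendsto_mul_div_one_add_sq.congr fun k => (omegaSq_eq_mul_div k).symm

theorem tendsto_cosTime_omegaSq (hl : l ≤ cobounded ℂ) (t : ℝ) :
    Tendsto (fun k => cosTime (omegaSq k) t) l (𝓝 (Real.cos t)) := by
  rw [← cosTime_one]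
  exact ((differentiable_cosTime t).continuous.tendsto 1).comp (tendsto_omegaSq.mono_left hl)

theorem tendsto_sinTime_omegaSq (hl : l ≤ cobounded ℂ) (t : ℝ) :
    Tendsto (fun k => sinTime (omegaSq k) t) l (𝓝 (Real.sin t)) := by
  rw [← sinTime_one]
  exact ((differentiable_sinTime t).continuous.tendsto 1).comp (tendsto_omegaSq.mono_left hl)

theorem tendsto_evolveR (hl : l ≤ cobounded ℂ) (hF : Tendsto F l (𝓝 a))
    (hG : Tendsto (fun k => k * G k) l (𝓝 b)) (t : ℝ) :
    Tendsto (evolveR F G t) l (𝓝 (Real.cos t * a - I * Real.sin t * b)) := by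
  refine (((tendsto_cosTime_omegaSq hl t).mul hF).sub
    (((tendsto_sinTime_omegaSq hl t).const_mul I).mul hG)).congr fun k => ?_
  rw [evolveR]
  ring

theorem tendsto_mul_evolveQ (hl : l ≤ cobounded ℂ) (hF : Tendsto F l (𝓝 a))
    (hG : Tendsto (fun k => k * G k) l (𝓝 b)) (t : ℝ) :
    Tendsto (fun k => k * evolveQ F G t k) l (𝓝 (Real.cos t * b - I * Real.sin t * a)) := by
  have h := ((tendsto_cosTime_omegaSq hl t).mul hG).sub
    ((((tendsto_mul_div_one_add_sq.mono_left hl).const_mul I).mul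
      (tendsto_sinTime_omegaSq hl t)).mul hF)
  rw [mul_one] at h
  refine h.congr fun k => ?_
  rw [evolveQ]
  ring

theorem tendsto_mul_forcingQ (g : 𝓢(ℝ, ℂ)) (t : ℝ) :
    Tendsto (fun k => k * forcingQ g t k) (cobounded ℂ)
      (𝓝 (-2 * I * (g t - Real.cos t * g 0))) := by
  have hE : Continuous fun z => sinConv g z t + cosConv (deriv g) z t :=
    (differentiable_sinConv g.continuous t).continuous.add
      (differentiable_cosConv (continuous_deriv_schwartz g) t).continuous
  have hval : sinConv g 1 t + cosConv (deriv g) 1 t = g t - Real.cos t * g 0 := by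
    rw [cosConv_deriv (fun s => g.differentiableAt.hasDerivAt) (continuous_deriv_schwartz g),
      cosTime_one]
    ring
  have h := (tendsto_mul_div_one_add_sq.const_mul (-2 * I)).mul
    ((hE.tendsto 1).comp tendsto_omegaSq)
  rw [hval, mul_one] at h
  refine h.congr fun k => ?_
  simp only [forcingQ, Function.comp_apply]
  ring

theorem tendsto_one_add_I_mul_inv : Tendsto (fun k : ℂ => (1 + I * k)⁻¹) (cobounded ℂ) (𝓝 0) := by
  refine tendsto_inv₀_cobounded.comp ?_
  rw [← tendsto_norm_atTop_iff_cobounded]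
  refine tendsto_atTop_mono (f := fun k : ℂ => ‖k‖ - 1) (fun k => ?_)
    (tendsto_atTop_add_const_right _ _ tendsto_norm_cobounded_atTop)
  have hsub := norm_sub_le (1 + I * k) 1
  rw [add_sub_cancel_left, norm_mul, norm_I, one_mul, norm_one] at hsub
  linarith

theorem tendsto_mul_one_add_I_mul_inv :
    Tendsto (fun k : ℂ => k * (1 + I * k)⁻¹) (cobounded ℂ) (𝓝 (-I)) := by
  have h : Tendsto (fun k : ℂ => -I + I * (1 + I * k)⁻¹) (cobounded ℂ) (𝓝 (-I + I * 0)) :=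
    (tendsto_one_add_I_mul_inv.const_mul I).const_add _
  rw [mul_zero, add_zero] at h
  refine h.congr' ?_
  filter_upwards [eventually_ne_cobounded I] with k hk
  have hne := one_add_I_mul_ne_zero hk
  field_simp
  linear_combination (-k) * I_sq

theorem tendsto_mul_jetFourier (f : 𝓢(ℝ, ℂ)) (n : ℕ) :
    Tendsto (fun k => k * jetFourier f (n + 1) k) (cobounded ℂ) (𝓝 (-I * f 0)) := by
  have hterm (j : ℕ) : Tendsto (fun k : ℂ => (oneAddDeriv^[j] f) 0 *
      ((k * (1 + I * k)⁻¹) * (1 + I * k)⁻¹ ^ j)) (cobounded ℂ)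
      (𝓝 ((oneAddDeriv^[j] f) 0 * (-I * 0 ^ j))) :=
    (tendsto_mul_one_add_I_mul_inv.mul (tendsto_one_add_I_mul_inv.pow j)).const_mul _
  have hsum := tendsto_finsetSum (Finset.range (n + 1)) fun j _ => hterm j
  rw [Finset.sum_range_succ', Finset.sum_eq_zero (fun j _ => by simp), zero_add] at hsum
  simp only [Function.iterate_zero, id_eq, pow_zero, mul_one] at hsum
  rw [mul_comm (f 0)] at hsum
  refine hsum.congr fun k => ?_
  rw [jetFourier, Finset.mul_sum]
  refine Finset.sum_congr rfl fun j _ => ?_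
  rw [inv_pow, div_eq_mul_inv, pow_succ, mul_inv]
  ring

theorem upperInfty_le_cobounded : upperInfty ≤ cobounded ℂ := inf_le_left

theorem tendsto_mul_tailFourier_neg (f : 𝓢(ℝ, ℂ)) (n : ℕ) :
    Tendsto (fun k => k * tailFourier f (n + 2) (-k)) upperInfty (𝓝 0) := by
  obtain ⟨M, _, hM⟩ := exists_norm_tailFourier_le f (n + 2)
  have hneg : Tendsto (fun k : ℂ => -k) upperInfty (cobounded ℂ) :=
    (tendsto_neg_cobounded (E := ℂ)).mono_left upperInfty_le_cobounded
  have hbound : Tendsto (fun k : ℂ => M * (‖-k * (1 + I * -k)⁻¹‖ * ‖(1 + I * -k)⁻¹‖ ^ (n + 1)))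
      upperInfty (𝓝 (M * (‖-I‖ * ‖(0 : ℂ)‖ ^ (n + 1)))) :=
    ((tendsto_mul_one_add_I_mul_inv.comp hneg).norm.mul
      ((tendsto_one_add_I_mul_inv.comp hneg).norm.pow (n + 1))).const_mul M
  rw [norm_zero, zero_pow (by lia), mul_zero, mul_zero] at hbound
  refine squeeze_zero_norm' ?_ hbound
  filter_upwards [mem_inf_of_right (mem_principal_self closedUpper)] with k hk
  have htail := hM (-k) (neg_im_nonpos hk)
  rw [norm_mul, norm_mul, norm_neg]
  calc ‖k‖ * ‖tailFourier f (n + 2) (-k)‖ ≤ ‖k‖ * (M / ‖1 + I * -k‖ ^ (n + 2)) := by gcongr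
    _ = M * (‖k‖ * ‖(1 + I * -k)⁻¹‖ * ‖(1 + I * -k)⁻¹‖ ^ (n + 1)) := by
      rw [norm_inv, pow_succ _ (n + 1), inv_pow]
      field_simp

end Infinity

/-! ### Plane waves with real wave numbers -/

theorem waveNumbers_ofReal : WaveNumbers (fun k : ℝ => (k : ℂ)) := by
  have hnorm (k : ℝ) : ‖(1 : ℂ) + (k : ℂ) ^ 2‖ = 1 + k ^ 2 := by
    rw [show (1 : ℂ) + (k : ℂ) ^ 2 = ((1 + k ^ 2 : ℝ) : ℂ) by push_cast; ring, norm_real,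
      Real.norm_of_nonneg (by positivity)]
  refine ⟨continuous_ofReal, fun k => ?_, ⟨0, by simp⟩, ⟨1, fun k => ?_⟩, ⟨1, fun k => ?_⟩⟩
  · rw [← norm_pos_iff, hnorm]
    positivity
  · rw [omegaSq, norm_div, hnorm, norm_pow, norm_real, Real.norm_eq_abs, sq_abs,
      div_le_one (by positivity)]
    linarith
  · rw [norm_div, hnorm, norm_real, Real.norm_eq_abs, div_le_one (by positivity)]
    nlinarith [sq_abs k, sq_nonneg (|k| - 1), abs_nonneg k]

theorem norm_one_add_I_mul_ofReal_sq (k : ℝ) : ‖1 + I * (k : ℂ)‖ ^ 2 = 1 + k ^ 2 := by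
  rw [← normSq_eq_norm_sq, mul_comm, ← ofReal_one, normSq_add_mul_I, one_pow]

theorem hasMoments_tailFourier (f : 𝓢(ℝ, ℂ)) (n : ℕ) :
    HasMoments volume (fun k : ℝ => (k : ℂ)) n (fun k : ℝ => tailFourier f (n + 2) k) := by
  obtain ⟨M, _, hM⟩ := exists_norm_tailFourier_le f (n + 2)
  have hc : Continuous (fun k : ℝ => tailFourier f (n + 2) k) :=
    (continuousOn_tailFourier f (n + 2)).comp_continuous continuous_ofReal fun _ => by simp
  refine ⟨hc.aestronglyMeasurable, (integrable_inv_one_add_sq.const_mul (2 ^ n * M)).mono'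
    (Continuous.aestronglyMeasurable (by fun_prop)) (ae_of_all _ fun k => ?_)⟩
  have hsq := norm_one_add_I_mul_ofReal_sq k
  set s := ‖1 + I * (k : ℂ)‖
  have hs : 0 ≤ s := norm_nonneg _
  have hs1 : 1 ≤ s := by nlinarith [sq_nonneg k]
  have hks : 1 + |k| ≤ 2 * s := by
    have : |k| ≤ s := abs_le_of_sq_le_sq (by rw [hsq]; linarith) hs
    linarith
  have htail := hM k (by simp)
  rw [Real.norm_of_nonneg (by positivity), norm_real, Real.norm_eq_abs]
  calc (1 + |k|) ^ n * ‖tailFourier f (n + 2) k‖ ≤ (2 * s) ^ n * (M / s ^ (n + 2)) := by gcongr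
    _ = 2 ^ n * M * (s ^ 2)⁻¹ := by
      rw [mul_pow, pow_add]
      field_simp
    _ = 2 ^ n * M * (1 + k ^ 2)⁻¹ := by rw [hsq]

theorem HasMoments.zero (ν : Measure ℝ) (κ : ℝ → ℂ) (n : ℕ) : HasMoments ν κ n (fun _ => 0) :=
  ⟨aestronglyMeasurable_const, by simp⟩

/-- The family of plane waves `e^{ikx}`, `k` real, with initial amplitudes `A` and `B`; the boundary
data do not act on it. -/
def lineFamily (A B : ℂ → ℂ) : WaveFamily := ⟨volume, (↑), fun k => A k, fun k => B k, fun _ => 0⟩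

section LineFamily

variable (A B : ℂ → ℂ) (g : ℝ → ℂ)

theorem fieldR_lineFamily (x t : ℝ) :
    (lineFamily A B).fieldR g x t = ∫ k : ℝ, exp (I * k * x) * evolveR A B t k := by
  simp [WaveFamily.fieldR, superpose, WaveFamily.amplitudeR, lineFamily, evolveR]

theorem fieldQ_lineFamily (x t : ℝ) :
    (lineFamily A B).fieldQ g x t = ∫ k : ℝ, exp (I * k * x) * evolveQ A B t k := by
  simp [WaveFamily.fieldQ, superpose, WaveFamily.amplitudeQ, lineFamily, evolveQ]

variable {A B}

theorem integrable_exp_mul_evolveR (h : (lineFamily A B).Admissible) (x t : ℝ) :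
    Integrable (fun k : ℝ => exp (I * k * x) * evolveR A B t k) := by
  simpa [WaveFamily.amplitudeR, lineFamily, evolveR] using
    (h.smoothAmplitude_amplitudeR 0).dominated.integrable h.waveNumbers (x, t)

theorem integrable_exp_mul_evolveQ (h : (lineFamily A B).Admissible) (x t : ℝ) :
    Integrable (fun k : ℝ => exp (I * k * x) * evolveQ A B t k) := by
  simpa [WaveFamily.amplitudeQ, lineFamily, evolveQ] using
    (h.smoothAmplitude_amplitudeQ 0).dominated.integrable h.waveNumbers (x, t)

theorem solvesSystem_lineFamily (h : (lineFamily A B).Admissible) (g : 𝓢(ℝ, ℂ)) :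
    SolvesSystem ((lineFamily A B).fieldR g) ((lineFamily A B).fieldQ g) :=
  h.solvesSystem g (fun x => by simp [lineFamily]) fun x => by simp [lineFamily]

end LineFamily

/-! ### Plane waves with wave numbers on the contour -/

/-- The extension of a function on `[0, 1]` to the real line by constants. -/
def extend (w : ℝ → ℂ) : ℝ → ℂ := IccExtend (zero_le_one (α := ℝ)) ((Icc 0 1).domRestrict w)

section Extend

variable {w : ℝ → ℂ}

theorem continuous_extend (hw : ContinuousOn w (Icc 0 1)) : Continuous (extend w) :=
  (continuousOn_iff_continuous_domRestrict.1 hw).Icc_extend'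

theorem extend_of_mem (w : ℝ → ℂ) {u : ℝ} (hu : u ∈ Icc (0 : ℝ) 1) : extend w u = w u :=
  IccExtend_of_mem _ _ hu

theorem exists_extend_eq (w : ℝ → ℂ) (u : ℝ) : ∃ v ∈ Icc (0 : ℝ) 1, extend w u = w v :=
  ⟨projIcc 0 1 zero_le_one u, Subtype.coe_prop _, rfl⟩

end Extend

section ContourFamily

variable {γ : ℝ → ℂ}

theorem IsContourAroundI.extend_mem (hγ : IsContourAroundI γ) (u : ℝ) :
    extend γ u ∈ puncturedUpper := by
  obtain ⟨v, hv, h⟩ := exists_extend_eq γ u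
  exact h ▸ hγ.mem_puncturedUpper hv

theorem IsContourAroundI.exists_bound (hγ : IsContourAroundI γ) {F : ℂ → ℂ}
    (hF : ContinuousOn F puncturedUpper) : ∃ M, ∀ u, ‖F (extend γ u)‖ ≤ M := by
  obtain ⟨M, hM⟩ := isCompact_Icc.exists_bound_of_continuousOn (hγ.comp_continuousOn hF)
  refine ⟨M, fun u => ?_⟩
  obtain ⟨v, hv, h⟩ := exists_extend_eq γ u
  exact h ▸ hM v hv

theorem IsContourAroundI.waveNumbers (hγ : IsContourAroundI γ) : WaveNumbers (extend γ) := by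
  obtain ⟨M, hM⟩ := hγ.exists_bound continuousOn_id
  exact ⟨continuous_extend hγ.contDiffOn.continuousOn,
    fun u => one_add_sq_ne_zero (hγ.extend_mem u),
    ⟨M, fun u => (abs_im_le_norm _).trans (hM u)⟩, hγ.exists_bound continuousOn_omegaSq,
    hγ.exists_bound continuousOn_div_one_add_sq⟩

theorem IsContourAroundI.hasMoments (hγ : IsContourAroundI γ) {w : ℝ → ℂ} (hw : Continuous w)
    (n : ℕ) : HasMoments (volume.restrict (Ioc 0 1)) (extend γ) n w := by
  have hκ := hγ.waveNumbers.continuous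
  exact ⟨hw.aestronglyMeasurable, Continuous.integrableOn_Ioc (by fun_prop)⟩

/-- The speed of the contour. -/
def contourSpeed (γ : ℝ → ℂ) : ℝ → ℂ := extend (derivWithin γ (Icc 0 1))

/-- The family of plane waves `e^{ikx}`, `k` on the contour, with initial amplitudes `A` and `B`;
the boundary data act on it with strength `1`. -/
def contourFamily (γ : ℝ → ℂ) (A B : ℂ → ℂ) : WaveFamily :=
  ⟨volume.restrict (Ioc 0 1), extend γ, fun u => A (extend γ u) * contourSpeed γ u,
    fun u => B (extend γ u) * contourSpeed γ u, contourSpeed γ⟩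

theorem integral_Ioc_eq_contourIntegral {φ : ℝ → ℂ} {F : ℂ → ℂ}
    (h : ∀ u, φ u = F (extend γ u) * contourSpeed γ u) :
    ∫ u in Ioc (0 : ℝ) 1, φ u = contourIntegral γ F := by
  rw [contourIntegral, intervalIntegral.integral_of_le zero_le_one]
  refine setIntegral_congr_fun measurableSet_Ioc fun u hu => ?_
  have hu' := Ioc_subset_Icc_self hu
  simp only [h, contourSpeed, extend_of_mem _ hu']

variable {A B : ℂ → ℂ}

theorem IsContourAroundI.admissible_contourFamily (hγ : IsContourAroundI γ)
    (hA : ContinuousOn A puncturedUpper) (hB : ContinuousOn B puncturedUpper) :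
    (contourFamily γ A B).Admissible := by
  have hspeed : Continuous (contourSpeed γ) := continuous_extend hγ.continuousOn_derivWithin
  have hκ := hγ.waveNumbers.continuous
  exact ⟨hγ.waveNumbers, hγ.hasMoments ((hA.comp_continuous hκ hγ.extend_mem).mul hspeed) 3,
    hγ.hasMoments ((hB.comp_continuous hκ hγ.extend_mem).mul hspeed) 4, hγ.hasMoments hspeed 3⟩

theorem fieldR_contourFamily (γ : ℝ → ℂ) (A B : ℂ → ℂ) (g : ℝ → ℂ) (x t : ℝ) :
    (contourFamily γ A B).fieldR g x t
      = contourIntegral γ (fun k => exp (I * k * x) * (evolveR A B t k + forcingR g t k)) :=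
  integral_Ioc_eq_contourIntegral fun u => by
    simp only [WaveFamily.amplitudeR, contourFamily, evolveR]
    ring

theorem fieldQ_contourFamily (γ : ℝ → ℂ) (A B : ℂ → ℂ) (g : ℝ → ℂ) (x t : ℝ) :
    (contourFamily γ A B).fieldQ g x t
      = contourIntegral γ (fun k => exp (I * k * x) * (evolveQ A B t k + forcingQ g t k)) :=
  integral_Ioc_eq_contourIntegral fun u => by
    simp only [WaveFamily.amplitudeQ, contourFamily, evolveQ]
    ring

theorem IsContourAroundI.solvesSystem_contourFamily (hγ : IsContourAroundI γ)
    (hA : ContinuousOn A puncturedUpper) (hB : ContinuousOn B puncturedUpper) (g : 𝓢(ℝ, ℂ)) :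
    SolvesSystem ((contourFamily γ A B).fieldR g) ((contourFamily γ A B).fieldQ g) := by
  refine (hγ.admissible_contourFamily hA hB).solvesSystem g (fun x => ?_) fun x => ?_
  · refine (integral_Ioc_eq_contourIntegral (F := fun k => exp (I * k * x)) fun u => rfl).trans ?_
    exact hγ.contourIntegral_eq_zero (by fun_prop)
  · refine (integral_Ioc_eq_contourIntegral (F := fun k => exp (I * k * x) * (I * k))
      fun u => ?_).trans (hγ.contourIntegral_eq_zero (by fun_prop))
    simp only [contourFamily]
    ring

end ContourFamily

/-! ### The solution -/

section Definitions

variable (r₀ q₀ g₀ : 𝓢(ℝ, ℂ)) (γ : ℝ → ℂ)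

/-- The amplitude of `r` for the boundary jets of the initial data. Jets of order six leave tails of
size `|k|⁻⁶`, which have the four moments needed for `q` to be `C³`. -/
def jetR : ℝ → ℂ → ℂ := evolveR (jetFourier r₀ 6) (jetFourier q₀ 6)

/-- The amplitude of `q` for the boundary jets of the initial data. -/
def jetQ : ℝ → ℂ → ℂ := evolveQ (jetFourier r₀ 6) (jetFourier q₀ 6)

/-- The amplitude of `r` for the tails of the initial data. -/
def tailR : ℝ → ℂ → ℂ := evolveR (tailFourier r₀ 6) (tailFourier q₀ 6)

/-- The amplitude of `q` for the tails of the initial data. -/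
def tailQ : ℝ → ℂ → ℂ := evolveQ (tailFourier r₀ 6) (tailFourier q₀ 6)

/-- The waves that make up the part of the integral over `ℝ` which converges absolutely. -/
def tailWaves : WaveFamily := lineFamily (tailFourier r₀ 6) (tailFourier q₀ 6)

/-- The waves that make up the contour integrals together with the jet part of the integral
over `ℝ`, which is moved to the contour. -/
def contourWaves : WaveFamily := contourFamily γ
  (fun k => jetFourier r₀ 6 k + halfLineFourier r₀ (-k))
  (fun k => jetFourier q₀ 6 k - halfLineFourier q₀ (-k))

/-- The function `r` of the theorem, for all real `x` and `t`. -/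
def solR (x t : ℝ) : ℂ :=
  1 / (2 * Real.pi) * ((tailWaves r₀ q₀).fieldR g₀ x t + (contourWaves r₀ q₀ γ).fieldR g₀ x t)

/-- The function `q` of the theorem, for all real `x` and `t`. -/
def solQ (x t : ℝ) : ℂ :=
  1 / (2 * Real.pi) * ((tailWaves r₀ q₀).fieldQ g₀ x t + (contourWaves r₀ q₀ γ).fieldQ g₀ x t)

end Definitions

variable {r₀ q₀ g₀ : 𝓢(ℝ, ℂ)} {γ : ℝ → ℂ}

theorem evolveR_halfLineFourier (r₀ q₀ : 𝓢(ℝ, ℂ)) (t : ℝ) {k : ℂ} (hk : k.im ≤ 0) :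
    evolveR (halfLineFourier r₀) (halfLineFourier q₀) t k
      = tailR r₀ q₀ t k + jetR r₀ q₀ t k := by
  rw [tailR, jetR, ← evolveR_add]
  simp only [evolveR, halfLineFourier_eq_jet_add_tail _ 6 hk, add_comm]

theorem evolveQ_halfLineFourier (r₀ q₀ : 𝓢(ℝ, ℂ)) (t : ℝ) {k : ℂ} (hk : k.im ≤ 0) :
    evolveQ (halfLineFourier r₀) (halfLineFourier q₀) t k
      = tailQ r₀ q₀ t k + jetQ r₀ q₀ t k := by
  rw [tailQ, jetQ, ← evolveQ_add]
  simp only [evolveQ, halfLineFourier_eq_jet_add_tail _ 6 hk, add_comm]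

theorem continuousOn_halfLineFourier_neg (f : 𝓢(ℝ, ℂ)) :
    ContinuousOn (fun k => halfLineFourier f (-k)) puncturedUpper :=
  (continuousOn_comp_neg (continuousOn_halfLineFourier f.integrable.integrableOn)).mono
    sdiff_subset

theorem admissible_tailWaves (r₀ q₀ : 𝓢(ℝ, ℂ)) : (tailWaves r₀ q₀).Admissible :=
  ⟨waveNumbers_ofReal, (hasMoments_tailFourier r₀ 4).of_succ waveNumbers_ofReal,
    hasMoments_tailFourier q₀ 4, HasMoments.zero _ _ _⟩

theorem admissible_contourWaves (r₀ q₀ : 𝓢(ℝ, ℂ)) (hγ : IsContourAroundI γ) :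
    (contourWaves r₀ q₀ γ).Admissible :=
  hγ.admissible_contourFamily
    ((continuousOn_jetFourier r₀ 6).add (continuousOn_halfLineFourier_neg r₀))
    ((continuousOn_jetFourier q₀ 6).sub (continuousOn_halfLineFourier_neg q₀))

theorem contDiff_solR (hγ : IsContourAroundI γ) :
    ContDiff ℝ 3 (fun p : ℝ × ℝ => solR r₀ q₀ g₀ γ p.1 p.2) :=
  contDiff_const.mul (((admissible_tailWaves r₀ q₀).contDiff_fieldR g₀).add
    ((admissible_contourWaves r₀ q₀ hγ).contDiff_fieldR g₀))

theorem contDiff_solQ (hγ : IsContourAroundI γ) :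
    ContDiff ℝ 3 (fun p : ℝ × ℝ => solQ r₀ q₀ g₀ γ p.1 p.2) :=
  contDiff_const.mul (((admissible_tailWaves r₀ q₀).contDiff_fieldQ g₀).add
    ((admissible_contourWaves r₀ q₀ hγ).contDiff_fieldQ g₀))

theorem solvesSystem_sol (hγ : IsContourAroundI γ) :
    SolvesSystem (solR r₀ q₀ g₀ γ) (solQ r₀ q₀ g₀ γ) :=
  ((solvesSystem_lineFamily (admissible_tailWaves r₀ q₀) g₀).add
    (hγ.solvesSystem_contourFamily
      ((continuousOn_jetFourier r₀ 6).add (continuousOn_halfLineFourier_neg r₀))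
      ((continuousOn_jetFourier q₀ 6).sub (continuousOn_halfLineFourier_neg q₀)) g₀)).const_mul _

/-! ### The solution formulas -/

section Formula

theorem continuousOn_jetR (t : ℝ) : ContinuousOn (jetR r₀ q₀ t) puncturedUpper :=
  continuousOn_evolveR (continuousOn_jetFourier r₀ 6) (continuousOn_jetFourier q₀ 6) t

theorem deformsToRect_exp_mul_jetR (hγ : IsContourAroundI γ) (x t : ℝ) :
    DeformsToRect γ (fun k => exp (I * k * x) * jetR r₀ q₀ t k) :=
  deformsToRect_mul_evolveR_jetFourier hγ r₀ q₀ 6 (by fun_prop) t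

theorem deformsToRect_exp_mul_jetQ (hγ : IsContourAroundI γ) (x t : ℝ) :
    DeformsToRect γ (fun k => exp (I * k * x) * jetQ r₀ q₀ t k) :=
  deformsToRect_mul_evolveQ_jetFourier hγ r₀ q₀ 6 (by fun_prop) t

theorem tendsto_jetFourier (f : 𝓢(ℝ, ℂ)) (n : ℕ) :
    Tendsto (jetFourier f (n + 1)) (Bornology.cobounded ℂ) (𝓝 0) :=
  tendsto_zero_of_mul_tendsto le_rfl (tendsto_mul_jetFourier f n)

theorem tendsto_jetR (r₀ q₀ : 𝓢(ℝ, ℂ)) (t : ℝ) :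
    Tendsto (jetR r₀ q₀ t) (Bornology.cobounded ℂ) (𝓝 (-(q₀ 0 * Real.sin t))) := by
  convert! tendsto_evolveR le_rfl (tendsto_jetFourier r₀ 5) (tendsto_mul_jetFourier q₀ 5) t using 2
  linear_combination -(q₀ 0 * Real.sin t) * I_sq

theorem tendsto_mul_jetQ (r₀ q₀ : 𝓢(ℝ, ℂ)) (t : ℝ) :
    Tendsto (fun k => k * jetQ r₀ q₀ t k) (Bornology.cobounded ℂ) (𝓝 (-I * Real.cos t * q₀ 0)) := by
  convert! tendsto_mul_evolveQ le_rfl (tendsto_jetFourier r₀ 5) (tendsto_mul_jetFourier q₀ 5) t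
    using 2
  ring

theorem lineIntegrandR_eq_tail_add_jet (r₀ q₀ : 𝓢(ℝ, ℂ)) (x t : ℝ) :
    lineIntegrandR r₀ q₀ x t
      = fun k : ℝ => exp (I * k * x) * tailR r₀ q₀ t k + exp (I * k * x) * jetR r₀ q₀ t k := by
  ext k
  rw [lineIntegrandR_eq_evolveR, evolveR_halfLineFourier _ _ _ (by simp), mul_add]

theorem lineIntegrandQ_eq_tail_add_jet (r₀ q₀ : 𝓢(ℝ, ℂ)) (x t : ℝ) :
    lineIntegrandQ r₀ q₀ x t
      = fun k : ℝ => exp (I * k * x) * tailQ r₀ q₀ t k + exp (I * k * x) * jetQ r₀ q₀ t k := by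
  ext k
  rw [lineIntegrandQ_eq_evolveQ, evolveQ_halfLineFourier _ _ _ (by simp), mul_add]

theorem HasImproperIntegral.add {F G : ℝ → ℂ} {J K : ℂ} (hF : HasImproperIntegral F J)
    (hG : HasImproperIntegral G K) (hFi : ∀ a b, IntervalIntegrable F volume a b)
    (hGi : ∀ a b, IntervalIntegrable G volume a b) :
    HasImproperIntegral (fun k => F k + G k) (J + K) :=
  (Tendsto.add hF hG).congr fun _ =>
    (intervalIntegral.integral_add (hFi _ _) (hGi _ _)).symm

theorem hasGaussIntegral_lineIntegrandR (g : ℝ → ℂ) (hγ : IsContourAroundI γ) {x : ℝ} (hx : 0 < x)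
    (t : ℝ) :
    HasGaussIntegral (lineIntegrandR r₀ q₀ x t) ((tailWaves r₀ q₀).fieldR g x t
      + contourIntegral γ (fun k => exp (I * k * x) * jetR r₀ q₀ t k)) := by
  have htail := integrable_exp_mul_evolveR (admissible_tailWaves r₀ q₀) x t
  have hlim := (tendsto_jetR r₀ q₀ t).mono_left upperInfty_le_cobounded
  have hjet : Continuous fun k : ℝ => jetR r₀ q₀ t k := by
    simpa using continuous_real (continuousOn_jetR t)
  obtain ⟨M, hM⟩ := exists_bound_of_tendsto_cobounded hjet
    (hlim.comp tendsto_ofReal_upperInfty)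
  rw [lineIntegrandR_eq_tail_add_jet, tailWaves, fieldR_lineFamily]
  refine (hasGaussIntegral_of_integrable htail).add
    (hasGaussIntegral_of_tendsto hγ hx (continuousOn_jetR t) (deformsToRect_exp_mul_jetR hγ x t)
      hlim) (fun ε hε => integrable_gauss_mul_of_integrable htail hε)
    fun ε hε => integrable_gauss_mul (by fun_prop) (M := M) (fun k => ?_) hε
  rw [norm_mul, norm_exp_I_mul_ofReal, one_mul]
  exact hM k

theorem hasImproperIntegral_lineIntegrandR (g : ℝ → ℂ) (hγ : IsContourAroundI γ) {x : ℝ}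
    (hx : 0 < x) {t : ℝ} (ht : q₀ 0 * (Real.sin t : ℂ) = 0) :
    HasImproperIntegral (lineIntegrandR r₀ q₀ x t) ((tailWaves r₀ q₀).fieldR g x t
      + contourIntegral γ (fun k => exp (I * k * x) * jetR r₀ q₀ t k)) := by
  have htail := integrable_exp_mul_evolveR (admissible_tailWaves r₀ q₀) x t
  have hjet := deformsToRect_exp_mul_jetR (r₀ := r₀) (q₀ := q₀) hγ x t
  have hlim : Tendsto (jetR r₀ q₀ t) upperInfty (𝓝 0) := by
    simpa only [ht, neg_zero] using (tendsto_jetR r₀ q₀ t).mono_left upperInfty_le_cobounded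
  have hcont : Continuous fun k : ℝ => exp (I * k * x) * jetR r₀ q₀ t k := by
    simpa using continuous_real hjet.continuousOn
  rw [lineIntegrandR_eq_tail_add_jet, tailWaves, fieldR_lineFamily]
  exact (hasImproperIntegral_of_integrable htail).add
    (hasImproperIntegral_of_tendsto_zero hx hjet hlim) (fun _ _ => htail.intervalIntegrable)
    hcont.intervalIntegrable

theorem hasImproperIntegral_lineIntegrandQ (g : ℝ → ℂ) (hγ : IsContourAroundI γ) {x : ℝ}
    (hx : 0 < x) (t : ℝ) :
    HasImproperIntegral (lineIntegrandQ r₀ q₀ x t) ((tailWaves r₀ q₀).fieldQ g x t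
      + contourIntegral γ (fun k => exp (I * k * x) * jetQ r₀ q₀ t k)) := by
  have htail := integrable_exp_mul_evolveQ (admissible_tailWaves r₀ q₀) x t
  have hjet := deformsToRect_exp_mul_jetQ (r₀ := r₀) (q₀ := q₀) hγ x t
  have hlim : Tendsto (jetQ r₀ q₀ t) upperInfty (𝓝 0) :=
    (tendsto_zero_of_mul_tendsto le_rfl (tendsto_mul_jetQ r₀ q₀ t)).mono_left
      upperInfty_le_cobounded
  have hcont : Continuous fun k : ℝ => exp (I * k * x) * jetQ r₀ q₀ t k := by
    simpa using continuous_real hjet.continuousOn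
  rw [lineIntegrandQ_eq_tail_add_jet, tailWaves, fieldQ_lineFamily]
  exact (hasImproperIntegral_of_integrable htail).add
    (hasImproperIntegral_of_tendsto_zero hx hjet hlim) (fun _ _ => htail.intervalIntegrable)
    hcont.intervalIntegrable

theorem continuousOn_contourIntegrandR₁ (r₀ q₀ : 𝓢(ℝ, ℂ)) (x t : ℝ) :
    ContinuousOn (contourIntegrandR₁ r₀ q₀ x t) puncturedUpper := by
  have h : ContinuousOn (fun k => evolveR (halfLineFourier r₀) (halfLineFourier q₀) t (-k))
      puncturedUpper := by
    simp only [evolveR_neg]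
    exact continuousOn_evolveR (continuousOn_halfLineFourier_neg r₀)
      (continuousOn_halfLineFourier_neg q₀).fun_neg t
  exact ContinuousOn.congr (by fun_prop) fun k hk =>
    contourIntegrandR₁_eq_evolveR _ _ _ _ (one_add_sq_ne_zero hk)

theorem continuousOn_contourIntegrandQ₁ (r₀ q₀ : 𝓢(ℝ, ℂ)) (x t : ℝ) :
    ContinuousOn (contourIntegrandQ₁ r₀ q₀ x t) puncturedUpper := by
  have h : ContinuousOn (fun k => evolveQ (halfLineFourier r₀) (halfLineFourier q₀) t (-k))
      puncturedUpper := by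
    simp only [evolveQ_neg]
    exact continuousOn_evolveQ (continuousOn_halfLineFourier_neg r₀).fun_neg
      (continuousOn_halfLineFourier_neg q₀) t
  rw [funext (contourIntegrandQ₁_eq_evolveQ r₀ q₀ x t)]
  fun_prop

theorem continuousOn_contourIntegrandR₂ (g₀ : 𝓢(ℝ, ℂ)) (x t : ℝ) :
    ContinuousOn (contourIntegrandR₂ g₀ x t) puncturedUpper := by
  have h := continuousOn_forcingR g₀ t
  rw [funext (contourIntegrandR₂_eq_forcingR g₀ x t)]
  fun_prop

theorem continuousOn_contourIntegrandQ₂ (g₀ : 𝓢(ℝ, ℂ)) (x t : ℝ) :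
    ContinuousOn (contourIntegrandQ₂ g₀ x t) puncturedUpper := by
  have h := continuousOn_forcingQ g₀ t
  rw [funext (contourIntegrandQ₂_eq_neg_forcingQ g₀ x t)]
  fun_prop

theorem fieldR_contourWaves (hγ : IsContourAroundI γ) (x t : ℝ) :
    (contourWaves r₀ q₀ γ).fieldR g₀ x t
      = contourIntegral γ (fun k => exp (I * k * x) * jetR r₀ q₀ t k)
        + contourIntegral γ (contourIntegrandR₁ r₀ q₀ x t)
        + contourIntegral γ (contourIntegrandR₂ g₀ x t) := by
  have hjet := (deformsToRect_exp_mul_jetR (r₀ := r₀) (q₀ := q₀) hγ x t).continuousOn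
  have hR₁ := continuousOn_contourIntegrandR₁ r₀ q₀ x t
  rw [← hγ.contourIntegral_add hjet hR₁,
    ← hγ.contourIntegral_add (hjet.fun_add hR₁) (continuousOn_contourIntegrandR₂ g₀ x t),
    contourWaves, fieldR_contourFamily]
  refine contourIntegral_congr fun u hu => ?_
  rw [contourIntegrandR₁_eq_evolveR _ _ _ _ (one_add_sq_ne_zero (hγ.mem_puncturedUpper hu)),
    contourIntegrandR₂_eq_forcingR, evolveR_add_reflect, jetR]
  ring

theorem fieldQ_contourWaves (hγ : IsContourAroundI γ) (x t : ℝ) :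
    (contourWaves r₀ q₀ γ).fieldQ g₀ x t
      = contourIntegral γ (fun k => exp (I * k * x) * jetQ r₀ q₀ t k)
        - contourIntegral γ (contourIntegrandQ₁ r₀ q₀ x t)
        - contourIntegral γ (contourIntegrandQ₂ g₀ x t) := by
  have hjet := (deformsToRect_exp_mul_jetQ (r₀ := r₀) (q₀ := q₀) hγ x t).continuousOn
  have hQ₁ := continuousOn_contourIntegrandQ₁ r₀ q₀ x t
  rw [← hγ.contourIntegral_sub hjet hQ₁,
    ← hγ.contourIntegral_sub (hjet.fun_sub hQ₁) (continuousOn_contourIntegrandQ₂ g₀ x t),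
    contourWaves, fieldQ_contourFamily]
  refine contourIntegral_congr fun u _ => ?_
  rw [contourIntegrandQ₁_eq_evolveQ, contourIntegrandQ₂_eq_neg_forcingQ, evolveQ_sub_reflect, jetQ]
  ring

theorem isFormulaValueR_solR (hγ : IsContourAroundI γ) {x : ℝ} (hx : 0 < x) (t : ℝ) :
    IsFormulaValueR r₀ q₀ g₀ γ x t (solR r₀ q₀ g₀ γ x t) := by
  refine ⟨_, hasGaussIntegral_lineIntegrandR g₀ hγ hx t,
    hasImproperIntegral_lineIntegrandR g₀ hγ hx, ?_⟩
  rw [solR, fieldR_contourWaves hγ]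
  ring

theorem isFormulaValueQ_solQ (hγ : IsContourAroundI γ) {x : ℝ} (hx : 0 < x) (t : ℝ) :
    IsFormulaValueQ r₀ q₀ g₀ γ x t (solQ r₀ q₀ g₀ γ x t) := by
  refine ⟨_, hasImproperIntegral_lineIntegrandQ g₀ hγ hx t, ?_⟩
  rw [solQ, fieldQ_contourWaves hγ]
  ring

end Formula

/-! ### Initial values -/

theorem contourIntegral_exp_mul_halfLineFourier_neg (hγ : IsContourAroundI γ) (f : 𝓢(ℝ, ℂ))
    (x : ℝ) : contourIntegral γ (fun k => exp (I * k * x) * halfLineFourier f (-k)) = 0 := by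
  have h := differentiableOn_comp_neg
    (differentiableOn_halfLineFourier f.integrable.integrableOn (integrableOn_mul_schwartz f))
  exact hγ.contourIntegral_eq_zero (by fun_prop)

theorem hasGaussIntegral_halfLineFourier_schwartz (f : 𝓢(ℝ, ℂ)) {x : ℝ} (hx : 0 < x) :
    HasGaussIntegral (fun k : ℝ => exp (I * k * x) * halfLineFourier f k) (2 * Real.pi * f x) :=
  hasGaussIntegral_halfLineFourier f.integrable.integrableOn hx f.continuous.continuousAt

theorem contourIntegral_zero (γ : ℝ → ℂ) : contourIntegral γ (fun _ => 0) = 0 := by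
  simp [contourIntegral]

theorem IsFormulaValueR.eq_initial (hγ : IsContourAroundI γ) {x : ℝ} (hx : 0 < x) {v : ℂ}
    (h : IsFormulaValueR r₀ q₀ g₀ γ x 0 v) : v = r₀ x := by
  obtain ⟨J, hJ, -, rfl⟩ := h
  have hJ_eq : J = 2 * Real.pi * r₀ x := by
    refine tendsto_nhds_unique hJ ?_
    simpa only [HasGaussIntegral, lineIntegrandR_eq_evolveR, evolveR_zero]
      using hasGaussIntegral_halfLineFourier_schwartz r₀ hx
  have hR₁ : contourIntegral γ (contourIntegrandR₁ r₀ q₀ x 0) = 0 := by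
    rw [← contourIntegral_exp_mul_halfLineFourier_neg hγ r₀ x]
    refine contourIntegral_congr fun u hu => ?_
    rw [contourIntegrandR₁_eq_evolveR _ _ _ _ (one_add_sq_ne_zero (hγ.mem_puncturedUpper hu)),
      evolveR_zero]
  have hR₂ : contourIntegral γ (contourIntegrandR₂ g₀ x 0) = 0 := by
    rw [← contourIntegral_zero γ]
    refine contourIntegral_congr fun u _ => ?_
    rw [contourIntegrandR₂_eq_forcingR, forcingR_zero, mul_zero]
  rw [hJ_eq, hR₁, hR₂]
  field_simp
  ring

theorem IsFormulaValueQ.eq_initial (hγ : IsContourAroundI γ) {x : ℝ} (hx : 0 < x) {v : ℂ}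
    (h : IsFormulaValueQ r₀ q₀ g₀ γ x 0 v) : v = q₀ x := by
  obtain ⟨J, hJ, rfl⟩ := h
  have hJ_eq : J = 2 * Real.pi * q₀ x := by
    have hcont : Continuous fun k : ℝ => halfLineFourier q₀ k :=
      (continuousOn_halfLineFourier q₀.integrable.integrableOn).comp_continuous continuous_ofReal
        fun _ => by simp
    have hline : lineIntegrandQ r₀ q₀ x 0 = fun k : ℝ => exp (I * k * x) * halfLineFourier q₀ k :=
      by simp only [funext (lineIntegrandQ_eq_evolveQ _ _ _ _), evolveQ_zero]
    rw [hline] at hJ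
    refine tendsto_nhds_unique (hJ.hasGaussIntegral (by fun_prop)
      ⟨∫ y in Ioi (0 : ℝ), ‖q₀ y‖, fun k => ?_⟩) (hasGaussIntegral_halfLineFourier_schwartz q₀ hx)
    rw [norm_mul, norm_exp_I_mul_ofReal, one_mul]
    exact norm_halfLineFourier_le q₀.integrable.integrableOn (by simp)
  have hQ₁ : contourIntegral γ (contourIntegrandQ₁ r₀ q₀ x 0) = 0 := by
    rw [← contourIntegral_exp_mul_halfLineFourier_neg hγ q₀ x]
    refine contourIntegral_congr fun u _ => ?_
    rw [contourIntegrandQ₁_eq_evolveQ, evolveQ_zero]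
  have hQ₂ : contourIntegral γ (contourIntegrandQ₂ g₀ x 0) = 0 := by
    rw [← contourIntegral_zero γ]
    refine contourIntegral_congr fun u _ => ?_
    rw [contourIntegrandQ₂_eq_neg_forcingQ, forcingQ_zero, mul_zero, neg_zero]
  rw [hJ_eq, hQ₁, hQ₂]
  field_simp
  ring

theorem eqOn_Ici_of_eqOn_Ioi {u v : ℝ → ℂ} {a : ℝ} (hu : Continuous u) (hv : Continuous v)
    (h : EqOn u v (Ioi a)) : EqOn u v (Ici a) := by
  simpa only [closure_Ioi] using h.closure hu hv

theorem solR_initial (hγ : IsContourAroundI γ) {x : ℝ} (hx : 0 ≤ x) :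
    solR r₀ q₀ g₀ γ x 0 = r₀ x := by
  have hcont : Continuous fun x => solR r₀ q₀ g₀ γ x 0 :=
    (contDiff_solR hγ).continuous.comp (f := fun x : ℝ => (x, (0 : ℝ))) (by fun_prop)
  exact eqOn_Ici_of_eqOn_Ioi hcont r₀.continuous
    (fun _ hx => (isFormulaValueR_solR hγ hx 0).eq_initial hγ hx) hx

theorem solQ_initial (hγ : IsContourAroundI γ) {x : ℝ} (hx : 0 ≤ x) :
    solQ r₀ q₀ g₀ γ x 0 = q₀ x := by
  have hcont : Continuous fun x => solQ r₀ q₀ g₀ γ x 0 :=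
    (contDiff_solQ hγ).continuous.comp (f := fun x : ℝ => (x, (0 : ℝ))) (by fun_prop)
  exact eqOn_Ici_of_eqOn_Ioi hcont q₀.continuous
    (fun _ hx => (isFormulaValueQ_solQ hγ hx 0).eq_initial hγ hx) hx

/-! ### The boundary value -/

section Boundary

variable {F G : ℂ → ℂ}

theorem deformsToRect_evolveQ_neg (hγ : IsContourAroundI γ)
    (hFc : ContinuousOn (fun k => F (-k)) closedUpper)
    (hFd : DifferentiableOn ℂ (fun k => F (-k)) upper)
    (hGc : ContinuousOn (fun k => G (-k)) closedUpper)
    (hGd : DifferentiableOn ℂ (fun k => G (-k)) upper) (t : ℝ) :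
    DeformsToRect γ (fun k => evolveQ F G t (-k)) := by
  simp only [evolveQ_neg]
  exact deformsToRect_evolveQ hγ hFc.fun_neg hFd.fun_neg hGc hGd t

theorem deformsToRect_tailQ_neg (hγ : IsContourAroundI γ) (r₀ q₀ : 𝓢(ℝ, ℂ)) (t : ℝ) :
    DeformsToRect γ (fun k => tailQ r₀ q₀ t (-k)) :=
  deformsToRect_evolveQ_neg hγ (continuousOn_comp_neg (continuousOn_tailFourier r₀ 6))
    (differentiableOn_comp_neg (differentiableOn_tailFourier r₀ 6))
    (continuousOn_comp_neg (continuousOn_tailFourier q₀ 6))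
    (differentiableOn_comp_neg (differentiableOn_tailFourier q₀ 6)) t

theorem differentiableOn_jetFourier_lower (f : 𝓢(ℝ, ℂ)) (n : ℕ) :
    DifferentiableOn ℂ (jetFourier f n) {k | k.im ≤ 0} :=
  (differentiableOn_jetFourier f n).mono fun _ hk => ne_I_of_im_nonpos hk

theorem deformsToRect_jetQ_neg (hγ : IsContourAroundI γ) (r₀ q₀ : 𝓢(ℝ, ℂ)) (t : ℝ) :
    DeformsToRect γ (fun k => jetQ r₀ q₀ t (-k)) := by
  have hlower : {k : ℂ | k.im < 0} ⊆ {k | k.im ≤ 0} := fun k (hk : k.im < 0) => hk.le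
  exact deformsToRect_evolveQ_neg hγ
    (continuousOn_comp_neg (differentiableOn_jetFourier_lower r₀ 6).continuousOn)
    (differentiableOn_comp_neg ((differentiableOn_jetFourier_lower r₀ 6).mono hlower))
    (continuousOn_comp_neg (differentiableOn_jetFourier_lower q₀ 6).continuousOn)
    (differentiableOn_comp_neg ((differentiableOn_jetFourier_lower q₀ 6).mono hlower)) t

theorem tendsto_mul_tailQ_neg (r₀ q₀ : 𝓢(ℝ, ℂ)) (t : ℝ) :
    Tendsto (fun k => k * tailQ r₀ q₀ t (-k)) upperInfty (𝓝 0) := by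
  have hr : Tendsto (fun k => -tailFourier r₀ 6 (-k)) upperInfty (𝓝 (-0)) :=
    (tendsto_zero_of_mul_tendsto upperInfty_le_cobounded (tendsto_mul_tailFourier_neg r₀ 4)).neg
  simpa only [tailQ, evolveQ_neg, neg_zero, mul_zero, sub_zero] using
    tendsto_mul_evolveQ upperInfty_le_cobounded hr (tendsto_mul_tailFourier_neg q₀ 4) t

-- The tails are holomorphic below the real line only, so the integral is reflected before it is
-- moved to the contour.
theorem fieldQ_tailWaves_zero (hγ : IsContourAroundI γ) (g : ℝ → ℂ) (t : ℝ) :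
    (tailWaves r₀ q₀).fieldQ g 0 t = contourIntegral γ (fun k => tailQ r₀ q₀ t (-k)) := by
  have hint : Integrable fun k : ℝ => tailQ r₀ q₀ t k := by
    simpa [tailQ] using integrable_exp_mul_evolveQ (admissible_tailWaves r₀ q₀) 0 t
  have hfull : Tendsto (fun R : ℝ => ∫ k in (-R)..R, tailQ r₀ q₀ t (-(k : ℂ))) atTop
      (𝓝 (∫ k : ℝ, tailQ r₀ q₀ t k)) := by
    rw [← integral_neg_eq_self (fun k : ℝ => tailQ r₀ q₀ t k)]
    simpa only [ofReal_neg, id_eq] using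
      intervalIntegral_tendsto_integral hint.comp_neg tendsto_neg_atTop_atBot tendsto_id
  rw [tendsto_nhds_unique (tendsto_integral_of_mul_tendsto_zero (deformsToRect_tailQ_neg hγ r₀ q₀ t)
    (tendsto_mul_tailQ_neg r₀ q₀ t)) hfull, tailWaves, fieldQ_lineFamily]
  simp [tailQ]

/-- The amplitude of `q` on the contour at `x = 0`, without the reflected tail, which the line
integral cancels. -/
def boundaryAmplitude (r₀ q₀ g₀ : 𝓢(ℝ, ℂ)) (t : ℝ) (k : ℂ) : ℂ :=
  jetQ r₀ q₀ t k - jetQ r₀ q₀ t (-k) + forcingQ g₀ t k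

theorem boundaryAmplitude_neg (t : ℝ) (k : ℂ) :
    boundaryAmplitude r₀ q₀ g₀ t (-k) = -boundaryAmplitude r₀ q₀ g₀ t k := by
  rw [boundaryAmplitude, boundaryAmplitude, forcingQ_neg, neg_neg]
  ring

theorem deformsToRect_boundaryAmplitude (hγ : IsContourAroundI γ) (t : ℝ) :
    DeformsToRect γ (boundaryAmplitude r₀ q₀ g₀ t) := by
  have hjet : DeformsToRect γ (jetQ r₀ q₀ t) := by
    simpa using deformsToRect_exp_mul_jetQ (r₀ := r₀) (q₀ := q₀) hγ 0 t
  exact (hjet.sub hγ (deformsToRect_jetQ_neg hγ r₀ q₀ t)).add hγ (deformsToRect_forcingQ hγ g₀ t)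

theorem tendsto_mul_boundaryAmplitude (hcompat : q₀ 0 = g₀ 0) (t : ℝ) :
    Tendsto (fun k => k * boundaryAmplitude r₀ q₀ g₀ t k) (Bornology.cobounded ℂ)
      (𝓝 (-2 * I * g₀ t)) := by
  have hjet := tendsto_mul_jetQ r₀ q₀ t
  convert! (hjet.add (hjet.comp tendsto_neg_cobounded)).add (tendsto_mul_forcingQ g₀ t) using 2
  · simp only [boundaryAmplitude, Function.comp_apply]
    ring
  · rw [hcompat]
    ring

theorem fieldQ_contourWaves_zero (hγ : IsContourAroundI γ) (t : ℝ) :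
    (contourWaves r₀ q₀ γ).fieldQ g₀ 0 t = contourIntegral γ (boundaryAmplitude r₀ q₀ g₀ t)
      - contourIntegral γ (fun k => tailQ r₀ q₀ t (-k)) := by
  rw [← hγ.contourIntegral_sub (deformsToRect_boundaryAmplitude hγ t).continuousOn
    (deformsToRect_tailQ_neg hγ r₀ q₀ t).continuousOn, contourWaves, fieldQ_contourFamily]
  refine contourIntegral_congr fun u hu => ?_
  rw [evolveQ_sub_reflect,
    evolveQ_halfLineFourier _ _ _ (neg_im_nonpos (hγ.mem_puncturedUpper hu).1),
    boundaryAmplitude, jetQ]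
  simp only [ofReal_zero, mul_zero, exp_zero]
  ring

theorem solQ_boundary (hγ : IsContourAroundI γ) (hcompat : q₀ 0 = g₀ 0) (t : ℝ) :
    solQ r₀ q₀ g₀ γ 0 t = g₀ t := by
  have hodd : contourIntegral γ (boundaryAmplitude r₀ q₀ g₀ t) = Real.pi * I * (-2 * I * g₀ t) :=
    contourIntegral_of_odd hγ (deformsToRect_boundaryAmplitude hγ t)
      (fun k => boundaryAmplitude_neg t k)
      ((tendsto_mul_boundaryAmplitude hcompat t).mono_left upperInfty_le_cobounded)
  rw [solQ, fieldQ_tailWaves_zero hγ, fieldQ_contourWaves_zero hγ, hodd, add_sub_cancel]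
  field_simp
  linear_combination -(g₀ t) * I_sq

end Boundary

theorem isClassicalSolution_sol (hγ : IsContourAroundI γ) (hcompat : q₀ 0 = g₀ 0) :
    IsClassicalSolution r₀ q₀ g₀ (solR r₀ q₀ g₀ γ) (solQ r₀ q₀ g₀ γ) where
  continuousOn_r := (contDiff_solR hγ).continuous.continuousOn
  continuousOn_q := (contDiff_solQ hγ).continuous.continuousOn
  contDiffOn_r := ((contDiff_solR hγ).of_le (by norm_num)).contDiffOn
  contDiffOn_q := (contDiff_solQ hγ).contDiffOn
  eq_one x t _ _ := (solvesSystem_sol hγ).first_equation x t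
  eq_two x t _ _ := (solvesSystem_sol hγ).second_equation x t
  initial_r _ hx := solR_initial hγ hx
  initial_q _ hx := solQ_initial hγ hx
  boundary_q t _ := solQ_boundary hγ hcompat t

end Boussinesq

end

/-- For `x > 0`, `t ≥ 0` the functions `r`, `q` are (uniquely) given by the formula; their values
on the boundary `x = 0` are the limits as `x → 0+`, by the continuity in `IsClassicalSolution`. -/
theorem mainTheorem1 (r₀ q₀ g₀ : 𝓢(ℝ, ℂ)) (hcompat : q₀ 0 = g₀ 0)
    (γ : ℝ → ℂ) (hγ : Boussinesq.IsContourAroundI γ) :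
    ∃ r q : ℝ → ℝ → ℂ,
      (∀ x t : ℝ, 0 < x → 0 ≤ t →
        Boussinesq.IsFormulaValueR r₀ q₀ g₀ γ x t (r x t) ∧
        Boussinesq.IsFormulaValueQ r₀ q₀ g₀ γ x t (q x t)) ∧
      Boussinesq.IsClassicalSolution r₀ q₀ g₀ r q :=
  ⟨Boussinesq.solR r₀ q₀ g₀ γ, Boussinesq.solQ r₀ q₀ g₀ γ,
    fun _ t hx _ =>
      ⟨Boussinesq.isFormulaValueR_solR hγ hx t, Boussinesq.isFormulaValueQ_solQ hγ hx t⟩,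
    Boussinesq.isClassicalSolution_sol hγ hcompat⟩
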